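/- Let $G$ be an \'etale groupoid, not necessarily Hausdorff, i.e. a topological groupoid whose unit space $G^0$ (with the relative topology) is locally compact Hausdorff and whose range map $r:G\to G^0$ is a local homeomorphism, and assume that $G$ is covered by countably many open bisections (open sets on which $r$ and $s$ are injective). Write $G_x=s^{-1}(x)$, $G^x_x=\{g: s(g)=r(g)=x\}$ and $G^U_x=\{g\in G_x: r(g)\in U\}$. Let $\mathscr C_c(G)$ be the linear span of the functions $f:G\to\mathbb C$ that are continuous and compactly supported on some open bisection and extended by zero, let $\lambda_x(f)\psi(g)=\sum_{h\in G_x}f(gh^{-1})\psi(h)$ for $\psi\in\ell^2(G_x)$, $g\in G_x$, and let $C^*_r(G)$ be the completion of $\mathscr C_c(G)$ in the norm $\|f\|_r=\sup_{x\in G^0}\|\lambda_x(f)\|$. An element $a\in C^*_r(G)$ is viewed as the function $a(g)=\langle\lambda_{s(g)}(a)\delta_{s(g)},\delta_g\rangle$ on $G$, and the singular ideal $J$ consists of all $a\in C^*_r(G)$ for which $s(\{g: a(g)\neq0\})$ is meagre in $G^0$. A unit $x$ is called Hausdorff if for every $h\in G$ with $h\ne x$ the points $x$ and $h$ have disjoint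 neighbourhoods in $G$; let $C$ be the set of Hausdorff units. For $x\in G^0$ let $\mathcal X(x)=\pi_{ess}^{-1}(x)$ be the set of all closed sets $X\subseteq G$ that lie in the closure of $\{\{y\}:y\in C\}$ in the Fell topology on the closed subsets of $G$ and satisfy $X\cap G^0=\{x\}$ (these are subgroups of $G^x_x$). The Fell topology has the basic open sets $\{X: X\cap K=\emptyset,\ X\cap V\neq\emptyset\text{ for all }V\in\mathcal F\}$, with $K$ compact and $\mathcal F$ a finite family of open sets. For $X\in\mathcal X(y)$ and an open bisection $B$, let $1_B*{}$ be the partial isometry of $\ell^2(G_y/X)$ with $1_B*\delta_{hX}=\delta_{bhX}$ if there is a (necessarily unique) $b\in B$ with $s(b)=r(h)$, and $1_B*\delta_{hX}=0$ otherwise. For every $g\in G$ with $s(g)=r(g)$ choose an open bisection $U_g$ containing $g$. For $x\in G^0$, say that the left regular representation $\lambda_{G^x_x}$ is $G$-weakly contained in $\bigoplus_{X\in\mathcal X(x)}\lambda_{G^x_x/X}$ if for every $\epsilon>0$, every finite set $F\subseteq G^x_x\setminus\{x\}$ and every open neighbourhood $U$ of $x$ in $G^0$ with $U\subseteq r(U_g)\cap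 s(U_g)$ for all $g\in F$, there are $n\in\mathbb N$, units $x_1,\dots,x_n\in U$, subgroups $X_i\in\mathcal X(x_i)$ and vectors $\psi_i\in\ell^2(G^U_{x_i}/X_i)\subseteq\ell^2(G_{x_i}/X_i)$ such that $$\sum_{i=1}^n\langle\psi_i,\psi_i\rangle=1\quad\text{and}\quad\Big|\sum_{i=1}^n\langle 1_{U_g}*\psi_i,\psi_i\rangle\Big|\le\epsilon\ \text{ for all }g\in F.$$ Then, whatever the choice of the bisections $U_g$, $J=\{0\}$ if and only if for every $x\in G^0$ the representation $\lambda_{G^x_x}$ is $G$-weakly contained in $\bigoplus_{X\in\mathcal X(x)}\lambda_{G^x_x/X}$. -/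

import Mathlib

open scoped ENNReal Topology

namespace EtaleGpd

universe u

/-! ### Étale groupoids -/

/-- A groupoid, presented through its set of arrows `G`. Objects are identified with their identity
arrows, so source and range are maps `G → G`; the products `g * h` are only meaningful (and only
constrained) for composable pairs, i.e. when `source g = range h`. -/
class ArrowGroupoid (G : Type u) extends Mul G, Inv G where
  source : G → G
  range : G → G
  inv_mul_self : ∀ g : G, g⁻¹ * g = source g
  mul_inv_self : ∀ g : G, g * g⁻¹ = range g
  source_inv : ∀ g : G, source g⁻¹ = range g
  range_inv : ∀ g : G, range g⁻¹ = source g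
  source_source : ∀ g : G, source (source g) = source g
  range_source : ∀ g : G, range (source g) = source g
  source_mul : ∀ g h : G, source g = range h → source (g * h) = source h
  range_mul : ∀ g h : G, source g = range h → range (g * h) = range g
  mul_source : ∀ g : G, g * source g = g
  range_mul_self : ∀ g : G, range g * g = g
  assoc : ∀ g h k : G, source g = range h → source h = range k → g * h * k = g * (h * k)

/-- The unit space `G⁰`, the set of identity arrows. -/
abbrev UnitSpace (G : Type u) [ArrowGroupoid G] : Type u := {x : G // ArrowGroupoid.source x = x}

section Algebra

variable {G : Type u} [ArrowGroupoid G]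

/-- The source map `s : G → G⁰`. -/
def src (g : G) : UnitSpace G := ⟨ArrowGroupoid.source g, ArrowGroupoid.source_source g⟩

/-- The range map `r : G → G⁰`. -/
def rng (g : G) : UnitSpace G :=
  ⟨ArrowGroupoid.range g, by
    have h := ArrowGroupoid.source_source g⁻¹
    rwa [ArrowGroupoid.source_inv] at h⟩

theorem src_eq_rng_iff {g h : G} :
    src g = rng h ↔ ArrowGroupoid.source g = ArrowGroupoid.range h := Subtype.ext_iff

theorem src_val (x : UnitSpace G) : src x.val = x := Subtype.ext x.2

theorem rng_val (x : UnitSpace G) : rng x.val = x := by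
  apply Subtype.ext
  have h := ArrowGroupoid.range_source x.val
  have h2 : ArrowGroupoid.source x.val = x.val := x.2
  rw [h2] at h
  exact h

theorem src_inv (g : G) : src g⁻¹ = rng g := Subtype.ext (ArrowGroupoid.source_inv g)

theorem rng_inv (g : G) : rng g⁻¹ = src g := Subtype.ext (ArrowGroupoid.range_inv g)

theorem src_mul {g h : G} (e : src g = rng h) : src (g * h) = src h :=
  Subtype.ext (ArrowGroupoid.source_mul g h (src_eq_rng_iff.1 e))

theorem rng_mul {g h : G} (e : src g = rng h) : rng (g * h) = rng g :=
  Subtype.ext (ArrowGroupoid.range_mul g h (src_eq_rng_iff.1 e))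

theorem mul_src (g : G) : g * (src g).val = g := ArrowGroupoid.mul_source g

theorem rng_mul_self (g : G) : (rng g).val * g = g := ArrowGroupoid.range_mul_self g

theorem mul_mul_mul {g h k : G} (e : src g = rng h) (e' : src h = rng k) :
    g * h * k = g * (h * k) :=
  ArrowGroupoid.assoc g h k (src_eq_rng_iff.1 e) (src_eq_rng_iff.1 e')

theorem inv_mul_cancel_left {g h : G} (e : src g = rng h) : g⁻¹ * (g * h) = h := by
  rw [← mul_mul_mul (src_inv g) e, ArrowGroupoid.inv_mul_self]
  have h2 := rng_mul_self h
  rw [← e] at h2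
  exact h2

theorem mul_left_cancel {g h k : G} (e : src g = rng h) (e' : src g = rng k)
    (eq : g * h = g * k) : h = k := by
  rw [← inv_mul_cancel_left e, eq, inv_mul_cancel_left e']

theorem inv_inj' {g h : G} (eq : g⁻¹ = h⁻¹) : g = h := by
  have key : ∀ k : G, k⁻¹⁻¹ = k := by
    intro k
    have h1 : k⁻¹⁻¹ * (k⁻¹ * k) = k := inv_mul_cancel_left (src_inv k |>.trans rfl)
    rw [ArrowGroupoid.inv_mul_self] at h1
    have h2 := mul_src k⁻¹⁻¹
    rw [src_inv, rng_inv] at h2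
    exact h2.symm.trans h1
  rw [← key g, eq, key h]

/-- `G_x = s⁻¹(x)`. -/
abbrev Fiber (x : UnitSpace G) : Type u := {g : G // src g = x}

/-- The isotropy group `G^x_x`, as a set of arrows. -/
def isotropy (x : UnitSpace G) : Set G := {g | src g = x ∧ rng g = x}

/-- The left translate `g A = {g a : a ∈ A}`. -/
def translate (g : G) (A : Set G) : Set G := (fun a => g * a) '' A

theorem translate_translate {b h : G} {A : Set G} (e : src b = rng h)
    (hA : ∀ a ∈ A, src h = rng a) : translate (b * h) A = translate b (translate h A) := by
  unfold translate
  rw [Set.image_image]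
  exact Set.image_congr fun a ha => mul_mul_mul e (hA a ha)

theorem rng_of_mem_translate {h k : G} {A : Set G} (hA : ∀ a ∈ A, src h = rng a)
    (hk : k ∈ translate h A) : rng k = rng h := by
  obtain ⟨a, ha, rfl⟩ := hk
  exact rng_mul (hA a ha)

end Algebra

/-- A (not necessarily Hausdorff) étale groupoid with locally compact Hausdorff unit space: the
product (on composable pairs) and the inverse are continuous, and the range map `r : G → G⁰` is a
local homeomorphism, where `G⁰ ⊆ G` carries the relative topology. -/
class EtaleGroupoid (G : Type u) [TopologicalSpace G] [ArrowGroupoid G] : Prop where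
  continuous_mul : Continuous fun p : {p : G × G // src p.1 = rng p.2} => p.1.1 * p.1.2
  continuous_inv : Continuous fun g : G => g⁻¹
  isLocalHomeomorph_rng : IsLocalHomeomorph (rng : G → UnitSpace G)
  t2Space_unitSpace : T2Space (UnitSpace G)
  locallyCompactSpace_unitSpace : LocallyCompactSpace (UnitSpace G)

/-- An open bisection: an open set on which `s` and `r` are injective. -/
structure OpenBisection (G : Type u) [TopologicalSpace G] [ArrowGroupoid G] where
  carrier : Set G
  isOpen : IsOpen carrier
  injOn_src : Set.InjOn (src : G → UnitSpace G) carrier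
  injOn_rng : Set.InjOn (rng : G → UnitSpace G) carrier

/-- `G` is covered by countably many open bisections. -/
def CountablyCovered (G : Type u) [TopologicalSpace G] [ArrowGroupoid G] : Prop :=
  ∃ U : ℕ → OpenBisection G, ⋃ n, (U n).carrier = Set.univ

/-! ### Weighted partial permutations on `ℓ²` -/

/-- The Hilbert space `ℓ²(ι)`. -/
abbrev L2 (ι : Type u) : Type u := lp (fun _ : ι => ℂ) 2

section PartialPerm

variable {ι : Type u}

open Classical in
/-- For a relation `R` that is the graph of a partial injection `i ↦ j` and weights `w`, the
function with value `w j * ψ i` at the image `j` of `i`, and zero at points that are no images. -/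
noncomputable def relFun (R : ι → ι → Prop) (w : ι → ℂ) (ψ : ι → ℂ) (j : ι) : ℂ :=
  if h : ∃ i, R i j then w j * ψ h.choose else 0

variable {R : ι → ι → Prop} {w : ι → ℂ}

theorem relFun_of_rel (hinj : ∀ i i' j, R i j → R i' j → i = i') (ψ : ι → ℂ) {i j : ι}
    (h : R i j) : relFun R w ψ j = w j * ψ i := by
  have h' : ∃ i, R i j := ⟨i, h⟩
  rw [relFun, dif_pos h', hinj _ _ _ h'.choose_spec h]

theorem relFun_of_not (ψ : ι → ℂ) {j : ι} (h : ¬ ∃ i, R i j) : relFun R w ψ j = 0 := dif_neg h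

theorem sum_relFun_le (hfun : ∀ i j j', R i j → R i j' → j = j') {M : ℝ} (hM : 0 ≤ M)
    (hw : ∀ j, ‖w j‖ ≤ M) (ψ : L2 ι) (t : Finset ι) :
    ∑ j ∈ t, ‖relFun R w ψ j‖ ^ (2 : ℝ≥0∞).toReal ≤ (M * ‖ψ‖) ^ (2 : ℝ≥0∞).toReal := by
  classical
  have h2 : (2 : ℝ≥0∞).toReal = (2 : ℕ) := by norm_num
  simp only [h2, Real.rpow_natCast]
  let c : ι → ι := fun j => if h : ∃ i, R i j then h.choose else j
  let t' := t.filter fun j => ∃ i, R i j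
  have hc : ∀ j ∈ t', R (c j) j := by
    intro j hj
    have h := (Finset.mem_filter.1 hj).2
    simp only [c, dif_pos h]
    exact h.choose_spec
  have hcinj : Set.InjOn c t' := by
    intro j hj j' hj' e
    have h1 := hc j hj
    rw [e] at h1
    exact hfun _ _ _ h1 (hc j' hj')
  calc ∑ j ∈ t, ‖relFun R w ψ j‖ ^ 2 = ∑ j ∈ t', ‖relFun R w ψ j‖ ^ 2 := by
        refine (Finset.sum_subset (Finset.filter_subset _ _) ?_).symm
        intro j hj hj'
        have : ¬ ∃ i, R i j := fun h => hj' (Finset.mem_filter.2 ⟨hj, h⟩)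
        rw [relFun_of_not _ this]; simp
    _ ≤ ∑ j ∈ t', M ^ 2 * ‖ψ (c j)‖ ^ 2 := by
        refine Finset.sum_le_sum fun j hj => ?_
        have h := (Finset.mem_filter.1 hj).2
        have : relFun R w ψ j = w j * ψ (c j) := by simp only [relFun, c, dif_pos h]
        rw [this, norm_mul, mul_pow]
        gcongr
        exact hw j
    _ = M ^ 2 * ∑ i ∈ t'.image c, ‖ψ i‖ ^ 2 := by
        rw [Finset.sum_image hcinj, Finset.mul_sum]
    _ ≤ M ^ 2 * ‖ψ‖ ^ 2 := by
        gcongr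
        have := lp.sum_rpow_le_norm_rpow (p := 2) (by norm_num) ψ (t'.image c)
        simpa only [h2, Real.rpow_natCast] using this
    _ = (M * ‖ψ‖) ^ 2 := by ring

/-- The bounded operator on `ℓ²(ι)` given by a partial injection of `ι` and bounded weights. -/
noncomputable def relOp (R : ι → ι → Prop) (w : ι → ℂ)
    (hfun : ∀ i j j', R i j → R i j' → j = j') (M : ℝ) (hM : 0 ≤ M) (hw : ∀ j, ‖w j‖ ≤ M) :
    L2 ι →L[ℂ] L2 ι :=
  LinearMap.mkContinuous
    { toFun := fun ψ => ⟨relFun R w ψ, memℓp_gen' (sum_relFun_le hfun hM hw ψ)⟩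
      map_add' := by
        intro φ ψ
        ext j
        change relFun R w (φ + ψ : L2 ι) j = relFun R w φ j + relFun R w ψ j
        by_cases h : ∃ i, R i j
        · simp only [relFun, dif_pos h, lp.coeFn_add, Pi.add_apply, mul_add]
        · simp only [relFun, dif_neg h, add_zero]
      map_smul' := by
        intro c ψ
        ext j
        change relFun R w (c • ψ : L2 ι) j = c * relFun R w ψ j
        by_cases h : ∃ i, R i j
        · simp only [relFun, dif_pos h, lp.coeFn_smul, Pi.smul_apply, smul_eq_mul]
          ring
        · simp only [relFun, dif_neg h, mul_zero] }
    M fun ψ => lp.norm_le_of_forall_sum_le (by norm_num) (by positivity)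
      (sum_relFun_le hfun hM hw ψ)

theorem relOp_apply (hfun : ∀ i j j', R i j → R i j' → j = j') (M : ℝ) (hM : 0 ≤ M)
    (hw : ∀ j, ‖w j‖ ≤ M) (ψ : L2 ι) (j : ι) : relOp R w hfun M hM hw ψ j = relFun R w ψ j := rfl

theorem norm_relOp_le (hfun : ∀ i j j', R i j → R i j' → j = j') (M : ℝ) (hM : 0 ≤ M)
    (hw : ∀ j, ‖w j‖ ≤ M) : ‖relOp R w hfun M hM hw‖ ≤ M :=
  LinearMap.mkContinuous_norm_le _ hM _

end PartialPerm

section Reduced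

variable (G : Type u) [TopologicalSpace G] [ArrowGroupoid G]

/-! ### The reduced C*-algebra and its singular ideal -/

/-- `𝒞_c(G)`, the span of the functions that are continuous and compactly supported on some open
bisection `U`, extended by zero off `U`. -/
def Cc : Submodule ℂ (G → ℂ) :=
  Submodule.span ℂ {f | ∃ U : OpenBisection G, Continuous (U.carrier.domRestrict f) ∧
    HasCompactSupport (U.carrier.domRestrict f) ∧ ∀ g ∉ U.carrier, f g = 0}

/-- The `ℓ^∞`-product of the C*-algebras `B(ℓ²(G_x))`, `x ∈ G⁰`, with norm `‖T‖ = sup_x ‖T_x‖`. -/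
abbrev FiberOperators : Type u :=
  lp (fun x : UnitSpace G => L2 (Fiber x) →L[ℂ] L2 (Fiber x)) ∞

/-- `T_x ψ = f * ψ` for all units `x` and all `ψ ∈ ℓ²(G_x)`, where
`(f * ψ)(g) = ∑_{h ∈ G_x} f(g h⁻¹) ψ(h)`. -/
def IsConvolution (f : G → ℂ) (T : FiberOperators G) : Prop :=
  ∀ (x : UnitSpace G) (ψ : L2 (Fiber x)) (g : Fiber x),
    HasSum (fun h : Fiber x => f (g.1 * h.1⁻¹) * ψ h) (T x ψ g)

set_option synthInstance.maxHeartbeats 400000 in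
noncomputable instance instNormedSpaceFiberOperators : NormedSpace ℂ (FiberOperators G) :=
  inferInstance

noncomputable instance instModuleFiberOperators : Module ℂ (FiberOperators G) :=
  NormedSpace.toModule

noncomputable instance instSMulFiberOperators : SMul ℂ (FiberOperators G) :=
  (instModuleFiberOperators G).toSMul

variable {G}

theorem IsConvolution.unique {f : G → ℂ} {S T : FiberOperators G} (hS : IsConvolution G f S)
    (hT : IsConvolution G f T) : S = T := by
  ext x : 2
  refine ContinuousLinearMap.ext fun ψ => ?_
  ext g
  exact (hS x ψ g).unique (hT x ψ g)

theorem IsConvolution.add {f f' : G → ℂ} {S T : FiberOperators G} (hS : IsConvolution G f S)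
    (hT : IsConvolution G f' T) : IsConvolution G (f + f') (S + T) := by
  intro x ψ g
  change HasSum (fun h : Fiber x => (f (g.1 * h.1⁻¹) + f' (g.1 * h.1⁻¹)) * ψ h)
    (S x ψ g + T x ψ g)
  simpa only [add_mul] using (hS x ψ g).add (hT x ψ g)

theorem IsConvolution.smul {f : G → ℂ} {T : FiberOperators G} (c : ℂ) (hT : IsConvolution G f T) :
    IsConvolution G (c • f) (c • T) := by
  intro x ψ g
  change HasSum (fun h : Fiber x => (c * f (g.1 * h.1⁻¹)) * ψ h) (c * T x ψ g)
  simpa only [mul_assoc] using (hT x ψ g).mul_left c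

theorem exists_isConvolution (f : G → ℂ) (hf : f ∈ Cc G) : ∃ T, IsConvolution G f T := by
  refine Submodule.span_induction ?_ ?_ ?_ ?_ hf
  · rintro f ⟨U, hcont, hsupp, hzero⟩
    obtain ⟨M, hM⟩ := hsupp.exists_bound_of_continuous hcont
    have hM' : ∀ g, ‖f g‖ ≤ max M 0 := by
      intro g
      by_cases hg : g ∈ U.carrier
      · exact (hM ⟨g, hg⟩).trans (le_max_left _ _)
      · rw [hzero g hg]; simp
    classical
    let R : ∀ x : UnitSpace G, Fiber x → Fiber x → Prop := fun x h g => g.1 * h.1⁻¹ ∈ U.carrier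
    have hcomp : ∀ (x : UnitSpace G) (g h : Fiber x), src g.1 = rng h.1⁻¹ := by
      intro x g h
      rw [rng_inv, g.2, h.2]
    have hinj : ∀ x, ∀ h h' g, R x h g → R x h' g → h = h' := by
      intro x h h' g H H'
      have e := U.injOn_rng H H' (by rw [rng_mul (hcomp x g h), rng_mul (hcomp x g h')])
      exact Subtype.ext (inv_inj' (mul_left_cancel (hcomp x g h) (hcomp x g h') e))
    have hfun : ∀ x, ∀ h g g', R x h g → R x h g' → g = g' := by
      intro x h g g' H H'
      have e := U.injOn_src H H' (by rw [src_mul (hcomp x g h), src_mul (hcomp x g' h)])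
      have key : ∀ k : Fiber x, k.1 * h.1⁻¹ * h.1 = k.1 := by
        intro k
        rw [mul_mul_mul (hcomp x k h) (src_inv _), ArrowGroupoid.inv_mul_self]
        have h3 := mul_src k.1
        have h4 : src k.1 = src h.1 := k.2.trans h.2.symm
        rw [h4] at h3
        exact h3
      apply Subtype.ext
      rw [← key g, e, key g']
    let w : ∀ x : UnitSpace G, Fiber x → ℂ := fun x g =>
      if h : ∃ h, R x h g then f (g.1 * h.choose.1⁻¹) else 0
    have hw : ∀ x g, ‖w x g‖ ≤ max M 0 := by
      intro x g
      simp only [w]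
      split_ifs
      · exact hM' _
      · simp
    refine ⟨⟨fun x => relOp (R x) (w x) (hfun x) (max M 0) (le_max_right _ _) (hw x),
      memℓp_infty ⟨max M 0, ?_⟩⟩, ?_⟩
    · rintro _ ⟨x, rfl⟩
      exact norm_relOp_le _ _ _ _
    · intro x ψ g
      change HasSum _ (relFun (R x) (w x) ψ g)
      by_cases h : ∃ h, R x h g
      · have e : relFun (R x) (w x) ψ g = f (g.1 * h.choose.1⁻¹) * ψ h.choose := by
          simp only [relFun, w, dif_pos h]
        rw [e]
        refine hasSum_single h.choose fun h' hne => ?_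
        rw [hzero, zero_mul]
        exact fun H => hne (hinj x _ _ _ H h.choose_spec)
      · rw [relFun_of_not _ h]
        convert hasSum_zero using 2 with h'
        rw [hzero, zero_mul]
        exact fun H => h ⟨h', H⟩
  · refine ⟨0, fun x ψ g => ?_⟩
    change HasSum (fun h : Fiber x => (0 : ℂ) * ψ h) 0
    simp only [zero_mul]
    exact hasSum_zero
  · rintro f f' - - ⟨S, hS⟩ ⟨T, hT⟩
    exact ⟨S + T, hS.add hT⟩
  · rintro c f - ⟨T, hT⟩
    exact ⟨c • T, hT.smul c⟩

variable (G)

/-- The map `f ↦ (λ_x(f))_{x ∈ G⁰}`, where `λ_x(f) ψ = f * ψ` on `ℓ²(G_x)`. -/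
noncomputable def regularRep : Cc G →ₗ[ℂ] FiberOperators G where
  toFun f := (exists_isConvolution f.1 f.2).choose
  map_add' f f' := (exists_isConvolution _ (f + f').2).choose_spec.unique
    ((exists_isConvolution f.1 f.2).choose_spec.add (exists_isConvolution f'.1 f'.2).choose_spec)
  map_smul' c f := (exists_isConvolution _ (c • f).2).choose_spec.unique
    ((exists_isConvolution f.1 f.2).choose_spec.smul c)

theorem regularRep_spec (f : Cc G) : IsConvolution G f.1 (regularRep G f) :=
  (exists_isConvolution f.1 f.2).choose_spec

/-- The reduced C*-algebra `C*_r(G)`: the completion of `𝒞_c(G)` in the reduced norm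
`‖f‖_r = sup_x ‖λ_x(f)‖`, i.e. the closure of the image of `𝒞_c(G)` under the (isometric)
embedding `f ↦ (λ_x(f))_x` into the `ℓ^∞`-product of the algebras `B(ℓ²(G_x))`. -/
noncomputable def reducedAlgebra : Submodule ℂ (FiberOperators G) :=
  (LinearMap.range (regularRep G)).topologicalClosure

variable {G}

/-- The function on `G` defined by `a ∈ C*_r(G)`: `a(g) = ⟨λ_{s(g)}(a) δ_{s(g)}, δ_g⟩`, the
coordinate at `g` of the vector `λ_{s(g)}(a) δ_{s(g)}`. -/
noncomputable def toFunction (a : FiberOperators G) (g : G) : ℂ :=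
  open Classical in
  a (src g) (lp.single 2 (⟨(src g).val, src_val _⟩ : Fiber (src g)) 1) ⟨g, rfl⟩

theorem toFunction_add (a b : FiberOperators G) (g : G) :
    toFunction (a + b) g = toFunction a g + toFunction b g := rfl

theorem toFunction_smul (c : ℂ) (a : FiberOperators G) (g : G) :
    toFunction (c • a) g = c * toFunction a g := rfl

variable (G)

/-- The singular ideal `J` of `C*_r(G)`: the elements `a` for which `s({g : a(g) ≠ 0})` is meagre
in `G⁰`. -/
noncomputable def singularIdeal : Submodule ℂ (reducedAlgebra G) where
  carrier := {a | IsMeagre (src '' {g : G | toFunction a.1 g ≠ 0})}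
  zero_mem' := by
    have : src '' {g : G | toFunction (0 : FiberOperators G) g ≠ 0} = ∅ := by
      rw [Set.image_eq_empty]
      ext g
      simp only [Set.mem_ofPred_eq, Set.mem_empty_iff_false, iff_false, not_not]
      rfl
    change IsMeagre (src '' {g : G | toFunction (0 : FiberOperators G) g ≠ 0})
    rw [this]
    exact IsMeagre.empty
  add_mem' := by
    intro a b ha hb
    refine IsMeagre.mono ?_ (ha.union hb)
    rw [← Set.image_union]
    refine Set.image_mono fun g hg => ?_
    by_contra hcon
    simp only [Set.mem_union, Set.mem_ofPred_eq, not_or, not_not] at hcon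
    apply hg
    change toFunction (a.1 + b.1) g = 0
    rw [toFunction_add, hcon.1, hcon.2, add_zero]
  smul_mem' := by
    intro c a ha
    refine IsMeagre.mono ?_ ha
    refine Set.image_mono fun g hg hcon => hg ?_
    change toFunction (c • a.1) g = 0
    rw [toFunction_smul, hcon, mul_zero]

/-! ### The essential Hausdorff cover over a unit -/

/-- The Fell topology on the closed subsets of a space. -/
@[reducible] def fellTopology (Y : Type u) [TopologicalSpace Y] : TopologicalSpace (TopologicalSpace.Closeds Y) :=
  TopologicalSpace.generateFrom
    {𝒰 | ∃ (C : Set Y) (F : Set (Set Y)), IsCompact C ∧ F.Finite ∧ (∀ V ∈ F, IsOpen V) ∧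
      𝒰 = {X : TopologicalSpace.Closeds Y | (X : Set Y) ∩ C = ∅ ∧
        ∀ V ∈ F, ((X : Set Y) ∩ V).Nonempty}}

/-- The Hausdorff units: those `x ∈ G⁰` that can be separated in `G` from every other arrow. -/
def hausdorffUnits : Set (UnitSpace G) := {x | ∀ h : G, h ≠ x.val → Disjoint (𝓝 x.val) (𝓝 h)}

variable {G}

/-- `𝒳(x) = π_ess⁻¹(x)`: the closed sets `X` in the Fell closure of the set of singletons of
Hausdorff units with `X ∩ G⁰ = {x}`. -/
def essFiber (x : UnitSpace G) : Set (TopologicalSpace.Closeds G) :=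
  {X | X ∈ @closure _ (fellTopology G)
      {Z : TopologicalSpace.Closeds G | ∃ y ∈ hausdorffUnits G, (Z : Set G) = {y.val}} ∧
    (X : Set G) ∩ Set.range (Subtype.val : UnitSpace G → G) = {x.val}}

theorem val_mem_of_mem_essFiber {x : UnitSpace G} (X : essFiber x) : x.val ∈ (X.1 : Set G) := by
  have h : x.val ∈ (X.1 : Set G) ∩ Set.range (Subtype.val : UnitSpace G → G) := by rw [X.2.2]; rfl
  exact h.1

theorem mem_isotropy_aux [EtaleGroupoid G] {x : UnitSpace G} (X : essFiber x) {p : G → UnitSpace G}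
    (hp : Continuous p) (hpx : ∀ y : UnitSpace G, p y.val = y) {g : G} (hg : g ∈ (X.1 : Set G)) :
    p g = x := by
  by_contra hne
  have := EtaleGroupoid.t2Space_unitSpace (G := G)
  obtain ⟨V, W, hV, hW, hgV, hxW, hVW⟩ := t2_separation hne
  have hopen : IsOpen[fellTopology G] {Z : TopologicalSpace.Closeds G | (Z : Set G) ∩ ∅ = ∅ ∧
      ∀ A ∈ ({p ⁻¹' V, p ⁻¹' W} : Set (Set G)), ((Z : Set G) ∩ A).Nonempty} := by
    refine TopologicalSpace.isOpen_generateFrom_of_mem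
      ⟨∅, {p ⁻¹' V, p ⁻¹' W}, isCompact_empty, Set.toFinite _, ?_, rfl⟩
    rintro A (rfl | rfl)
    · exact hV.preimage hp
    · exact hW.preimage hp
  have hmem : X.1 ∈ {Z : TopologicalSpace.Closeds G | (Z : Set G) ∩ ∅ = ∅ ∧
      ∀ A ∈ ({p ⁻¹' V, p ⁻¹' W} : Set (Set G)), ((Z : Set G) ∩ A).Nonempty} := by
    refine ⟨Set.inter_empty _, ?_⟩
    rintro A (rfl | rfl)
    · exact ⟨g, hg, hgV⟩
    · refine ⟨x.val, val_mem_of_mem_essFiber X, ?_⟩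
      change p x.val ∈ W
      rwa [hpx]
  obtain ⟨Z, hZ, y, -, hy⟩ := (@mem_closure_iff _ (fellTopology G) _ _).1 X.2.1 _ hopen hmem
  obtain ⟨a, ha, haV⟩ := hZ.2 (p ⁻¹' V) (Or.inl rfl)
  obtain ⟨b, hb, hbW⟩ := hZ.2 (p ⁻¹' W) (Or.inr rfl)
  rw [hy] at ha hb
  rw [Set.mem_singleton_iff] at ha hb
  subst ha
  subst hb
  exact Set.disjoint_left.1 hVW haV hbW

theorem rng_of_mem_essFiber [EtaleGroupoid G] {x : UnitSpace G} (X : essFiber x) {g : G}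
    (hg : g ∈ (X.1 : Set G)) : rng g = x :=
  mem_isotropy_aux X EtaleGroupoid.isLocalHomeomorph_rng.continuous rng_val hg

/-! ### Coset spaces and the action of open bisections -/

/-- The set of cosets `G_x / X = {h X : h ∈ G_x}`, for `X ∈ 𝒳(x)`. -/
abbrev CosetSpace {x : UnitSpace G} (X : essFiber x) : Type u :=
  {Y : Set G // ∃ h : G, src h = x ∧ Y = translate h (X.1 : Set G)}

/-- `Y` is the translate of the coset `Z` by an element of `B`: there are `b ∈ B` and `h ∈ G_x` with
`s(b) = r(h)`, `Z = h X` and `Y = b h X`. -/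
def MovesTo {x : UnitSpace G} {X : essFiber x} (B : OpenBisection G) (Z Y : CosetSpace X) : Prop :=
  ∃ b ∈ B.carrier, ∃ h : G, src h = x ∧ src b = rng h ∧
    Z.1 = translate h (X.1 : Set G) ∧ Y.1 = translate (b * h) (X.1 : Set G)

section Action

variable [EtaleGroupoid G] {x : UnitSpace G} {X : essFiber x}

theorem rng_eq_of_translate_eq {h h' : G} (e : src h = x) (e' : src h' = x)
    (eq : translate h (X.1 : Set G) = translate h' (X.1 : Set G)) : rng h = rng h' := by
  have hm : h * x.val ∈ translate h' (X.1 : Set G) := by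
    rw [← eq]
    exact ⟨_, val_mem_of_mem_essFiber X, rfl⟩
  have h1 := rng_of_mem_translate (fun a ha => by rw [e', rng_of_mem_essFiber X ha]) hm
  rwa [rng_mul (by rw [e, rng_val])] at h1

theorem MovesTo.right_unique (B : OpenBisection G) (Z Y Y' : CosetSpace X) (H : MovesTo B Z Y)
    (H' : MovesTo B Z Y') : Y = Y' := by
  obtain ⟨b, hb, h, e1, e2, e3, e4⟩ := H
  obtain ⟨b', hb', h', e1', e2', e3', e4'⟩ := H'
  have hr := rng_eq_of_translate_eq e1 e1' (e3.symm.trans e3')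
  have hbb : b = b' := B.injOn_src hb hb' (by rw [e2, e2', hr])
  subst hbb
  apply Subtype.ext
  rw [e4, e4', translate_translate e2 fun a ha => by rw [e1, rng_of_mem_essFiber X ha],
    translate_translate e2' fun a ha => by rw [e1', rng_of_mem_essFiber X ha], ← e3, ← e3']

theorem MovesTo.left_unique (B : OpenBisection G) (Z Z' Y : CosetSpace X) (H : MovesTo B Z Y)
    (H' : MovesTo B Z' Y) : Z = Z' := by
  obtain ⟨b, hb, h, e1, e2, e3, e4⟩ := H
  obtain ⟨b', hb', h', e1', e2', e3', e4'⟩ := H'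
  have hr := rng_eq_of_translate_eq ((src_mul e2).trans e1) ((src_mul e2').trans e1')
    (e4.symm.trans e4')
  rw [rng_mul e2, rng_mul e2'] at hr
  have hbb : b = b' := B.injOn_rng hb hb' hr
  subst hbb
  have key : ∀ k : G, src k = x → src b = rng k →
      translate b⁻¹ (translate (b * k) (X.1 : Set G)) = translate k (X.1 : Set G) := by
    intro k hk hbk
    rw [← translate_translate (by rw [src_inv, rng_mul hbk]) fun a ha => by
      rw [src_mul hbk, hk, rng_of_mem_essFiber X ha], inv_mul_cancel_left hbk]
  apply Subtype.ext
  rw [e3, e3', ← key h e1 e2, ← key h' e1' e2', ← e4, ← e4']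

/-- The partial isometry `ψ ↦ 1_B * ψ` of `ℓ²(G_x/X)`: it maps `δ_{hX}` to `δ_{bhX}` if there is a
(necessarily unique) `b ∈ B` with `s(b) = r(h)`, and to `0` otherwise. -/
noncomputable def bisectionOp (B : OpenBisection G) (X : essFiber x) :
    L2 (CosetSpace X) →L[ℂ] L2 (CosetSpace X) :=
  relOp (MovesTo B) (fun _ => 1) (MovesTo.right_unique B) 1 zero_le_one (fun _ => by simp)

open Classical in
theorem bisectionOp_single_of_movesTo (B : OpenBisection G) {Z Y : CosetSpace X}
    (H : MovesTo B Z Y) : bisectionOp B X (lp.single 2 Z 1) = lp.single 2 Y 1 := by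
  ext Y'
  rw [bisectionOp, relOp_apply]
  by_cases hY : Y' = Y
  · subst hY
    rw [relFun_of_rel (MovesTo.left_unique B) _ H]
    simp
  · rw [lp.single_apply_ne _ _ _ hY]
    by_cases h : ∃ Z', MovesTo B Z' Y'
    · obtain ⟨Z', h⟩ := h
      rw [relFun_of_rel (MovesTo.left_unique B) _ h, lp.single_apply_ne, mul_zero]
      rintro rfl
      exact hY (MovesTo.right_unique B _ _ _ h H)
    · exact relFun_of_not _ h

open Classical in
theorem bisectionOp_single_of_not (B : OpenBisection G) {Z : CosetSpace X}
    (H : ¬ ∃ Y, MovesTo B Z Y) : bisectionOp B X (lp.single 2 Z 1) = 0 := by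
  ext Y'
  rw [bisectionOp, relOp_apply]
  by_cases h : ∃ Z', MovesTo B Z' Y'
  · obtain ⟨Z', h⟩ := h
    rw [relFun_of_rel (MovesTo.left_unique B) _ h, lp.single_apply_ne, mul_zero]
    · rfl
    · rintro rfl
      exact H ⟨_, h⟩
  · exact relFun_of_not _ h

/-- `λ_{G^x_x}` is `G`-weakly contained in `λ_{G^x_x/𝒳(x)}` (with respect to the chosen open
bisections `B g`, of which only those for `g ∈ G^x_x` matter). The vectors `ψ i` lie in
`ℓ²(G^U_{y i} / X i)`, i.e. they are vectors in `ℓ²(G_{y i} / X i)` that are supported on the cosets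
of elements with range in `U`. -/
def IsGWeaklyContained (B : G → OpenBisection G) (x : UnitSpace G) : Prop :=
  ∀ ε : ℝ, 0 < ε → ∀ F : Finset G, (F : Set G) ⊆ isotropy x \ {x.val} →
    ∀ U : Set (UnitSpace G), IsOpen U → x ∈ U →
      (∀ g ∈ F, U ⊆ rng '' (B g).carrier ∩ src '' (B g).carrier) →
      ∃ (n : ℕ) (y : Fin n → UnitSpace G) (X : ∀ i, essFiber (y i))
        (ψ : ∀ i, L2 (CosetSpace (X i))),
        (∀ i, y i ∈ U) ∧
        (∀ i, ∀ Y : CosetSpace (X i), ψ i Y ≠ 0 → ∀ k ∈ Y.1, rng k ∈ U) ∧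
        ∑ i, inner ℂ (ψ i) (ψ i) = 1 ∧
        ∀ g ∈ F, ‖∑ i, inner ℂ (ψ i) (bisectionOp (B g) (X i) (ψ i))‖ ≤ ε

end Action

end Reduced

end EtaleGpd

/-!
Write `C` for the set of Hausdorff units. Since `G` is covered by countably many open bisections,
`C` is comeagre, hence dense, and it is invariant; functions in `𝒞_c(G)` are continuous at the
arrows over `C`, so `J` is the kernel of `⨁_{c ∈ C} λ_c` (`mem_singularIdeal_iff`).

*Weak containment implies `J = 0`.* The singleton of a Hausdorff unit `c` is the trivial subgroup
of `G_c^c`, and a set `X ∈ 𝒳(y)` is a limit of such singletons in the Fell topology. Along such a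
limit the matrix coefficients of `λ_c` converge to those of the quasi-regular representation on
`ℓ²(G_y/X)`, because whether `c` lies in an open bisection containing an isotropy element `γ` is
eventually decided by whether `γ ∈ X`. Hence the norm of `f ∈ 𝒞_c(G)` on `ℓ²(G_y/X)` is at most
`sup_{c ∈ C} ‖λ_c(f)‖` (`norm_inner_cosetOp_le`). Let `a ∈ J`, and let `f = ∑ f_k` be close to `a`,
with each `f_k` supported on a bisection. On vectors supported over a small neighbourhood of `x`,
each `f_k` acts almost like a multiple of the identity, of some `1_{U_g}` with `g ≠ x` in the
isotropy group at `x`, or of zero, and the multiple of the identity is `f_k(x)`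
(`IsCoefficient.exists_nhds_norm_inner_le`). On the vectors provided by weak containment the terms
with `1_{U_g}` are negligible, so that `f(x)`, up to a small error, is a value `∑ i, ⟨ψ i, f ψ i⟩`,
which is small since `λ_c(a) = 0` for `c ∈ C`. Thus `a(x) = 0` for all units `x`, and translating
by functions on bisections gives `a = 0`.

*`J = 0` implies weak containment.* If `J = 0`, an element of the reduced C*-algebra that is
positive in all `λ_c`, `c ∈ C`, is positive, since its negative part lies in `J`. By the
Hahn–Banach theorem the vector functional of `δ_x` in `λ_x` is a pointwise limit of sums of vector
functionals of representations `λ_c` with `c ∈ C` (`exists_norm_sum_inner_sub_lt`). Evaluating at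
the products `φ²` and `φ 1_{U_g} φ`, with a bump function `φ` at `x` supported in `U`, and
translating `c` into `U` by an arrow, yields the required vectors, with the trivial subgroups `{y}`
as elements of `𝒳(y)`, `y ∈ C ∩ U` (`exists_inner_bisectionOp_eq`).
-/

set_option linter.unusedSectionVars false

namespace EtaleGpd

universe u

/-! ### Groupoid algebra -/

section Algebra

variable {G : Type u} [ArrowGroupoid G]

theorem inv_inv_self (k : G) : k⁻¹⁻¹ = k := by
  have h1 : k⁻¹⁻¹ * (k⁻¹ * k) = k := inv_mul_cancel_left (src_inv k)
  rw [ArrowGroupoid.inv_mul_self] at h1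
  have h2 := mul_src k⁻¹⁻¹
  rw [src_inv, rng_inv] at h2
  exact h2.symm.trans h1

theorem inv_mul_eq_src (g : G) : g⁻¹ * g = (src g).val := ArrowGroupoid.inv_mul_self g

theorem mul_inv_eq_rng (g : G) : g * g⁻¹ = (rng g).val := ArrowGroupoid.mul_inv_self g

theorem mul_unit {g : G} {x : UnitSpace G} (e : src g = x) : g * x.val = g := by
  subst e; exact mul_src g

theorem unit_mul {g : G} {x : UnitSpace G} (e : rng g = x) : x.val * g = g := by
  subst e; exact rng_mul_self g

theorem mul_inv_cancel_right {g h : G} (e : src g = rng h) : g * h * h⁻¹ = g := by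
  rw [mul_mul_mul e (rng_inv h).symm, mul_inv_eq_rng, mul_unit e]

theorem inv_mul_cancel_right {g h : G} (e : src g = src h) : g * h⁻¹ * h = g := by
  rw [mul_mul_mul (e.trans (rng_inv h).symm) (src_inv h), inv_mul_eq_src, mul_unit e]

theorem mul_inv_cancel_left {g h : G} (e : rng g = rng h) : g * (g⁻¹ * h) = h := by
  rw [← mul_mul_mul (rng_inv g).symm ((src_inv g).trans e), mul_inv_eq_rng, unit_mul e.symm]

theorem unit_inv (x : UnitSpace G) : x.val⁻¹ = x.val := by
  have h := mul_inv_eq_rng x.val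
  rw [rng_val] at h
  rwa [unit_mul (by rw [rng_inv, src_val])] at h

theorem mul_inv_rev {g h : G} (e : src g = rng h) : (g * h)⁻¹ = h⁻¹ * g⁻¹ := by
  have e1 : src h⁻¹ = rng g⁻¹ := by rw [src_inv, rng_inv, e]
  refine mul_left_cancel (g := g * h) (by rw [rng_inv]) (by rw [rng_mul e1, rng_inv, src_mul e]) ?_
  rw [mul_inv_eq_rng, rng_mul e, mul_mul_mul e (by rw [rng_mul e1, rng_inv]),
    mul_inv_cancel_left (by rw [rng_inv, e]), mul_inv_eq_rng]

theorem eq_src_of_mem_units {g : G} (hg : g ∈ Set.range (Subtype.val : UnitSpace G → G)) :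
    g = (src g).val := by
  obtain ⟨x, rfl⟩ := hg
  rw [src_val]

theorem eq_rng_of_mem_units {g : G} (hg : g ∈ Set.range (Subtype.val : UnitSpace G → G)) :
    g = (rng g).val := by
  obtain ⟨x, rfl⟩ := hg
  rw [rng_val]

end Algebra

/-! ### Open bisections and their sections -/

section Topology

variable {G : Type u} [TopologicalSpace G] [ArrowGroupoid G] [EtaleGroupoid G]

instance : T2Space (UnitSpace G) := EtaleGroupoid.t2Space_unitSpace

instance : LocallyCompactSpace (UnitSpace G) := EtaleGroupoid.locallyCompactSpace_unitSpace

theorem continuous_rng : Continuous (rng : G → UnitSpace G) :=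
  EtaleGroupoid.isLocalHomeomorph_rng.continuous

theorem isOpenMap_rng : IsOpenMap (rng : G → UnitSpace G) :=
  EtaleGroupoid.isLocalHomeomorph_rng.isOpenMap

theorem continuous_arrowInv : Continuous (fun g : G => g⁻¹) := EtaleGroupoid.continuous_inv

theorem continuous_src : Continuous (src : G → UnitSpace G) := by
  have : (src : G → UnitSpace G) = rng ∘ fun g : G => g⁻¹ := funext fun g => (rng_inv g).symm
  rw [this]
  exact continuous_rng.comp continuous_arrowInv

theorem isOpenMap_src : IsOpenMap (src : G → UnitSpace G) := by
  intro W hW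
  have : src '' W = rng '' ((fun g : G => g⁻¹) ⁻¹' W) := by
    ext x
    constructor
    · rintro ⟨g, hg, rfl⟩
      exact ⟨g⁻¹, by simpa only [Set.mem_preimage, inv_inv_self] using hg, rng_inv g⟩
    · rintro ⟨g, hg, rfl⟩
      exact ⟨g⁻¹, hg, src_inv g⟩
  rw [this]
  exact isOpenMap_rng _ (hW.preimage continuous_arrowInv)

/-- The unit space of an étale groupoid is open: it is the set where the identity and `g ↦ r(g)`
agree, and both of these are lifts of the locally injective map `r`. -/
theorem isOpen_units : IsOpen (Set.range (Subtype.val : UnitSpace G → G)) := by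
  have h := (EtaleGroupoid.isLocalHomeomorph_rng (G := G)).isLocallyInjective.isOpen_eqLocus
    (g₁ := id) (g₂ := fun g => (rng g).val) continuous_id
    (continuous_subtype_val.comp continuous_rng) (funext fun g => (rng_val (rng g)).symm)
  convert h using 1
  ext g
  exact ⟨eq_rng_of_mem_units, fun hg => ⟨rng g, hg.symm⟩⟩

theorem isOpenEmbedding_unit_val :
    Topology.IsOpenEmbedding (Subtype.val : UnitSpace G → G) :=
  ⟨Topology.IsEmbedding.subtypeVal, isOpen_units⟩

/-- The product of composable arrows converges along convergent arrows. -/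
theorem tendsto_arrowMul {α : Type*} {l : Filter α} {f g : α → G} {a b : G}
    (hf : Filter.Tendsto f l (𝓝 a)) (hg : Filter.Tendsto g l (𝓝 b))
    (h : ∀ᶠ t in l, src (f t) = rng (g t)) (hab : src a = rng b) :
    Filter.Tendsto (fun t => f t * g t) l (𝓝 (a * b)) := by
  have hc : ContinuousOn (fun p : G × G => p.1 * p.2) {p : G × G | src p.1 = rng p.2} :=
    continuousOn_iff_continuous_domRestrict.2 EtaleGroupoid.continuous_mul
  have h1 : Filter.Tendsto (fun p : G × G => p.1 * p.2)
      (𝓝[{p : G × G | src p.1 = rng p.2}] (a, b)) (𝓝 (a * b)) := hc (a, b) hab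
  exact h1.comp (tendsto_nhdsWithin_iff.2 ⟨hf.prodMk_nhds hg, h⟩)

theorem tendsto_arrowInv {α : Type*} {l : Filter α} {f : α → G} {a : G}
    (hf : Filter.Tendsto f l (𝓝 a)) : Filter.Tendsto (fun t => (f t)⁻¹) l (𝓝 a⁻¹) :=
  (continuous_arrowInv.tendsto a).comp hf

namespace OpenBisection

/-- The unit space as an open bisection. -/
def unit (G : Type u) [TopologicalSpace G] [ArrowGroupoid G] [EtaleGroupoid G] :
    OpenBisection G where
  carrier := Set.range (Subtype.val : UnitSpace G → G)
  isOpen := isOpen_units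
  injOn_src := by
    intro g hg h hh e
    rw [eq_src_of_mem_units hg, eq_src_of_mem_units hh, e]
  injOn_rng := by
    intro g hg h hh e
    rw [eq_rng_of_mem_units hg, eq_rng_of_mem_units hh, e]

theorem val_mem_unit (x : UnitSpace G) : x.val ∈ (unit G).carrier := ⟨x, rfl⟩

/-- The open bisection `U⁻¹`. -/
def inv (U : OpenBisection G) : OpenBisection G where
  carrier := (fun g => g⁻¹) ⁻¹' U.carrier
  isOpen := U.isOpen.preimage continuous_arrowInv
  injOn_src := by
    intro g hg h hh e
    exact inv_inj' (U.injOn_rng hg hh (by rw [rng_inv, rng_inv, e]))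
  injOn_rng := by
    intro g hg h hh e
    exact inv_inj' (U.injOn_src hg hh (by rw [src_inv, src_inv, e]))

theorem mem_inv {U : OpenBisection G} {g : G} : g ∈ U.inv.carrier ↔ g⁻¹ ∈ U.carrier := Iff.rfl

theorem inv_mem_inv {U : OpenBisection G} {g : G} (hg : g ∈ U.carrier) : g⁻¹ ∈ U.inv.carrier := by
  rwa [mem_inv, inv_inv_self]

open Classical in
/-- The inverse of `r : U → r(U)`, with junk value the unit `t` outside `r(U)`. -/
noncomputable def sec (U : OpenBisection G) (t : UnitSpace G) : G :=
  if h : ∃ u ∈ U.carrier, rng u = t then h.choose else t.val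

theorem sec_rng (U : OpenBisection G) {u : G} (hu : u ∈ U.carrier) : U.sec (rng u) = u := by
  have h : ∃ v ∈ U.carrier, rng v = rng u := ⟨u, hu, rfl⟩
  rw [sec, dif_pos h]
  exact U.injOn_rng h.choose_spec.1 hu h.choose_spec.2

theorem sec_mem (U : OpenBisection G) {t : UnitSpace G} (ht : t ∈ rng '' U.carrier) :
    U.sec t ∈ U.carrier := by
  obtain ⟨u, hu, rfl⟩ := ht
  rwa [sec_rng U hu]

/-- `sec` is a section of `r` even at its junk values. -/
theorem rng_sec (U : OpenBisection G) (t : UnitSpace G) : rng (U.sec t) = t := by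
  by_cases h : ∃ u ∈ U.carrier, rng u = t
  · rw [sec, dif_pos h]
    exact h.choose_spec.2
  · rw [sec, dif_neg h, rng_val]

theorem isOpen_rng_image (U : OpenBisection G) : IsOpen (rng '' U.carrier) :=
  isOpenMap_rng _ U.isOpen

theorem isOpen_src_image (U : OpenBisection G) : IsOpen (src '' U.carrier) :=
  isOpenMap_src _ U.isOpen

theorem continuousAt_sec (U : OpenBisection G) {t : UnitSpace G} (ht : t ∈ rng '' U.carrier) :
    ContinuousAt U.sec t := by
  obtain ⟨u, hu, rfl⟩ := ht
  intro W hW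
  rw [sec_rng U hu] at hW
  obtain ⟨O, hOW, hO, huO⟩ := mem_nhds_iff.1 hW
  have h : rng '' (U.carrier ∩ O) ∈ 𝓝 (rng u) :=
    (isOpenMap_rng _ (U.isOpen.inter hO)).mem_nhds ⟨u, ⟨hu, huO⟩, rfl⟩
  refine Filter.mem_map.2 (Filter.mem_of_superset h ?_)
  rintro _ ⟨v, ⟨hv, hvO⟩, rfl⟩
  change U.sec (rng v) ∈ W
  rw [sec_rng U hv]
  exact hOW hvO

/-- The inverse of `s : U → s(U)`, with junk value the unit `t` outside `s(U)`. -/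
noncomputable def srcSec (U : OpenBisection G) (t : UnitSpace G) : G := (U.inv.sec t)⁻¹

theorem rng_image_inv (U : OpenBisection G) : rng '' U.inv.carrier = src '' U.carrier := by
  ext t
  constructor
  · rintro ⟨g, hg, rfl⟩
    exact ⟨g⁻¹, hg, src_inv g⟩
  · rintro ⟨g, hg, rfl⟩
    exact ⟨g⁻¹, inv_mem_inv hg, rng_inv g⟩

theorem srcSec_src (U : OpenBisection G) {u : G} (hu : u ∈ U.carrier) : U.srcSec (src u) = u := by
  rw [srcSec, ← rng_inv, sec_rng _ (inv_mem_inv hu), inv_inv_self]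

theorem srcSec_mem (U : OpenBisection G) {t : UnitSpace G} (ht : t ∈ src '' U.carrier) :
    U.srcSec t ∈ U.carrier := by
  obtain ⟨u, hu, rfl⟩ := ht
  rwa [srcSec_src U hu]

theorem src_srcSec (U : OpenBisection G) (t : UnitSpace G) : src (U.srcSec t) = t := by
  rw [srcSec, src_inv, rng_sec]

theorem continuousAt_srcSec (U : OpenBisection G) {t : UnitSpace G} (ht : t ∈ src '' U.carrier) :
    ContinuousAt U.srcSec t := by
  rw [← rng_image_inv] at ht
  exact continuous_arrowInv.continuousAt.comp (U.inv.continuousAt_sec ht)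

/-- The open bisection `U V = {u v : u ∈ U, v ∈ V, s(u) = r(v)}`, encoded through `v = u⁻¹ g`. -/
def mul (U V : OpenBisection G) : OpenBisection G where
  carrier := {g | ∃ u ∈ U.carrier, rng u = rng g ∧ u⁻¹ * g ∈ V.carrier}
  isOpen := by
    rw [isOpen_iff_mem_nhds]
    rintro g ⟨u, hu, hr, hv⟩
    have ht : rng g ∈ rng '' U.carrier := ⟨u, hu, hr⟩
    have h1 : Filter.Tendsto (fun k : G => U.sec (rng k)) (𝓝 g) (𝓝 (U.sec (rng g))) :=
      (U.continuousAt_sec ht).tendsto.comp (continuous_rng.tendsto g)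
    have h2 := tendsto_arrowMul (tendsto_arrowInv h1) Filter.tendsto_id
      (Filter.Eventually.of_forall fun k => by rw [src_inv, rng_sec]; rfl)
      (by rw [src_inv, rng_sec])
    have hu' : U.sec (rng g) = u := by rw [← hr, sec_rng U hu]
    rw [hu'] at h2
    filter_upwards [h2 (V.isOpen.mem_nhds hv),
      (continuous_rng.tendsto g) (U.isOpen_rng_image.mem_nhds ht)] with k hk hk'
    exact ⟨U.sec (rng k), U.sec_mem hk', U.rng_sec _, hk⟩
  injOn_src := by
    rintro g ⟨u, hu, hr, hv⟩ g' ⟨u', hu', hr', hv'⟩ e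
    have e1 : src u⁻¹ = rng g := by rw [src_inv, hr]
    have e2 : src u'⁻¹ = rng g' := by rw [src_inv, hr']
    have h := V.injOn_src hv hv' (by rw [src_mul e1, src_mul e2, e])
    have h3 : u = u' := by
      apply U.injOn_src hu hu'
      have := congrArg rng h
      rwa [rng_mul e1, rng_mul e2, rng_inv, rng_inv] at this
    subst h3
    exact mul_left_cancel e1 e2 h
  injOn_rng := by
    rintro g ⟨u, hu, hr, hv⟩ g' ⟨u', hu', hr', hv'⟩ e
    have h3 : u = u' := U.injOn_rng hu hu' (by rw [hr, hr', e])
    subst h3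
    have e1 : src u⁻¹ = rng g := by rw [src_inv, hr]
    have e2 : src u⁻¹ = rng g' := by rw [src_inv, hr']
    exact mul_left_cancel e1 e2 (V.injOn_rng hv hv' (by rw [rng_mul e1, rng_mul e2]))

theorem mul_mem_mul {U V : OpenBisection G} {u v : G} (hu : u ∈ U.carrier) (hv : v ∈ V.carrier)
    (e : src u = rng v) : u * v ∈ (U.mul V).carrier :=
  ⟨u, hu, (rng_mul e).symm, by rwa [inv_mul_cancel_left e]⟩

theorem exists_of_mem_mul {U V : OpenBisection G} {g : G} (hg : g ∈ (U.mul V).carrier) :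
    ∃ u ∈ U.carrier, ∃ v ∈ V.carrier, src u = rng v ∧ g = u * v := by
  obtain ⟨u, hu, hr, hv⟩ := hg
  refine ⟨u, hu, _, hv, ?_, (mul_inv_cancel_left hr).symm⟩
  rw [rng_mul (by rw [src_inv, hr]), rng_inv]

/-- Compact neighbourhoods inside open bisections. -/
theorem exists_isCompact_subset (U : OpenBisection G) {g : G} (hg : g ∈ U.carrier) {N : Set G}
    (hN : IsOpen N) (hgN : g ∈ N) :
    ∃ K : Set G, IsCompact K ∧ K ⊆ U.carrier ∩ N ∧ rng '' K ∈ 𝓝 (rng g) := by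
  have hO : rng '' (U.carrier ∩ N) ∈ 𝓝 (rng g) :=
    (isOpenMap_rng _ (U.isOpen.inter hN)).mem_nhds ⟨g, ⟨hg, hgN⟩, rfl⟩
  obtain ⟨L, hL, hLO, hLc⟩ := local_compact_nhds hO
  refine ⟨U.sec '' L, hLc.image_of_continuousOn ?_, ?_, ?_⟩
  · intro t ht
    exact (U.continuousAt_sec (Set.image_mono Set.inter_subset_left (hLO ht))).continuousWithinAt
  · rintro _ ⟨t, ht, rfl⟩
    obtain ⟨u, hu, rfl⟩ := hLO ht
    rwa [sec_rng U hu.1]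
  · rw [Set.image_image]
    simpa only [rng_sec, Set.image_id'] using hL

end OpenBisection

theorem CountablyCovered.exists_mem (hG : CountablyCovered G) (g : G) :
    ∃ U : OpenBisection G, g ∈ U.carrier := by
  obtain ⟨U, hU⟩ := hG
  have h : g ∈ ⋃ n, (U n).carrier := by rw [hU]; trivial
  obtain ⟨n, hn⟩ := Set.mem_iUnion.1 h
  exact ⟨U n, hn⟩

/-! ### Hausdorff units -/

/-- The units contained in `U`, as an open subset of the unit space. -/
def OpenBisection.units (U : OpenBisection G) : Set (UnitSpace G) := {t | t.val ∈ U.carrier}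

theorem OpenBisection.isOpen_unitsSet (U : OpenBisection G) : IsOpen U.units :=
  U.isOpen.preimage continuous_subtype_val

/-- If a Hausdorff unit `x` is a limit of units in `U`, then no arrow of `U` over `x` differs
from `x`. -/
theorem eq_of_mem_hausdorffUnits {x : UnitSpace G} (hx : x ∈ hausdorffUnits G)
    {U : OpenBisection G} {u : G} (hu : u ∈ U.carrier) (hr : rng u = x)
    (hcl : x ∈ closure U.units) : u = x.val := by
  by_contra hne
  obtain ⟨A, hA, A', hA', hdisj⟩ := Filter.disjoint_iff.1 (hx u hne)
  obtain ⟨O, hOA, hO, huO⟩ := mem_nhds_iff.1 hA'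
  have h1 : rng '' (U.carrier ∩ O) ∈ 𝓝 x :=
    (isOpenMap_rng _ (U.isOpen.inter hO)).mem_nhds ⟨u, ⟨hu, huO⟩, hr⟩
  have h2 : Subtype.val ⁻¹' A ∈ 𝓝 x := continuous_subtype_val.continuousAt hA
  obtain ⟨t, ⟨⟨v, ⟨hv, hvO⟩, rfl⟩, ht2⟩, ht3⟩ :=
    mem_closure_iff_nhds.1 hcl _ (Filter.inter_mem h1 h2)
  have : (rng v).val = v := U.injOn_rng ht3 hv (by rw [rng_val])
  rw [Set.mem_preimage, this] at ht2
  exact Set.disjoint_left.1 hdisj ht2 (hOA hvO)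

/-- Converse of `eq_of_mem_hausdorffUnits`, for a cover of `G` by bisections: a unit `x` is
Hausdorff if no bisection in the cover whose set of units accumulates at `x` has another arrow
over `x`. -/
theorem mem_hausdorffUnits_of_forall {ι : Type*} {U : ι → OpenBisection G}
    (hU : ⋃ i, (U i).carrier = Set.univ) {x : UnitSpace G}
    (hx : ∀ i, ∀ u ∈ (U i).carrier, rng u = x → x ∈ closure (U i).units → u = x.val) :
    x ∈ hausdorffUnits G := by
  intro h hne
  have hmem : h ∈ ⋃ i, (U i).carrier := by rw [hU]; trivial
  obtain ⟨i, hi⟩ := Set.mem_iUnion.1 hmem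
  by_cases hr : rng h = x
  · have hcl : x ∉ closure (U i).units := fun hcl => hne (hx i h hi hr hcl)
    rw [mem_closure_iff_nhds] at hcl
    push Not at hcl
    obtain ⟨N, hN, hNe⟩ := hcl
    refine Filter.disjoint_iff.2 ⟨Subtype.val '' N, isOpenEmbedding_unit_val.image_mem_nhds.2 hN,
      (U i).carrier, (U i).isOpen.mem_nhds hi, Set.disjoint_left.2 ?_⟩
    rintro _ ⟨t, ht, rfl⟩ htU
    have : t ∈ N ∩ (U i).units := ⟨ht, htU⟩
    rw [hNe] at this
    exact this
  · refine (continuous_rng.tendsto x.val).disjoint ?_ (continuous_rng.tendsto h)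
    rw [rng_val]
    exact disjoint_nhds_nhds.2 (Ne.symm hr)

/-- Units that are not Hausdorff lie in the boundary of `Uₙ ∩ G⁰` for one of the countably many
bisections `Uₙ` that cover `G`. -/
theorem isMeagre_compl_hausdorffUnits (hG : CountablyCovered G) :
    IsMeagre (hausdorffUnits G)ᶜ := by
  obtain ⟨U, hU⟩ := hG
  have h : ∀ n, IsMeagre (frontier (U n).units) := fun n =>
    IsNowhereDense.isMeagre <| by
      rw [IsClosed.isNowhereDense_iff isClosed_frontier]
      rw [← frontier_compl]
      exact interior_frontier (U n).isOpen_unitsSet.isClosed_compl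
  refine (isMeagre_iUnion h).mono fun x hx => ?_
  by_contra hcon
  simp only [Set.mem_iUnion, not_exists] at hcon
  refine hx (mem_hausdorffUnits_of_forall hU fun n u hu hr hcl => ?_)
  have hxU : x ∈ (U n).units := by
    by_contra hxU
    exact hcon n ⟨hcl, by rwa [(U n).isOpen_unitsSet.interior_eq]⟩
  exact (U n).injOn_rng hu hxU (by rw [hr, rng_val])

theorem dense_hausdorffUnits (hG : CountablyCovered G) : Dense (hausdorffUnits G) := by
  have h := isMeagre_compl_hausdorffUnits hG
  rw [IsMeagre, compl_compl] at h
  exact dense_of_mem_residual h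

/-- The set of Hausdorff units is invariant: an arrow `u` over `r(h)` that cannot be separated from
`r(h)` is conjugated by `h` to an arrow that cannot be separated from `s(h)`. -/
theorem rng_mem_hausdorffUnits (hG : CountablyCovered G) {h : G}
    (hh : src h ∈ hausdorffUnits G) : rng h ∈ hausdorffUnits G := by
  obtain ⟨H, hH⟩ := hG.exists_mem h
  obtain ⟨U, hU⟩ := hG
  refine mem_hausdorffUnits_of_forall hU fun n u hu hr hcl => ?_
  -- The source of `u` is a limit of sources of the units that accumulate at `r(u)`.
  have hus : src u = rng u := by
    have hcl' := hcl
    by_contra hne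
    have h1 : Filter.Tendsto (fun t => src ((U n).sec t)) (𝓝 (rng u)) (𝓝 (src u)) := by
      have := (continuous_src.tendsto _).comp ((U n).continuousAt_sec ⟨u, hu, rfl⟩).tendsto
      rwa [(U n).sec_rng hu] at this
    rw [← hr] at hcl'
    obtain ⟨A, A', hA, hA', hsA, hrA, hd⟩ := t2_separation hne
    obtain ⟨t, ⟨ht1, ht2⟩, ht3⟩ := mem_closure_iff_nhds.1 hcl' _
      (Filter.inter_mem (h1 (hA.mem_nhds hsA)) (hA'.mem_nhds hrA))
    have : (U n).sec t = t.val := by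
      conv_lhs => rw [← rng_val t]
      exact (U n).sec_rng ht3
    rw [Set.mem_preimage, this, src_val] at ht1
    exact Set.disjoint_left.1 hd ht1 ht2
  have e1 : src h⁻¹ = rng u := by rw [src_inv, hr]
  have e2 : src u = rng h := by rw [hus, hr]
  have hV : h⁻¹ * u * h ∈ ((H.inv.mul (U n)).mul H).carrier :=
    OpenBisection.mul_mem_mul (OpenBisection.mul_mem_mul (OpenBisection.inv_mem_inv hH) hu e1) hH
      (by rw [src_mul e1, e2])
  have hcl2 : src h ∈ closure ((H.inv.mul (U n)).mul H).units := by
    rw [mem_closure_iff_nhds]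
    intro N hN
    have h1 : Filter.Tendsto (fun t => src (H.sec t)) (𝓝 (rng h)) (𝓝 (src h)) := by
      have := (continuous_src.tendsto _).comp (H.continuousAt_sec ⟨h, hH, rfl⟩).tendsto
      rwa [H.sec_rng hH] at this
    obtain ⟨t, ⟨ht1, ht2⟩, ht3⟩ := mem_closure_iff_nhds.1 hcl _
      (Filter.inter_mem (h1 hN) (H.isOpen_rng_image.mem_nhds ⟨h, hH, rfl⟩))
    refine ⟨src (H.sec t), ht1, ?_⟩
    change (src (H.sec t)).val ∈ ((H.inv.mul (U n)).mul H).carrier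
    have h5 : (H.sec t)⁻¹ * t.val = (H.sec t)⁻¹ := mul_unit (by rw [src_inv, H.rng_sec])
    rw [← inv_mul_eq_src, ← h5]
    refine OpenBisection.mul_mem_mul (OpenBisection.mul_mem_mul
      (OpenBisection.inv_mem_inv (H.sec_mem ht2)) ht3 ?_) (H.sec_mem ht2) ?_
    · rw [src_inv, H.rng_sec, rng_val]
    · rw [h5, src_inv]
  have key := eq_of_mem_hausdorffUnits hh hV
    (by rw [rng_mul (by rw [src_mul e1, e2]), rng_mul e1, rng_inv]) hcl2
  -- Conjugating `h⁻¹ * u * h = s(h)` back by `h` gives `u = r(h)`.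
  have h6 : h⁻¹ * u * h = h⁻¹ * h := by rw [key, inv_mul_eq_src]
  rw [mul_mul_mul e1 e2] at h6
  have h7 : u * h = h := mul_left_cancel (by rw [src_inv, rng_mul e2, hr]) (src_inv h) h6
  have h8 := mul_inv_cancel_right e2
  rwa [h7, mul_inv_eq_rng, eq_comm] at h8

/-- Over a Hausdorff unit, the complement of a bisection `U` is a neighbourhood of each arrow that
has the same range as an arrow of `U` but is not in `U`. -/
theorem eventually_notMem_of_src_mem_hausdorffUnits (hG : CountablyCovered G) {g : G}
    (hg : src g ∈ hausdorffUnits G) {U : OpenBisection G} (hr : rng g ∈ rng '' U.carrier)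
    (hgU : g ∉ U.carrier) : ∀ᶠ k in 𝓝 g, k ∉ U.carrier := by
  obtain ⟨u, hu, hur⟩ := hr
  obtain ⟨W, hW⟩ := hG.exists_mem g
  have hne : g ≠ u := fun e => hgU (e ▸ hu)
  by_cases hs : src u = src g
  · -- Left multiplication by `g⁻¹` reduces this case to `eq_of_mem_hausdorffUnits`.
    have e1 : src g⁻¹ = rng u := by rw [src_inv, hur]
    have hm : g⁻¹ * u ∈ (W.inv.mul U).carrier :=
      OpenBisection.mul_mem_mul (OpenBisection.inv_mem_inv hW) hu e1
    have hcl : src g ∉ closure (W.inv.mul U).units := by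
      intro hcl
      have h := eq_of_mem_hausdorffUnits hg hm (by rw [rng_mul e1, rng_inv]) hcl
      rw [← inv_mul_eq_src] at h
      exact hne (mul_left_cancel e1 (src_inv g) h).symm
    have h1 := (continuous_src.tendsto g) (isClosed_closure.isOpen_compl.mem_nhds hcl)
    filter_upwards [h1, W.isOpen.mem_nhds hW] with k hk hkW hkU
    refine hk (subset_closure ?_)
    change (src k).val ∈ (W.inv.mul U).carrier
    rw [← inv_mul_eq_src]
    exact OpenBisection.mul_mem_mul (OpenBisection.inv_mem_inv hkW) hkU (src_inv k)
  · have h1 : Filter.Tendsto (fun k => src (U.sec (rng k))) (𝓝 g) (𝓝 (src u)) := by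
      have := (continuous_src.tendsto _).comp ((U.continuousAt_sec ⟨u, hu, rfl⟩).tendsto.comp
        (hur ▸ continuous_rng.tendsto g))
      rwa [U.sec_rng hu] at this
    obtain ⟨A, A', hA, hA', hsA, hrA, hd⟩ := t2_separation hs
    filter_upwards [h1 (hA.mem_nhds hsA), (continuous_src.tendsto g) (hA'.mem_nhds hrA)]
      with k hk hk' hkU
    rw [Set.mem_preimage, U.sec_rng hkU] at hk
    exact Set.disjoint_left.1 hd hk hk'

theorem isClosed_singleton_of_mem_hausdorffUnits {x : UnitSpace G} (hx : x ∈ hausdorffUnits G) :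
    IsClosed ({x.val} : Set G) := by
  rw [← isOpen_compl_iff, isOpen_iff_mem_nhds]
  intro h hne
  obtain ⟨A, hA, A', hA', hd⟩ := Filter.disjoint_iff.1 (hx h hne)
  refine Filter.mem_of_superset hA' fun k hk e => ?_
  rw [Set.mem_singleton_iff] at e
  subst e
  exact Set.disjoint_left.1 hd (mem_of_mem_nhds hA) hk

/-- For a Hausdorff unit `x`, the set `{x}` belongs to `𝒳(x)`. -/
def singletonEssFiber {x : UnitSpace G} (hx : x ∈ hausdorffUnits G) : essFiber x :=
  ⟨⟨{x.val}, isClosed_singleton_of_mem_hausdorffUnits hx⟩,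
    @subset_closure _ (fellTopology G) _ _ ⟨x, hx, rfl⟩, by
      ext g
      simp only [TopologicalSpace.Closeds.coe_mk, Set.mem_inter_iff, Set.mem_singleton_iff]
      exact ⟨fun h => h.1, fun h => ⟨h, x, h.symm⟩⟩⟩

end Topology

/-! ### Functions supported on a bisection -/

section BisectionFunctions

variable {G : Type u} [TopologicalSpace G] [ArrowGroupoid G] [EtaleGroupoid G]

open Classical in
/-- The function on `G` supported on the bisection `U` that is given there by `θ ∘ r`. -/
noncomputable def bisFun (U : OpenBisection G) (θ : UnitSpace G → ℂ) (g : G) : ℂ :=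
  if g ∈ U.carrier then θ (rng g) else 0

/-- `θ` is a continuous function on the unit space with compact support in `r(U)`, so that
`bisFun U θ` is continuous and compactly supported on `U`. -/
structure IsCoefficient (U : OpenBisection G) (θ : UnitSpace G → ℂ) : Prop where
  continuous : Continuous θ
  compact : HasCompactSupport θ
  tsupport_subset : tsupport θ ⊆ rng '' U.carrier

theorem bisFun_of_mem {U : OpenBisection G} {θ : UnitSpace G → ℂ} {g : G} (hg : g ∈ U.carrier) :
    bisFun U θ g = θ (rng g) := if_pos hg

theorem bisFun_of_notMem {U : OpenBisection G} {θ : UnitSpace G → ℂ} {g : G}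
    (hg : g ∉ U.carrier) : bisFun U θ g = 0 := if_neg hg

theorem IsCoefficient.eq_zero {U : OpenBisection G} {θ : UnitSpace G → ℂ} (h : IsCoefficient U θ)
    {t : UnitSpace G} (ht : t ∉ rng '' U.carrier) : θ t = 0 :=
  image_eq_zero_of_notMem_tsupport fun h' => ht (h.tsupport_subset h')

theorem IsCoefficient.exists_bound {U : OpenBisection G} {θ : UnitSpace G → ℂ}
    (h : IsCoefficient U θ) : ∃ M : ℝ, 0 ≤ M ∧ ∀ t, ‖θ t‖ ≤ M := by
  obtain ⟨M, hM⟩ := h.compact.exists_bound_of_continuous h.continuous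
  exact ⟨max M 0, le_max_right _ _, fun t => (hM t).trans (le_max_left _ _)⟩

theorem IsCoefficient.const_mul {U : OpenBisection G} {θ : UnitSpace G → ℂ}
    (h : IsCoefficient U θ) (c : ℂ) : IsCoefficient U (fun t => c * θ t) where
  continuous := continuous_const.mul h.continuous
  compact := h.compact.mul_left
  tsupport_subset := (tsupport_mul_subset_right (f := fun _ => c)).trans h.tsupport_subset

theorem OpenBisection.isOpenEmbedding_rng (U : OpenBisection G) :
    Topology.IsOpenEmbedding (U.carrier.domRestrict rng : U.carrier → UnitSpace G) :=
  .of_continuous_injective_isOpenMap (continuous_rng.comp continuous_subtype_val)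
    (Set.injOn_iff_injective.1 U.injOn_rng) (isOpenMap_rng.comp U.isOpen.isOpenMap_subtype_val)

theorem IsCoefficient.bisFun_mem_Cc {U : OpenBisection G} {θ : UnitSpace G → ℂ}
    (h : IsCoefficient U θ) : bisFun U θ ∈ Cc G := by
  refine Submodule.subset_span ⟨U, ?_, ?_, fun g hg => bisFun_of_notMem hg⟩
  all_goals
    have e : U.carrier.domRestrict (bisFun U θ) = θ ∘ U.carrier.domRestrict rng :=
      funext fun g => bisFun_of_mem g.2
    rw [e]
  · exact h.continuous.comp U.isOpenEmbedding_rng.continuous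
  · have hK : IsCompact (U.carrier.domRestrict rng ⁻¹' tsupport θ) := by
      rw [U.isOpenEmbedding_rng.isInducing.isCompact_iff, Set.image_preimage_eq_of_subset]
      · exact h.compact
      · intro t ht
        obtain ⟨u, hu, rfl⟩ := h.tsupport_subset ht
        exact ⟨⟨u, hu⟩, rfl⟩
    exact HasCompactSupport.intro' hK
      ((isClosed_tsupport θ).preimage U.isOpenEmbedding_rng.continuous)
      fun g hg => image_eq_zero_of_notMem_tsupport (f := θ) hg

theorem exists_isCoefficient {U : OpenBisection G} {f : G → ℂ}
    (hc : Continuous (U.carrier.domRestrict f)) (hs : HasCompactSupport (U.carrier.domRestrict f))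
    (hf : ∀ g ∉ U.carrier, f g = 0) : ∃ θ, IsCoefficient U θ ∧ f = bisFun U θ := by
  classical
  let θ : UnitSpace G → ℂ := fun t => if t ∈ rng '' U.carrier then f (U.sec t) else 0
  have hθ : ∀ u : U.carrier, θ (rng u.1) = f u.1 := fun u => by
    simp only [θ]
    rw [if_pos ⟨u.1, u.2, rfl⟩, U.sec_rng u.2]
  let K : Set (UnitSpace G) := U.carrier.domRestrict rng '' tsupport (U.carrier.domRestrict f)
  have hK : IsCompact K := IsCompact.image hs U.isOpenEmbedding_rng.continuous
  have hKU : K ⊆ rng '' U.carrier := by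
    rintro _ ⟨u, -, rfl⟩
    exact ⟨u.1, u.2, rfl⟩
  have hθK : ∀ t ∉ K, θ t = 0 := by
    intro t ht
    by_cases htU : t ∈ rng '' U.carrier
    · obtain ⟨u, hu, rfl⟩ := htU
      rw [hθ ⟨u, hu⟩]
      exact image_eq_zero_of_notMem_tsupport (f := U.carrier.domRestrict f) (x := ⟨u, hu⟩)
        fun h => ht ⟨_, h, rfl⟩
    · exact if_neg htU
  refine ⟨θ, ⟨?_, HasCompactSupport.intro hK hθK, ?_⟩, ?_⟩
  · rw [continuous_iff_continuousAt]
    intro t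
    by_cases htU : t ∈ rng '' U.carrier
    · obtain ⟨u, hu, rfl⟩ := htU
      have : ContinuousAt (θ ∘ U.carrier.domRestrict rng) ⟨u, hu⟩ := by
        have e : θ ∘ U.carrier.domRestrict rng = U.carrier.domRestrict f := funext hθ
        rw [e]
        exact hc.continuousAt
      exact (U.isOpenEmbedding_rng.continuousAt_iff).1 this
    · have h0 : θ =ᶠ[𝓝 t] fun _ => 0 := by
        filter_upwards [hK.isClosed.isOpen_compl.mem_nhds fun h => htU (hKU h)] with t' ht'
        exact hθK t' ht'
      exact continuousAt_const.congr h0.symm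
  · refine (closure_minimal ?_ hK.isClosed).trans hKU
    intro t ht
    by_contra hcon
    exact ht (hθK t hcon)
  · funext g
    by_cases hg : g ∈ U.carrier
    · rw [bisFun_of_mem hg, hθ ⟨g, hg⟩]
    · rw [bisFun_of_notMem hg, hf g hg]

theorem Cc_eq_span :
    Cc G = Submodule.span ℂ {f | ∃ U θ, IsCoefficient U θ ∧ f = bisFun U θ} := by
  apply le_antisymm
  · refine Submodule.span_mono ?_
    rintro f ⟨U, hc, hs, hf⟩
    exact ⟨U, exists_isCoefficient hc hs hf⟩
  · rw [Submodule.span_le]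
    rintro _ ⟨U, θ, h, rfl⟩
    exact h.bisFun_mem_Cc

/-- Elements of `𝒞_c(G)` are finite sums of functions supported on bisections. -/
theorem exists_eq_sum_bisFun {f : G → ℂ} (hf : f ∈ Cc G) :
    ∃ (n : ℕ) (U : Fin n → OpenBisection G) (θ : Fin n → UnitSpace G → ℂ),
      (∀ k, IsCoefficient (U k) (θ k)) ∧ f = ∑ k, bisFun (U k) (θ k) := by
  rw [Cc_eq_span] at hf
  obtain ⟨n, c, g, rfl⟩ := Submodule.mem_span_set'.1 hf
  choose U θ h e using fun k => (g k).2
  refine ⟨n, U, fun k t => c k * θ k t, fun k => (h k).const_mul (c k), ?_⟩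
  refine Finset.sum_congr rfl fun k _ => ?_
  funext γ
  rw [Pi.smul_apply, e k, smul_eq_mul]
  by_cases hg : γ ∈ (U k).carrier
  · rw [bisFun_of_mem hg, bisFun_of_mem hg]
  · rw [bisFun_of_notMem hg, bisFun_of_notMem hg, mul_zero]

/-! ### Products and adjoints of bisection functions -/

/-- The coefficient of the convolution product of `bisFun U θ` and `bisFun V η`, which is supported
on `U V`. -/
noncomputable def mulCoeff (U : OpenBisection G) (θ η : UnitSpace G → ℂ) (t : UnitSpace G) : ℂ :=
  θ t * η (src (U.sec t))

theorem IsCoefficient.mul {U V : OpenBisection G} {θ η : UnitSpace G → ℂ} (hθ : IsCoefficient U θ)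
    (hη : IsCoefficient V η) : IsCoefficient (U.mul V) (mulCoeff U θ η) where
  continuous := by
    rw [continuous_iff_continuousAt]
    intro t
    by_cases ht : t ∈ rng '' U.carrier
    · exact hθ.continuous.continuousAt.mul
        ((hη.continuous.comp continuous_src).continuousAt.comp (U.continuousAt_sec ht))
    · have h0 : mulCoeff U θ η =ᶠ[𝓝 t] fun _ => 0 := by
        filter_upwards [(isClosed_tsupport θ).isOpen_compl.mem_nhds
          fun h => ht (hθ.tsupport_subset h)] with t' ht'
        rw [mulCoeff, image_eq_zero_of_notMem_tsupport ht', zero_mul]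
      exact continuousAt_const.congr h0.symm
  compact := hθ.compact.mul_right
  tsupport_subset := by
    intro t ht
    have htU : t ∈ rng '' U.carrier := hθ.tsupport_subset
      (tsupport_mul_subset_left (f := θ) (g := fun t => η (src (U.sec t))) ht)
    have hts : src (U.sec t) ∈ tsupport η := by
      by_contra hcon
      have h1 := (continuous_src.continuousAt.comp (U.continuousAt_sec htU)).tendsto
        ((isClosed_tsupport η).isOpen_compl.mem_nhds hcon)
      refine (mem_closure_iff_nhds.1 ht _ h1).elim fun t' ht' => ht'.2 ?_
      have : η (src (U.sec t')) = 0 := image_eq_zero_of_notMem_tsupport ht'.1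
      rw [mulCoeff, this, mul_zero]
    obtain ⟨v, hv, hvr⟩ := hη.tsupport_subset hts
    refine ⟨U.sec t * v, OpenBisection.mul_mem_mul (U.sec_mem htU) hv hvr.symm, ?_⟩
    rw [rng_mul hvr.symm, U.rng_sec]

open Classical in
/-- The coefficient of the adjoint of `bisFun U θ`, which is supported on `U⁻¹`. -/
noncomputable def starCoeff (U : OpenBisection G) (θ : UnitSpace G → ℂ) (t : UnitSpace G) : ℂ :=
  if t ∈ src '' U.carrier then star (θ (rng (U.srcSec t))) else 0

theorem IsCoefficient.star {U : OpenBisection G} {θ : UnitSpace G → ℂ} (hθ : IsCoefficient U θ) :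
    IsCoefficient U.inv (starCoeff U θ) := by
  let K : Set (UnitSpace G) := (fun t => src (U.sec t)) '' tsupport θ
  have hK : IsCompact K := by
    refine IsCompact.image_of_continuousOn hθ.compact fun t ht => ?_
    exact (continuous_src.continuousAt.comp
      (U.continuousAt_sec (hθ.tsupport_subset ht))).continuousWithinAt
  have hKU : K ⊆ src '' U.carrier := by
    rintro _ ⟨t, ht, rfl⟩
    exact ⟨_, U.sec_mem (hθ.tsupport_subset ht), rfl⟩
  have hzero : ∀ t ∉ K, starCoeff U θ t = 0 := by
    intro t ht
    by_cases htU : t ∈ src '' U.carrier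
    · obtain ⟨u, hu, rfl⟩ := htU
      rw [starCoeff, if_pos ⟨u, hu, rfl⟩, U.srcSec_src hu,
        image_eq_zero_of_notMem_tsupport (f := θ), star_zero]
      intro h
      refine ht ⟨_, h, ?_⟩
      simp only [U.sec_rng hu]
    · exact if_neg htU
  refine ⟨?_, HasCompactSupport.intro hK hzero, ?_⟩
  · rw [continuous_iff_continuousAt]
    intro t
    by_cases ht : t ∈ src '' U.carrier
    · have h1 : ContinuousAt (fun t => Star.star (θ (rng (U.srcSec t)))) t :=
        (continuous_star.comp (hθ.continuous.comp continuous_rng)).continuousAt.comp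
          (U.continuousAt_srcSec ht)
      refine h1.congr ?_
      filter_upwards [U.isOpen_src_image.mem_nhds ht] with t' ht'
      rw [starCoeff, if_pos ht']
    · have h0 : starCoeff U θ =ᶠ[𝓝 t] fun _ => 0 := by
        filter_upwards [hK.isClosed.isOpen_compl.mem_nhds fun h => ht (hKU h)] with t' ht'
        exact hzero t' ht'
      exact continuousAt_const.congr h0.symm
  · rw [OpenBisection.rng_image_inv]
    refine (closure_minimal ?_ hK.isClosed).trans hKU
    intro t ht
    by_contra hcon
    exact ht (hzero t hcon)

theorem bisFun_star (U : OpenBisection G) (θ : UnitSpace G → ℂ) (g : G) :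
    bisFun U.inv (starCoeff U θ) g = star (bisFun U θ g⁻¹) := by
  by_cases hg : g⁻¹ ∈ U.carrier
  · have h : rng g = src g⁻¹ := (src_inv g).symm
    rw [bisFun_of_mem hg, bisFun_of_mem (OpenBisection.mem_inv.2 hg), h, starCoeff,
      if_pos ⟨_, hg, rfl⟩, U.srcSec_src hg]
  · rw [bisFun_of_notMem hg, bisFun_of_notMem (U := U.inv) hg, star_zero]

/-- Arrows `u⁻¹ g`, where `u ∈ U` has the range of `g`, as a self-map of `G_x`. -/
noncomputable def OpenBisection.pull (U : OpenBisection G) {x : UnitSpace G} (g : Fiber x) :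
    Fiber x :=
  ⟨(U.sec (rng g.1))⁻¹ * g.1, by rw [src_mul (by rw [src_inv, U.rng_sec]), g.2]⟩

theorem OpenBisection.rng_pull (U : OpenBisection G) {x : UnitSpace G} (g : Fiber x) :
    rng (U.pull g).1 = src (U.sec (rng g.1)) := by
  rw [OpenBisection.pull, rng_mul (by rw [src_inv, U.rng_sec]), rng_inv]

theorem fiber_comp {x : UnitSpace G} (g h : Fiber x) : src g.1 = rng h.1⁻¹ := by
  rw [rng_inv, g.2, h.2]

theorem rng_mul_inv_fiber {x : UnitSpace G} (g h : Fiber x) : rng (g.1 * h.1⁻¹) = rng g.1 :=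
  rng_mul (fiber_comp g h)

theorem src_mul_inv_fiber {x : UnitSpace G} (g h : Fiber x) : src (g.1 * h.1⁻¹) = rng h.1 := by
  rw [src_mul (fiber_comp g h), src_inv]

theorem OpenBisection.eq_pull (U : OpenBisection G) {x : UnitSpace G} {g h : Fiber x}
    (hU : g.1 * h.1⁻¹ ∈ U.carrier) : h = U.pull g := by
  apply Subtype.ext
  have e : U.sec (rng g.1) = g.1 * h.1⁻¹ := by
    rw [← rng_mul_inv_fiber g h]; exact U.sec_rng hU
  change h.1 = (U.sec (rng g.1))⁻¹ * g.1
  rw [e, mul_inv_rev (fiber_comp g h), inv_inv_self, inv_mul_cancel_right (h.2.trans g.2.symm)]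

theorem OpenBisection.mul_inv_pull (U : OpenBisection G) {x : UnitSpace G} (g : Fiber x) :
    g.1 * (U.pull g).1⁻¹ = U.sec (rng g.1) := by
  have e : src (U.sec (rng g.1))⁻¹ = rng g.1 := by rw [src_inv, U.rng_sec]
  rw [pull, mul_inv_rev e, inv_inv_self, mul_inv_cancel_left (by rw [U.rng_sec])]

/-- Convolution by a function supported on a bisection is a weighted partial permutation. -/
theorem hasSum_bisFun {U : OpenBisection G} {θ : UnitSpace G → ℂ}
    (hθ : ∀ t ∉ rng '' U.carrier, θ t = 0) {x : UnitSpace G} (ψ : Fiber x → ℂ) (g : Fiber x) :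
    HasSum (fun h : Fiber x => bisFun U θ (g.1 * h.1⁻¹) * ψ h) (θ (rng g.1) * ψ (U.pull g)) := by
  have h1 : bisFun U θ (g.1 * (U.pull g).1⁻¹) = θ (rng g.1) := by
    rw [U.mul_inv_pull]
    by_cases h : rng g.1 ∈ rng '' U.carrier
    · rw [bisFun_of_mem (U.sec_mem h), U.rng_sec]
    · rw [hθ _ h, bisFun_of_notMem fun h' => h ⟨_, h', U.rng_sec _⟩]
  rw [← h1]
  refine hasSum_single _ fun h hne => ?_
  rw [bisFun_of_notMem fun h' => hne (U.eq_pull h'), zero_mul]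

theorem IsConvolution.apply_bisFun {U : OpenBisection G} {θ : UnitSpace G → ℂ}
    (hθ : IsCoefficient U θ) {T : FiberOperators G} (hT : IsConvolution G (bisFun U θ) T)
    {x : UnitSpace G} (ψ : L2 (Fiber x)) (g : Fiber x) :
    T x ψ g = θ (rng g.1) * ψ (U.pull g) :=
  (hT x ψ g).unique (hasSum_bisFun (fun _ => hθ.eq_zero) ψ g)

/-- The product of the convolution operators of two functions supported on bisections is the
convolution operator of a function supported on a bisection. -/
theorem hasSum_mul_bisFun {U V : OpenBisection G} {θ η : UnitSpace G → ℂ}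
    (hθ : IsCoefficient U θ) (hη : IsCoefficient V η) {x : UnitSpace G} (ψ : Fiber x → ℂ)
    (g : Fiber x) :
    HasSum (fun h : Fiber x => bisFun (U.mul V) (mulCoeff U θ η) (g.1 * h.1⁻¹) * ψ h)
      (θ (rng g.1) * (η (rng (U.pull g).1) * ψ (V.pull (U.pull g)))) := by
  have h := hasSum_bisFun (fun _ => (hθ.mul hη).eq_zero) ψ g
  convert h using 1
  rw [mulCoeff, mul_assoc, ← U.rng_pull g]
  by_cases hU : rng g.1 ∈ rng '' U.carrier
  · by_cases hV : rng (U.pull g).1 ∈ rng '' V.carrier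
    · congr 3
      apply OpenBisection.eq_pull
      have e : V.sec (rng (U.pull g).1) = (U.pull g).1 * (V.pull (U.pull g)).1⁻¹ :=
        (V.mul_inv_pull _).symm
      refine ⟨U.sec (rng g.1), U.sec_mem hU, by rw [U.rng_sec, rng_mul_inv_fiber], ?_⟩
      rw [← mul_mul_mul (by rw [src_inv, U.rng_sec]) (fiber_comp _ _)]
      change (U.pull g).1 * (V.pull (U.pull g)).1⁻¹ ∈ V.carrier
      rw [← e]
      exact V.sec_mem hV
    · rw [hη.eq_zero hV, zero_mul, zero_mul]
  · rw [hθ.eq_zero hU, zero_mul, zero_mul]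

end BisectionFunctions

/-! ### Families of operators in the reduced C*-algebra -/

section OperatorFamilies

variable {G : Type u} [TopologicalSpace G] [ArrowGroupoid G] [EtaleGroupoid G]

open Classical in
/-- The basis vector `δ_i` of `ℓ²(ι)`. -/
noncomputable def basisVec {ι : Type u} (i : ι) : L2 ι := lp.single 2 i 1

theorem inner_basisVec_left {ι : Type u} (i : ι) (ψ : L2 ι) :
    inner ℂ (basisVec i) ψ = ψ i := by
  classical
  have h := lp.inner_single_left (𝕜 := ℂ) i (1 : ℂ) ψ
  rw [basisVec]
  convert! h using 1
  simp

theorem basisVec_apply_self {ι : Type u} (i : ι) : (basisVec i : L2 ι) i = 1 := by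
  classical
  exact lp.single_apply_self _ _ _

theorem basisVec_apply_ne {ι : Type u} {i j : ι} (h : j ≠ i) : (basisVec i : L2 ι) j = 0 := by
  classical
  exact lp.single_apply_ne _ _ _ h

theorem norm_basisVec {ι : Type u} (i : ι) : ‖(basisVec i : L2 ι)‖ = 1 := by
  classical
  have h := lp.norm_single (p := 2) (E := fun _ : ι => ℂ) (by norm_num) i (1 : ℂ)
  rw [basisVec, h, norm_one]

theorem norm_apply_le {ι : Type u} (ψ : L2 ι) (i : ι) : ‖ψ i‖ ≤ ‖ψ‖ :=
  lp.norm_apply_le_norm (by norm_num) ψ i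

theorem norm_matrixCoeff_le {ι : Type u} (T : L2 ι →L[ℂ] L2 ι) (i j : ι) :
    ‖T (basisVec i) j‖ ≤ ‖T‖ :=
  (norm_apply_le _ _).trans <| (T.le_opNorm _).trans (by rw [norm_basisVec, mul_one])

theorem hasSum_basisVec {ι : Type u} (ψ : L2 ι) : HasSum (fun i => ψ i • basisVec i) ψ := by
  classical
  have h := lp.hasSum_single (E := fun _ : ι => ℂ) (p := 2) (by norm_num) ψ
  convert! h using 2 with i
  rw [basisVec, ← lp.single_smul, smul_eq_mul, mul_one]

/-- An operator on `ℓ²(ι)` is determined by its matrix. -/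
theorem eq_zero_of_matrixCoeff {ι : Type u} {T : L2 ι →L[ℂ] L2 ι}
    (h : ∀ i j, T (basisVec i) j = 0) : T = 0 := by
  refine ContinuousLinearMap.ext fun ψ => ?_
  have h1 := (hasSum_basisVec ψ).mapL T
  have h2 : (fun i => T (ψ i • basisVec i)) = fun _ => 0 := by
    funext i
    rw [map_smul]
    have : T (basisVec i) = 0 := by
      ext j
      exact h i j
    rw [this, smul_zero]
  rw [h2] at h1
  exact h1.unique hasSum_zero

variable (G) in
/-- Families of operators on the spaces `ℓ²(G_x)`, `x ∈ G⁰`. -/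
abbrev OpFamily : Type u := ∀ x : UnitSpace G, L2 (Fiber x) →L[ℂ] L2 (Fiber x)

/-- `T` is the family of convolution operators by a function in `𝒞_c(G)`. -/
def IsCcFamily (T : OpFamily G) : Prop :=
  ∃ f ∈ Cc G, ∀ (x : UnitSpace G) (ψ : L2 (Fiber x)) (g : Fiber x),
    HasSum (fun h : Fiber x => f (g.1 * h.1⁻¹) * ψ h) (T x ψ g)

/-- `T` belongs to the reduced C*-algebra. -/
def MemReduced (T : OpFamily G) : Prop := ∃ a ∈ reducedAlgebra G, ∀ x, a x = T x

theorem isCcFamily_regularRep (f : Cc G) : IsCcFamily fun x => regularRep G f x :=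
  ⟨f.1, f.2, regularRep_spec G f⟩

theorem IsCcFamily.exists_eq_regularRep {T : OpFamily G} (hT : IsCcFamily T) :
    ∃ f : Cc G, ∀ x, T x = regularRep G f x := by
  obtain ⟨f, hf, h⟩ := hT
  refine ⟨⟨f, hf⟩, fun x => ContinuousLinearMap.ext fun ψ => ?_⟩
  ext g
  exact (h x ψ g).unique (regularRep_spec G ⟨f, hf⟩ x ψ g)

theorem IsConvolution.matrixCoeff {f : G → ℂ} {T : FiberOperators G} (hT : IsConvolution G f T)
    {x : UnitSpace G} (h g : Fiber x) : T x (basisVec h) g = f (g.1 * h.1⁻¹) := by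
  refine (hT x (basisVec h) g).unique ?_
  have : f (g.1 * h.1⁻¹) = f (g.1 * h.1⁻¹) * (basisVec h : L2 (Fiber x)) h := by
    rw [basisVec_apply_self, mul_one]
  rw [this]
  exact hasSum_single h fun k hk => by rw [basisVec_apply_ne hk, mul_zero]

theorem IsCcFamily.add {S T : OpFamily G} (hS : IsCcFamily S) (hT : IsCcFamily T) :
    IsCcFamily fun x => S x + T x := by
  obtain ⟨f, hf, hS⟩ := hS
  obtain ⟨f', hf', hT⟩ := hT
  refine ⟨f + f', add_mem hf hf', fun x ψ g => ?_⟩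
  simp only [Pi.add_apply, add_mul]
  exact (hS x ψ g).add (hT x ψ g)

theorem IsCcFamily.zero : IsCcFamily fun _ : UnitSpace G => 0 := by
  refine ⟨0, zero_mem _, fun x ψ g => ?_⟩
  simp only [Pi.zero_apply, zero_mul]
  exact hasSum_zero

theorem IsCcFamily.sum {ι : Type*} (s : Finset ι) {S : ι → OpFamily G}
    (h : ∀ i ∈ s, IsCcFamily (S i)) : IsCcFamily fun x => ∑ i ∈ s, S i x := by
  classical
  induction s using Finset.induction_on with
  | empty => exact IsCcFamily.zero
  | insert i s hi ih =>
    simp only [Finset.sum_insert hi]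
    exact (h i (Finset.mem_insert_self i s)).add (ih fun j hj => h j (Finset.mem_insert_of_mem hj))

/-- The convolution operator of a function supported on a bisection. -/
noncomputable def IsCoefficient.op {U : OpenBisection G} {θ : UnitSpace G → ℂ}
    (h : IsCoefficient U θ) : FiberOperators G := regularRep G ⟨bisFun U θ, h.bisFun_mem_Cc⟩

theorem IsCoefficient.isConvolution_op {U : OpenBisection G} {θ : UnitSpace G → ℂ}
    (h : IsCoefficient U θ) : IsConvolution G (bisFun U θ) h.op :=
  regularRep_spec G ⟨bisFun U θ, h.bisFun_mem_Cc⟩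

theorem IsCoefficient.op_apply {U : OpenBisection G} {θ : UnitSpace G → ℂ}
    (h : IsCoefficient U θ) {x : UnitSpace G} (ψ : L2 (Fiber x)) (g : Fiber x) :
    h.op x ψ g = θ (rng g.1) * ψ (U.pull g) := h.isConvolution_op.apply_bisFun h ψ g

theorem IsCcFamily.exists_eq_sum {T : OpFamily G} (hT : IsCcFamily T) :
    ∃ (n : ℕ) (U : Fin n → OpenBisection G) (θ : Fin n → UnitSpace G → ℂ)
      (h : ∀ k, IsCoefficient (U k) (θ k)), ∀ x, T x = ∑ k, (h k).op x := by
  obtain ⟨f, hf, hT⟩ := hT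
  obtain ⟨n, U, θ, h, e⟩ := exists_eq_sum_bisFun hf
  refine ⟨n, U, θ, h, fun x => ContinuousLinearMap.ext fun ψ => ?_⟩
  ext g
  refine (hT x ψ g).unique ?_
  rw [sum_apply, lp.coeFn_sum, Finset.sum_apply]
  simp only [e, Finset.sum_apply, Finset.sum_mul]
  exact hasSum_sum fun k _ => (h k).isConvolution_op x ψ g

theorem IsCoefficient.isCcFamily_mul {U V : OpenBisection G} {θ η : UnitSpace G → ℂ}
    (hθ : IsCoefficient U θ) (hη : IsCoefficient V η) :
    IsCcFamily fun x => hθ.op x * hη.op x := by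
  refine ⟨_, (hθ.mul hη).bisFun_mem_Cc, fun x ψ g => ?_⟩
  change HasSum _ (hθ.op x (hη.op x ψ) g)
  rw [hθ.op_apply, hη.op_apply]
  exact hasSum_mul_bisFun hθ hη ψ g

theorem IsCoefficient.isCcFamily_star {U : OpenBisection G} {θ : UnitSpace G → ℂ}
    (hθ : IsCoefficient U θ) : IsCcFamily fun x => Star.star (hθ.op x) := by
  refine ⟨_, hθ.star.bisFun_mem_Cc, fun x ψ g => ?_⟩
  have h1 : (Star.star (hθ.op x)) ψ g = inner ℂ (hθ.op x (basisVec g)) ψ := by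
    rw [← inner_basisVec_left, ContinuousLinearMap.star_eq_adjoint,
      ContinuousLinearMap.adjoint_inner_right]
  rw [h1]
  have e : (fun h : Fiber x => bisFun U.inv (starCoeff U θ) (g.1 * h.1⁻¹) * ψ h)
      = fun h => inner ℂ (hθ.op x (basisVec g) h) (ψ h) := by
    funext h
    rw [hθ.isConvolution_op.matrixCoeff, bisFun_star, mul_inv_rev (fiber_comp g h), inv_inv_self,
      RCLike.inner_apply, mul_comm]
    rfl
  rw [e]
  exact lp.hasSum_inner (𝕜 := ℂ) (hθ.op x (basisVec g)) ψ

theorem IsCcFamily.mul {S T : OpFamily G} (hS : IsCcFamily S) (hT : IsCcFamily T) :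
    IsCcFamily fun x => S x * T x := by
  obtain ⟨n, U, θ, h, e⟩ := hS.exists_eq_sum
  obtain ⟨m, V, η, h', e'⟩ := hT.exists_eq_sum
  simp only [e, e', Finset.sum_mul_sum]
  exact IsCcFamily.sum _ fun k _ => IsCcFamily.sum _ fun l _ => (h k).isCcFamily_mul (h' l)

theorem IsCcFamily.star {S : OpFamily G} (hS : IsCcFamily S) :
    IsCcFamily fun x => Star.star (S x) := by
  obtain ⟨n, U, θ, h, e⟩ := hS.exists_eq_sum
  simp only [e, star_sum]
  exact IsCcFamily.sum _ fun k _ => (h k).isCcFamily_star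

theorem norm_fiberOperators_apply_le (a : FiberOperators G) (x : UnitSpace G) : ‖a x‖ ≤ ‖a‖ :=
  lp.norm_apply_le_norm (by simp) a x

theorem mem_reducedAlgebra_iff {a : FiberOperators G} :
    a ∈ reducedAlgebra G ↔ ∀ ε : ℝ, 0 < ε → ∃ f : Cc G, ‖a - regularRep G f‖ < ε := by
  refine (Metric.mem_closure_iff
    (s := ((LinearMap.range (regularRep G) : Submodule ℂ (FiberOperators G)) :
      Set (FiberOperators G)))).trans ?_
  simp only [dist_eq_norm]
  constructor
  · intro h ε hε
    obtain ⟨_, ⟨f, rfl⟩, hf⟩ := h ε hε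
    exact ⟨f, hf⟩
  · intro h ε hε
    obtain ⟨f, hf⟩ := h ε hε
    exact ⟨_, ⟨f, rfl⟩, hf⟩

theorem exists_norm_sub_regularRep_lt {a : FiberOperators G} (ha : a ∈ reducedAlgebra G) {ε : ℝ}
    (hε : 0 < ε) : ∃ f : Cc G, ∀ x, ‖a x - regularRep G f x‖ < ε := by
  obtain ⟨f, hf⟩ := mem_reducedAlgebra_iff.1 ha ε hε
  exact ⟨f, fun x => (norm_fiberOperators_apply_le (a - regularRep G f) x).trans_lt hf⟩

/-- The reduced C*-algebra consists of the uniform limits of convolution operators. -/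
theorem memReduced_iff {T : OpFamily G} :
    MemReduced T ↔ ∀ ε : ℝ, 0 < ε → ∃ S, IsCcFamily S ∧ ∀ x, ‖T x - S x‖ ≤ ε := by
  constructor
  · rintro ⟨a, ha, haT⟩ ε hε
    obtain ⟨f, hf⟩ := exists_norm_sub_regularRep_lt ha hε
    exact ⟨_, isCcFamily_regularRep f, fun x => haT x ▸ (hf x).le⟩
  · intro h
    obtain ⟨S, hSc, hS⟩ := h 1 one_pos
    obtain ⟨f, hf⟩ := hSc.exists_eq_regularRep
    have hb : Memℓp (T : ∀ x : UnitSpace G, L2 (Fiber x) →L[ℂ] L2 (Fiber x)) ∞ := by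
      refine memℓp_infty ⟨1 + ‖regularRep G f‖, ?_⟩
      rintro _ ⟨x, rfl⟩
      calc ‖T x‖ = ‖(T x - S x) + S x‖ := by rw [sub_add_cancel]
        _ ≤ ‖T x - S x‖ + ‖S x‖ := norm_add_le _ _
        _ ≤ 1 + ‖regularRep G f‖ :=
            add_le_add (hS x) ((hf x).symm ▸ norm_fiberOperators_apply_le _ x)
    refine ⟨⟨T, hb⟩, mem_reducedAlgebra_iff.2 fun ε hε => ?_, fun x => rfl⟩
    obtain ⟨S, hSc, hS⟩ := h (ε / 2) (half_pos hε)
    obtain ⟨f, hf⟩ := hSc.exists_eq_regularRep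
    refine ⟨f, ?_⟩
    refine lt_of_le_of_lt (lp.norm_le_of_forall_le (half_pos hε).le fun x => ?_) (half_lt_self hε)
    change ‖T x - regularRep G f x‖ ≤ ε / 2
    rw [← hf x]
    exact hS x

theorem IsCcFamily.memReduced {T : OpFamily G} (hT : IsCcFamily T) : MemReduced T :=
  memReduced_iff.2 fun _ hε => ⟨T, hT, fun x => by rw [sub_self, norm_zero]; exact hε.le⟩

theorem IsCoefficient.memReduced_op {U : OpenBisection G} {θ : UnitSpace G → ℂ}
    (h : IsCoefficient U θ) : MemReduced fun x => h.op x :=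
  (isCcFamily_regularRep _).memReduced

theorem MemReduced.exists_bound {T : OpFamily G} (hT : MemReduced T) :
    ∃ M : ℝ, 0 ≤ M ∧ ∀ x, ‖T x‖ ≤ M := by
  obtain ⟨a, -, ha⟩ := hT
  exact ⟨‖a‖, norm_nonneg _, fun x => ha x ▸ norm_fiberOperators_apply_le a x⟩

theorem MemReduced.of_approx {T : OpFamily G}
    (h : ∀ ε : ℝ, 0 < ε → ∃ S, MemReduced S ∧ ∀ x, ‖T x - S x‖ ≤ ε) : MemReduced T := by
  refine memReduced_iff.2 fun ε hε => ?_
  obtain ⟨S, hS, hTS⟩ := h (ε / 2) (half_pos hε)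
  obtain ⟨R, hR, hSR⟩ := memReduced_iff.1 hS (ε / 2) (half_pos hε)
  refine ⟨R, hR, fun x => ?_⟩
  calc ‖T x - R x‖ ≤ ‖T x - S x‖ + ‖S x - R x‖ := norm_sub_le_norm_sub_add_norm_sub _ _ _
    _ ≤ ε / 2 + ε / 2 := add_le_add (hTS x) (hSR x)
    _ = ε := add_halves ε

theorem MemReduced.add {S T : OpFamily G} (hS : MemReduced S) (hT : MemReduced T) :
    MemReduced fun x => S x + T x := by
  obtain ⟨a, ha, hS⟩ := hS
  obtain ⟨b, hb, hT⟩ := hT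
  exact ⟨a + b, add_mem ha hb, fun x => congrArg₂ (· + ·) (hS x) (hT x)⟩

theorem MemReduced.smul {T : OpFamily G} (hT : MemReduced T) (c : ℂ) :
    MemReduced fun x => c • T x := by
  obtain ⟨a, ha, hT⟩ := hT
  exact ⟨c • a, Submodule.smul_mem _ c ha, fun x => congrArg (c • ·) (hT x)⟩

theorem MemReduced.zero : MemReduced fun _ : UnitSpace G => 0 := IsCcFamily.zero.memReduced

theorem MemReduced.sum {ι : Type*} (s : Finset ι) {S : ι → OpFamily G}
    (h : ∀ i ∈ s, MemReduced (S i)) : MemReduced fun x => ∑ i ∈ s, S i x := by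
  classical
  induction s using Finset.induction_on with
  | empty => exact MemReduced.zero
  | insert i s hi ih =>
    simp only [Finset.sum_insert hi]
    exact (h i (Finset.mem_insert_self i s)).add (ih fun j hj => h j (Finset.mem_insert_of_mem hj))

theorem MemReduced.mul {S T : OpFamily G} (hS : MemReduced S) (hT : MemReduced T) :
    MemReduced fun x => S x * T x := by
  obtain ⟨M, hM, hSM⟩ := hS.exists_bound
  obtain ⟨N, hN, hTN⟩ := hT.exists_bound
  refine memReduced_iff.2 fun ε hε => ?_
  let δ := min 1 (ε / (M + N + 1))
  have hδ : 0 < δ := lt_min one_pos (by positivity)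
  obtain ⟨S', hS', hSS'⟩ := memReduced_iff.1 hS δ hδ
  obtain ⟨T', hT', hTT'⟩ := memReduced_iff.1 hT δ hδ
  refine ⟨_, hS'.mul hT', fun x => ?_⟩
  have hT'N : ‖T' x‖ ≤ N + 1 := by
    calc ‖T' x‖ = ‖T x - (T x - T' x)‖ := by rw [sub_sub_cancel]
      _ ≤ ‖T x‖ + ‖T x - T' x‖ := norm_sub_le _ _
      _ ≤ N + 1 := add_le_add (hTN x) ((hTT' x).trans (min_le_left _ _))
  calc ‖S x * T x - S' x * T' x‖ = ‖S x * (T x - T' x) + (S x - S' x) * T' x‖ := by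
        congr 1; noncomm_ring
    _ ≤ ‖S x‖ * ‖T x - T' x‖ + ‖S x - S' x‖ * ‖T' x‖ :=
        (norm_add_le _ _).trans (add_le_add (norm_mul_le _ _) (norm_mul_le _ _))
    _ ≤ M * δ + δ * (N + 1) := by
        gcongr
        · exact hSM x
        · exact hTT' x
        · exact hSS' x
    _ = (M + N + 1) * δ := by ring
    _ ≤ (M + N + 1) * (ε / (M + N + 1)) := by
        gcongr
        exact min_le_right _ _
    _ = ε := by field_simp

theorem MemReduced.star {T : OpFamily G} (hT : MemReduced T) :
    MemReduced fun x => Star.star (T x) := by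
  refine memReduced_iff.2 fun ε hε => ?_
  obtain ⟨S, hS, hTS⟩ := memReduced_iff.1 hT ε hε
  exact ⟨_, hS.star, fun x => by rw [← star_sub, norm_star]; exact hTS x⟩

theorem MemReduced.pow_succ {T : OpFamily G} (hT : MemReduced T) (n : ℕ) :
    MemReduced fun x => T x ^ (n + 1) := by
  induction n with
  | zero => simpa only [zero_add, pow_one] using hT
  | succ n ih =>
    simp only [_root_.pow_succ (T _) (n + 1)]
    exact ih.mul hT

/-- The negative parts of all self-adjoint operators of norm at most `M` are approximated at once by
a polynomial without constant term. -/
theorem exists_polynomial_near_negPart {M : ℝ} (hM : 0 ≤ M) {ε : ℝ} (hε : 0 < ε) :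
    ∃ (n : ℕ) (c : ℕ → ℂ), ∀ (H : Type u) [NormedAddCommGroup H] [InnerProductSpace ℂ H]
      [CompleteSpace H] (T : H →L[ℂ] H), IsSelfAdjoint T → ‖T‖ ≤ M →
        ‖T⁻ - ∑ i ∈ Finset.range n, c i • T ^ (i + 1)‖ ≤ ε := by
  obtain ⟨q, hq⟩ := exists_polynomial_near_of_continuousOn (-M) M (fun t : ℝ => t⁻)
    (by fun_prop) (ε / 2) (half_pos hε)
  let p : Polynomial ℝ := q - Polynomial.C (q.coeff 0)
  have hp0 : p.coeff 0 = 0 := by simp [p]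
  have hp : ∀ t ∈ Set.Icc (-M) M, ‖t⁻ - p.eval t‖ ≤ ε := by
    intro t ht
    have h1 := hq t ht
    have h2 := hq 0 ⟨by linarith, hM⟩
    rw [← Polynomial.coeff_zero_eq_eval_zero, negPart_zero, sub_zero] at h2
    have e : t⁻ - p.eval t = -(q.eval t - t⁻) + q.coeff 0 := by simp [p]; ring
    rw [e]
    refine (norm_add_le _ _).trans ?_
    rw [norm_neg, Real.norm_eq_abs, Real.norm_eq_abs]
    linarith
  refine ⟨p.natDegree, fun i => (p.coeff (i + 1) : ℂ), fun H _ _ _ T hsa hTM => ?_⟩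
  have e : ∑ i ∈ Finset.range p.natDegree, (p.coeff (i + 1) : ℂ) • T ^ (i + 1)
      = Polynomial.aeval T p := by
    rw [Polynomial.aeval_eq_sum_range, Finset.sum_range_succ', hp0, zero_smul, add_zero]
    exact Finset.sum_congr rfl fun i _ => Complex.coe_smul _ _
  have h1 : T⁻ = cfc (fun t : ℝ => t⁻) T := by
    rw [CFC.negPart_def, cfcₙ_eq_cfc]
  rw [e, h1, ← cfc_polynomial p T, ← cfc_sub ..]
  refine norm_cfc_le hε.le fun t ht => hp t ?_
  have h2 : ‖t‖ ≤ ‖T‖ * ‖(1 : H →L[ℂ] H)‖ := spectrum.norm_le_norm_mul_of_mem ht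
  have h3 : ‖t‖ ≤ M := (h2.trans (mul_le_of_le_one_right (norm_nonneg _)
    ContinuousLinearMap.norm_id_le)).trans hTM
  exact abs_le.1 h3

/-- The negative part of a bounded operator on a Hilbert space. -/
noncomputable def negPartOp {H : Type u} [NormedAddCommGroup H] [InnerProductSpace ℂ H]
    [CompleteSpace H] (T : H →L[ℂ] H) : H →L[ℂ] H := T⁻

theorem negPartOp_eq_zero_iff {H : Type u} [NormedAddCommGroup H] [InnerProductSpace ℂ H]
    [CompleteSpace H] {T : H →L[ℂ] H} (hT : IsSelfAdjoint T) :
    negPartOp T = 0 ↔ ∀ ψ : H, 0 ≤ (inner ℂ ψ (T ψ)).re := by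
  rw [negPartOp, CFC.negPart_eq_zero_iff T hT, ContinuousLinearMap.nonneg_iff_isPositive]
  constructor
  · exact fun h ψ => h.re_inner_nonneg_right ψ
  · refine fun h => ContinuousLinearMap.isPositive_def'.2 ⟨hT, fun ψ => ?_⟩
    rw [ContinuousLinearMap.reApplyInnerSelf_apply, inner_re_symm]
    exact h ψ

/-- The reduced C*-algebra contains the negative parts of its self-adjoint elements. -/
theorem MemReduced.negPart {T : OpFamily G} (hT : MemReduced T) (hsa : ∀ x, IsSelfAdjoint (T x)) :
    MemReduced fun x => negPartOp (T x) := by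
  obtain ⟨M, hM, hTM⟩ := hT.exists_bound
  refine MemReduced.of_approx fun ε hε => ?_
  obtain ⟨n, c, h⟩ := exists_polynomial_near_negPart.{u} hM hε
  exact ⟨_, MemReduced.sum (Finset.range n) fun i _ => (hT.pow_succ i).smul (c i),
    fun x => h _ (T x) (hsa x) (hTM x)⟩

/-! ### The singular ideal -/

theorem toFunction_eq (a : FiberOperators G) (g : G) :
    toFunction a g = a (src g) (basisVec ⟨(src g).val, src_val _⟩) ⟨g, rfl⟩ := by
  have h : ∀ d d' : DecidableEq (Fiber (src g)), ∀ i : Fiber (src g),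
      @lp.single _ (fun _ => ℂ) _ d 2 i (1 : ℂ) = @lp.single _ (fun _ => ℂ) _ d' 2 i 1 :=
    fun d d' i => by rw [Subsingleton.elim d d']
  exact congrArg (fun v => (a (src g) v : L2 (Fiber (src g))) ⟨g, rfl⟩) (h _ _ _)

theorem norm_toFunction_sub_le (a b : FiberOperators G) (g : G) :
    ‖toFunction a g - toFunction b g‖ ≤ ‖a (src g) - b (src g)‖ := by
  rw [toFunction_eq, toFunction_eq]
  exact norm_matrixCoeff_le (a (src g) - b (src g)) _ _

theorem toFunction_regularRep (f : Cc G) (g : G) : toFunction (regularRep G f) g = f.1 g := by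
  rw [toFunction_eq, (regularRep_spec G f).matrixCoeff, unit_inv, mul_src]

/-- The matrix of an element of the reduced C*-algebra is given by its function on `G`. -/
theorem matrixCoeff_eq_toFunction {a : FiberOperators G} (ha : a ∈ reducedAlgebra G)
    {x : UnitSpace G} (h g : Fiber x) :
    a x (basisVec h) g = toFunction a (g.1 * h.1⁻¹) := by
  refine eq_of_forall_dist_le fun ε hε => ?_
  obtain ⟨f, hf⟩ := exists_norm_sub_regularRep_lt ha (half_pos hε)
  have h1 : ‖a x (basisVec h) g - regularRep G f x (basisVec h) g‖ ≤ ε / 2 :=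
    (norm_matrixCoeff_le (a x - regularRep G f x) h g).trans (hf x).le
  have h2 : ‖toFunction a (g.1 * h.1⁻¹) - toFunction (regularRep G f) (g.1 * h.1⁻¹)‖ ≤ ε / 2 :=
    (norm_toFunction_sub_le _ _ _).trans (hf _).le
  rw [toFunction_regularRep] at h2
  rw [(regularRep_spec G f).matrixCoeff] at h1
  calc dist (a x (basisVec h) g) (toFunction a (g.1 * h.1⁻¹))
      ≤ dist (a x (basisVec h) g) (f.1 (g.1 * h.1⁻¹)) +
        dist (f.1 (g.1 * h.1⁻¹)) (toFunction a (g.1 * h.1⁻¹)) := dist_triangle _ _ _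
    _ ≤ ε / 2 + ε / 2 := by
        refine add_le_add ?_ ?_
        · rwa [dist_eq_norm]
        · rwa [dist_comm, dist_eq_norm]
    _ = ε := add_halves ε

theorem eq_zero_of_toFunction {a : FiberOperators G} (ha : a ∈ reducedAlgebra G)
    (h : ∀ g, toFunction a g = 0) : a = 0 := by
  ext x : 2
  exact eq_zero_of_matrixCoeff fun i j => by rw [matrixCoeff_eq_toFunction ha, h]

/-- Functions in `𝒞_c(G)` are continuous at the arrows over Hausdorff units. -/
theorem continuousAt_of_mem_Cc (hG : CountablyCovered G) {f : G → ℂ} (hf : f ∈ Cc G) {g : G}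
    (hg : src g ∈ hausdorffUnits G) : ContinuousAt f g := by
  obtain ⟨n, U, θ, h, rfl⟩ := exists_eq_sum_bisFun hf
  have key : ∀ k, ContinuousAt (bisFun (U k) (θ k)) g := by
    intro k
    by_cases hgU : g ∈ (U k).carrier
    · refine ((h k).continuous.comp continuous_rng).continuousAt.congr ?_
      filter_upwards [(U k).isOpen.mem_nhds hgU] with g' hg'
      exact (bisFun_of_mem hg').symm
    · refine (continuousAt_const (y := (0 : ℂ))).congr ?_
      by_cases hr : rng g ∈ rng '' (U k).carrier
      · filter_upwards [eventually_notMem_of_src_mem_hausdorffUnits hG hg hr hgU] with g' hg'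
        exact (bisFun_of_notMem hg').symm
      · have h1 : rng g ∉ tsupport (θ k) := fun h' => hr ((h k).tsupport_subset h')
        filter_upwards [continuous_rng.continuousAt
          ((isClosed_tsupport (θ k)).isOpen_compl.mem_nhds h1)] with g' hg'
        by_cases hU : g' ∈ (U k).carrier
        · rw [bisFun_of_mem hU]
          exact (image_eq_zero_of_notMem_tsupport hg').symm
        · exact (bisFun_of_notMem hU).symm
  have e : (∑ k, bisFun (U k) (θ k)) = fun g => ∑ k, bisFun (U k) (θ k) g := by
    funext g; rw [Finset.sum_apply]
  rw [e]
  exact tendsto_finsetSum _ fun k _ => key k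

/-- Elements of the singular ideal vanish at the arrows over Hausdorff units: a value `a(g) ≠ 0`
there would keep `a` away from zero on a neighbourhood of `g`, by approximation with a function in
`𝒞_c(G)`, which is continuous at `g`. -/
theorem toFunction_eq_zero_of_mem_singularIdeal (hG : CountablyCovered G) {a : reducedAlgebra G}
    (ha : a ∈ singularIdeal G) {g : G} (hg : src g ∈ hausdorffUnits G) :
    toFunction a.1 g = 0 := by
  by_contra hne
  have hpos : 0 < ‖toFunction a.1 g‖ := norm_pos_iff.2 hne
  obtain ⟨f, hf⟩ := exists_norm_sub_regularRep_lt a.2 (half_pos hpos)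
  have hclose : ∀ k, ‖toFunction a.1 k - f.1 k‖ < ‖toFunction a.1 g‖ / 2 := by
    intro k
    rw [← toFunction_regularRep f k]
    exact (norm_toFunction_sub_le _ _ _).trans_lt (hf _)
  have h1 : ‖toFunction a.1 g‖ / 2 < ‖f.1 g‖ := by
    have := norm_sub_norm_le (toFunction a.1 g) (f.1 g)
    linarith [hclose g]
  have h2 : ∀ᶠ k in 𝓝 g, ‖toFunction a.1 g‖ / 2 < ‖f.1 k‖ :=
    (continuousAt_of_mem_Cc hG f.2 hg).norm.eventually (lt_mem_nhds h1)
  obtain ⟨O, hO, hOo, hgO⟩ := mem_nhds_iff.1 h2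
  refine not_isMeagre_of_isOpen (isOpenMap_src O hOo) ⟨_, g, hgO, rfl⟩ (IsMeagre.mono ?_ ha)
  refine Set.image_mono fun k hk hk0 => ?_
  have h3 := hclose k
  have h4 : ‖toFunction a.1 g‖ / 2 < ‖f.1 k‖ := hO hk
  rw [hk0, zero_sub, norm_neg] at h3
  exact lt_asymm h3 h4

/-- The singular ideal is the kernel of the direct sum of the representations `λ_x` over the
Hausdorff units `x`. -/
theorem mem_singularIdeal_iff (hG : CountablyCovered G) {a : reducedAlgebra G} :
    a ∈ singularIdeal G ↔ ∀ x ∈ hausdorffUnits G, a.1 x = 0 := by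
  constructor
  · intro ha x hx
    refine eq_zero_of_matrixCoeff fun i j => ?_
    rw [matrixCoeff_eq_toFunction a.2]
    refine toFunction_eq_zero_of_mem_singularIdeal hG ha ?_
    rw [src_mul_inv_fiber]
    exact rng_mem_hausdorffUnits hG (by rwa [i.2])
  · intro ha
    refine IsMeagre.mono ?_ (isMeagre_compl_hausdorffUnits hG)
    rintro _ ⟨g, hg, rfl⟩ hx
    refine hg ?_
    rw [toFunction_eq, ha _ hx]
    rfl

/-- If the singular ideal vanishes, so do the elements of the reduced C*-algebra that vanish over
all Hausdorff units. -/
theorem MemReduced.eq_zero (hG : CountablyCovered G) (hJ : singularIdeal G = ⊥) {T : OpFamily G}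
    (hT : MemReduced T) (h : ∀ x ∈ hausdorffUnits G, T x = 0) (x : UnitSpace G) : T x = 0 := by
  obtain ⟨a, ha, haT⟩ := hT
  have h1 : (⟨a, ha⟩ : reducedAlgebra G) ∈ singularIdeal G :=
    (mem_singularIdeal_iff hG).2 fun x hx => (haT x).trans (h x hx)
  rw [hJ, Submodule.mem_bot] at h1
  have h2 : a = 0 := congrArg Subtype.val h1
  rw [← haT x, h2]
  rfl

end OperatorFamilies

/-! ### Sets in the essential fibres as limits of Hausdorff units -/

section EssentialFibres

variable {G : Type u} [TopologicalSpace G] [ArrowGroupoid G] [EtaleGroupoid G]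

/-- The singletons `{c}` converge to `X` in the Fell topology along the filter `l`. -/
structure IsFellLimit (l : Filter (UnitSpace G)) (X : Set G) : Prop where
  eventually_mem : ∀ V : Set G, IsOpen V → (X ∩ V).Nonempty → ∀ᶠ c in l, c.val ∈ V
  eventually_notMem : ∀ K : Set G, IsCompact K → X ∩ K = ∅ → ∀ᶠ c in l, c.val ∉ K

/-- The Fell topology need not be first countable, so the sets in `𝒳(x)` are limits along filters of
Hausdorff units. -/
theorem exists_isFellLimit {x : UnitSpace G} (X : essFiber x) :
    ∃ l : Filter (UnitSpace G), l.NeBot ∧ (∀ᶠ c in l, c ∈ hausdorffUnits G) ∧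
      IsFellLimit l (X.1 : Set G) := by
  let _ := fellTopology G
  let j : hausdorffUnits G → TopologicalSpace.Closeds G := fun c =>
    ⟨{c.1.val}, isClosed_singleton_of_mem_hausdorffUnits c.2⟩
  have hX := X.2.1
  refine ⟨Filter.map Subtype.val (Filter.comap j (𝓝 X.1)), ?_, ?_, ?_, ?_⟩
  · refine Filter.map_neBot_iff _ |>.2 (Filter.comap_neBot_iff.2 fun t ht => ?_)
    obtain ⟨Z, hZt, y, hy, hZ⟩ := mem_closure_iff_nhds.1 hX t ht
    refine ⟨⟨y, hy⟩, ?_⟩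
    have : j ⟨y, hy⟩ = Z := TopologicalSpace.Closeds.ext hZ.symm
    rwa [this]
  · exact Filter.eventually_map.2 (Filter.Eventually.of_forall fun c => c.2)
  · intro V hV hne
    have hopen : IsOpen {Z : TopologicalSpace.Closeds G | (Z : Set G) ∩ ∅ = ∅ ∧
        ∀ A ∈ ({V} : Set (Set G)), ((Z : Set G) ∩ A).Nonempty} := by
      refine TopologicalSpace.isOpen_generateFrom_of_mem
        ⟨∅, {V}, isCompact_empty, Set.toFinite _, ?_, rfl⟩
      rintro A rfl
      exact hV
    have hmem := hopen.mem_nhds (x := X.1) ⟨Set.inter_empty _, by rintro A rfl; exact hne⟩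
    refine Filter.eventually_map.2 (Filter.mem_of_superset (Filter.preimage_mem_comap hmem) ?_)
    intro c hc
    obtain ⟨a, rfl, ha⟩ := hc.2 V rfl
    exact ha
  · intro K hK hXK
    have hopen : IsOpen {Z : TopologicalSpace.Closeds G | (Z : Set G) ∩ K = ∅ ∧
        ∀ A ∈ (∅ : Set (Set G)), ((Z : Set G) ∩ A).Nonempty} :=
      TopologicalSpace.isOpen_generateFrom_of_mem
        ⟨K, ∅, hK, Set.toFinite _, fun A hA => hA.elim, rfl⟩
    have hmem := hopen.mem_nhds (x := X.1) ⟨hXK, fun A hA => hA.elim⟩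
    refine Filter.eventually_map.2 (Filter.mem_of_superset (Filter.preimage_mem_comap hmem) ?_)
    intro c hc hcK
    have : c.1.val ∈ ((j c : TopologicalSpace.Closeds G) : Set G) ∩ K := ⟨rfl, hcK⟩
    rw [hc.1] at this
    exact this

variable {x : UnitSpace G} {X : essFiber x} {l : Filter (UnitSpace G)}

theorem IsFellLimit.tendsto (hl : IsFellLimit l (X.1 : Set G)) : Filter.Tendsto id l (𝓝 x) := by
  intro N hN
  obtain ⟨O, hON, hO, hxO⟩ := mem_nhds_iff.1 hN
  refine Filter.mem_map.2 (Filter.mem_of_superset (hl.eventually_mem (Subtype.val '' O)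
    (isOpenEmbedding_unit_val.isOpenMap O hO) ⟨_, val_mem_of_mem_essFiber X, x, hxO, rfl⟩) ?_)
  rintro c ⟨c', hc', e⟩
  have : c' = c := Subtype.ext e
  exact hON (this ▸ hc')

theorem src_of_mem_essFiber {g : G} (hg : g ∈ (X.1 : Set G)) : src g = x :=
  mem_isotropy_aux X continuous_src src_val hg

/-- Membership in the limit set `X` is decided by any open bisection. -/
theorem IsFellLimit.eventually_mem_iff (hl : IsFellLimit l (X.1 : Set G)) {V : OpenBisection G}
    {γ : G} (hγ : γ ∈ V.carrier) (hr : rng γ = x) :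
    ∀ᶠ c in l, (c.val ∈ V.carrier ↔ γ ∈ (X.1 : Set G)) := by
  by_cases hX : γ ∈ (X.1 : Set G)
  · filter_upwards [hl.eventually_mem V.carrier V.isOpen ⟨γ, hX, hγ⟩] with c hc
    exact iff_of_true hc hX
  · obtain ⟨K, hK, hKV, hKn⟩ := V.exists_isCompact_subset hγ X.1.isClosed.isOpen_compl hX
    have hXK : (X.1 : Set G) ∩ K = ∅ :=
      Set.eq_empty_of_forall_notMem fun k hk => (hKV hk.2).2 hk.1
    rw [hr] at hKn
    filter_upwards [hl.eventually_notMem K hK hXK, hl.tendsto hKn] with c hc hcK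
    refine iff_of_false (fun hcV => hc ?_) hX
    obtain ⟨κ, hκ, e⟩ := hcK
    have : κ = c.val := V.injOn_rng (hKV hκ).1 hcV (by rw [e, rng_val])
    rwa [← this]

/-- The sets in `𝒳(x)` are closed under products. -/
theorem mul_mem_essFiber (hG : CountablyCovered G) {s t : G} (hs : s ∈ (X.1 : Set G))
    (ht : t ∈ (X.1 : Set G)) : s * t ∈ (X.1 : Set G) := by
  obtain ⟨l, hne, -, hl⟩ := exists_isFellLimit X
  obtain ⟨V, hV⟩ := hG.exists_mem s
  obtain ⟨W, hW⟩ := hG.exists_mem t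
  have e : src s = rng t := by rw [src_of_mem_essFiber hs, rng_of_mem_essFiber X ht]
  have h := hl.eventually_mem_iff (OpenBisection.mul_mem_mul hV hW e)
    (by rw [rng_mul e, rng_of_mem_essFiber X hs])
  obtain ⟨c, hc, hcV, hcW⟩ := (h.and ((hl.eventually_mem _ V.isOpen ⟨s, hs, hV⟩).and
    (hl.eventually_mem _ W.isOpen ⟨t, ht, hW⟩))).exists
  refine hc.1 ?_
  rw [← mul_unit (src_val c)]
  exact OpenBisection.mul_mem_mul hcV hcW (by rw [src_val, rng_val])

/-- The sets in `𝒳(x)` are closed under inverses. -/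
theorem inv_mem_essFiber (hG : CountablyCovered G) {s : G} (hs : s ∈ (X.1 : Set G)) :
    s⁻¹ ∈ (X.1 : Set G) := by
  obtain ⟨l, hne, -, hl⟩ := exists_isFellLimit X
  obtain ⟨V, hV⟩ := hG.exists_mem s
  have h := hl.eventually_mem_iff (OpenBisection.inv_mem_inv hV)
    (by rw [rng_inv, src_of_mem_essFiber hs])
  obtain ⟨c, hc, hcV⟩ := (h.and (hl.eventually_mem _ V.isOpen ⟨s, hs, hV⟩)).exists
  refine hc.1 ?_
  rw [← unit_inv c]
  exact OpenBisection.inv_mem_inv hcV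

/-! ### Cosets -/

theorem mem_translate_iff {h k : G} (hh : src h = x) :
    k ∈ translate h (X.1 : Set G) ↔ rng k = rng h ∧ h⁻¹ * k ∈ (X.1 : Set G) := by
  constructor
  · rintro ⟨t, ht, rfl⟩
    have e : src h = rng t := by rw [hh, rng_of_mem_essFiber X ht]
    refine ⟨rng_mul e, ?_⟩
    change h⁻¹ * (h * t) ∈ _
    rwa [inv_mul_cancel_left e]
  · rintro ⟨hr, hk⟩
    exact ⟨_, hk, mul_inv_cancel_left hr.symm⟩

theorem self_mem_translate {h : G} (hh : src h = x) : h ∈ translate h (X.1 : Set G) :=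
  ⟨x.val, val_mem_of_mem_essFiber X, mul_unit hh⟩

theorem translate_mul_mem (hG : CountablyCovered G) {h t : G} (hh : src h = x)
    (ht : t ∈ (X.1 : Set G)) :
    translate (h * t) (X.1 : Set G) = translate h (X.1 : Set G) := by
  have hr := rng_of_mem_essFiber X ht
  have hs := src_of_mem_essFiber ht
  rw [translate_translate (by rw [hh, hr]) fun a ha => by rw [hs, rng_of_mem_essFiber X ha]]
  congr 1
  ext k
  rw [mem_translate_iff hs]
  constructor
  · rintro ⟨hk, hk'⟩
    rw [← mul_inv_cancel_left hk.symm]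
    exact mul_mem_essFiber hG ht hk'
  · intro hk
    exact ⟨by rw [rng_of_mem_essFiber X hk, hr],
      mul_mem_essFiber hG (inv_mem_essFiber hG ht) hk⟩

/-- The common range of the arrows in a coset. -/
noncomputable def cosetRng (Y : CosetSpace X) : UnitSpace G := rng Y.2.choose

theorem cosetRng_eq {Y : CosetSpace X} {h : G} (hh : src h = x)
    (e : Y.1 = translate h (X.1 : Set G)) : cosetRng Y = rng h :=
  rng_eq_of_translate_eq Y.2.choose_spec.1 hh (Y.2.choose_spec.2.symm.trans e)

theorem rng_eq_cosetRng {Y : CosetSpace X} {k : G} (hk : k ∈ Y.1) : rng k = cosetRng Y := by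
  rw [Y.2.choose_spec.2] at hk
  exact ((mem_translate_iff Y.2.choose_spec.1).1 hk).1

theorem MovesTo.exists_arrow {U : OpenBisection G} {Z Y : CosetSpace X} (H : MovesTo U Z Y) :
    ∃ u ∈ U.carrier, rng u = cosetRng Y ∧ src u = cosetRng Z := by
  obtain ⟨b, hb, h, h1, h2, h3, h4⟩ := H
  refine ⟨b, hb, ?_, ?_⟩
  · rw [cosetRng_eq (by rw [src_mul h2, h1]) h4, rng_mul h2]
  · rw [cosetRng_eq h1 h3, h2]

theorem movesTo_iff (hG : CountablyCovered G) {U : OpenBisection G} {Z Y : CosetSpace X}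
    {u h k : G} (hu : u ∈ U.carrier) (hh : src h = x) (hk : src k = x)
    (hZ : Z.1 = translate h (X.1 : Set G)) (hY : Y.1 = translate k (X.1 : Set G))
    (hur : rng u = rng k) (hus : src u = rng h) :
    MovesTo U Z Y ↔ k⁻¹ * (u * h) ∈ (X.1 : Set G) := by
  have e : rng k = rng (u * h) := by rw [rng_mul hus, hur]
  constructor
  · intro H
    obtain ⟨b, hb, h', h1, h2, h3, h4⟩ := H
    have hrb : rng b = rng u := by
      rw [hur, ← cosetRng_eq hk hY, cosetRng_eq (by rw [src_mul h2, h1]) h4, rng_mul h2]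
    have hbu : b = u := U.injOn_rng hb hu hrb
    subst hbu
    have hm : b * h ∈ translate k (X.1 : Set G) := by
      rw [← hY, h4, translate_translate h2 fun a ha => by rw [h1, rng_of_mem_essFiber X ha], ← h3,
        hZ]
      exact ⟨h, self_mem_translate hh, rfl⟩
    exact ((mem_translate_iff hk).1 hm).2
  · intro H
    refine ⟨u, hu, h, hh, hus, hZ, ?_⟩
    rw [hY, ← translate_mul_mem hG hk H, mul_inv_cancel_left e]

theorem movesTo_unit_iff {Z Y : CosetSpace X} :
    MovesTo (OpenBisection.unit G) Z Y ↔ Z = Y := by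
  constructor
  · rintro ⟨b, hb, h, h1, h2, h3, h4⟩
    apply Subtype.ext
    rw [h3, h4, eq_src_of_mem_units hb, h2, rng_mul_self]
  · rintro rfl
    obtain ⟨h, hh, hY⟩ := Z.2
    refine ⟨_, OpenBisection.val_mem_unit (rng h), h, hh, src_val _, hY, ?_⟩
    rw [rng_mul_self, hY]

open Classical in
/-- Matrix coefficients of bisection functions at the units `c` converge to those at the limit `X`,
if the cosets `hX` and `kX` are approximated by the arrows over `c` in bisections around `h`
and `k`. -/
theorem IsFellLimit.tendsto_bisFun (hG : CountablyCovered G) (hl : IsFellLimit l (X.1 : Set G))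
    {U : OpenBisection G} {θ : UnitSpace G → ℂ} (hθ : Continuous θ)
    (hθU : ∀ t ∉ rng '' U.carrier, θ t = 0) {Z Y : CosetSpace X} {h k : G} {A B : OpenBisection G}
    (hA : h ∈ A.carrier) (hB : k ∈ B.carrier) (hh : src h = x) (hk : src k = x)
    (hZ : Z.1 = translate h (X.1 : Set G)) (hY : Y.1 = translate k (X.1 : Set G)) :
    Filter.Tendsto (fun c => bisFun U θ (B.srcSec c * (A.srcSec c)⁻¹)) l
      (𝓝 (if MovesTo U Z Y then θ (cosetRng Y) else 0)) := by
  have hAx : x ∈ src '' A.carrier := ⟨h, hA, hh⟩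
  have hBx : x ∈ src '' B.carrier := ⟨k, hB, hk⟩
  have hAs : A.srcSec x = h := by rw [← hh, A.srcSec_src hA]
  have hBs : B.srcSec x = k := by rw [← hk, B.srcSec_src hB]
  have hcomp : ∀ c, src (B.srcSec c) = rng (A.srcSec c)⁻¹ := fun c => by
    rw [rng_inv, A.src_srcSec, B.src_srcSec]
  have tA : Filter.Tendsto (fun c => rng (A.srcSec c)) l (𝓝 (rng h)) := by
    have := (continuous_rng.continuousAt.comp (A.continuousAt_srcSec hAx)).tendsto.comp hl.tendsto
    simpa only [Function.comp_def, hAs, id] using this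
  have tB : Filter.Tendsto (fun c => rng (B.srcSec c)) l (𝓝 (rng k)) := by
    have := (continuous_rng.continuousAt.comp (B.continuousAt_srcSec hBx)).tendsto.comp hl.tendsto
    simpa only [Function.comp_def, hBs, id] using this
  have tθ : Filter.Tendsto (fun c => θ (rng (B.srcSec c))) l (𝓝 (θ (rng k))) :=
    (hθ.tendsto _).comp tB
  have hbis : ∀ c, B.srcSec c * (A.srcSec c)⁻¹ ∈ U.carrier →
      bisFun U θ (B.srcSec c * (A.srcSec c)⁻¹) = θ (rng (B.srcSec c)) := fun c hc => by
    rw [bisFun_of_mem hc, rng_mul (hcomp c)]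
  rw [cosetRng_eq hk hY]
  by_cases hkU : rng k ∈ rng '' U.carrier
  · obtain ⟨u, hu, hur⟩ := hkU
    by_cases hus : src u = rng h
    · have e1 : src k⁻¹ = rng u := by rw [src_inv, hur]
      have e2 : src (k⁻¹ * u) = rng h := by rw [src_mul e1, hus]
      -- `U` moves `hX` to `kX` if and only if `k⁻¹ u h ∈ X`. This is decided by whether the unit
      -- `c` lies in the bisection `B⁻¹ U A`, that is, by whether `U` contains the quotient of the
      -- arrows over `c` that lie in `B` and `A`.
      have hmem : k⁻¹ * u * h ∈ ((B.inv.mul U).mul A).carrier :=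
        OpenBisection.mul_mem_mul (OpenBisection.mul_mem_mul (OpenBisection.inv_mem_inv hB) hu e1)
          hA e2
      have hev := hl.eventually_mem_iff hmem (by rw [rng_mul e2, rng_mul e1, rng_inv, hk])
      rw [mul_mul_mul e1 hus, ← movesTo_iff hG hu hh hk hZ hY hur hus] at hev
      have key : ∀ᶠ c in l, (B.srcSec c * (A.srcSec c)⁻¹ ∈ U.carrier ↔ MovesTo U Z Y) := by
        filter_upwards [hev, hl.tendsto (A.isOpen_src_image.mem_nhds hAx),
          hl.tendsto (B.isOpen_src_image.mem_nhds hBx)] with c hc hcA hcB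
        rw [← hc]
        have hcA' := A.srcSec_mem hcA
        have hcB' := B.srcSec_mem hcB
        constructor
        · intro hcU
          have e : c.val = (B.srcSec c)⁻¹ * (B.srcSec c * (A.srcSec c)⁻¹) * A.srcSec c := by
            rw [inv_mul_cancel_left (hcomp c), inv_mul_eq_src, A.src_srcSec]
          rw [e]
          refine OpenBisection.mul_mem_mul (OpenBisection.mul_mem_mul
            (OpenBisection.inv_mem_inv hcB') hcU ?_) hcA' ?_
          · rw [src_inv, rng_mul (hcomp c)]
          · rw [inv_mul_cancel_left (hcomp c), src_inv]
        · intro hcV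
          obtain ⟨w, hw, a, ha, hwa, e⟩ := OpenBisection.exists_of_mem_mul hcV
          obtain ⟨b, hb, v, hv, hbv, rfl⟩ := OpenBisection.exists_of_mem_mul hw
          have hac : a = A.srcSec c := by
            rw [← A.srcSec_src ha, ← src_mul hwa, ← e, src_val]
          have hbc : b⁻¹ = B.srcSec c := by
            have h1 : src b⁻¹ = c := by
              rw [src_inv, ← rng_mul hbv, ← rng_mul hwa, ← e, rng_val]
            rw [← h1]
            exact (B.srcSec_src hb).symm
          have hva : src v = rng a := by rw [← hwa, src_mul hbv]
          have hv' : v = B.srcSec c * (A.srcSec c)⁻¹ := by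
            rw [← hbc, ← hac, ← mul_inv_cancel_right hva]
            congr 1
            have hbva : b⁻¹ * c.val = b⁻¹ := mul_unit (by rw [hbc, B.src_srcSec])
            rw [← hbva, e, mul_mul_mul hbv hva]
            exact (inv_mul_cancel_left (by rw [rng_mul hva, hbv])).symm
          rwa [← hv']
      by_cases H : MovesTo U Z Y
      · rw [if_pos H]
        refine tθ.congr' ?_
        filter_upwards [key] with c hc
        exact (hbis c (hc.2 H)).symm
      · rw [if_neg H]
        refine tendsto_const_nhds.congr' ?_
        filter_upwards [key] with c hc
        exact (bisFun_of_notMem fun hcU => H (hc.1 hcU)).symm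
    · -- The arrow of `U` at `r(k)` does not start at `r(h)`, and neither do nearby ones.
      have H : ¬ MovesTo U Z Y := by
        intro H
        obtain ⟨u', hu', h1, h2⟩ := H.exists_arrow
        rw [cosetRng_eq hk hY, ← hur] at h1
        rw [U.injOn_rng hu' hu h1, cosetRng_eq hh hZ] at h2
        exact hus h2
      rw [if_neg H]
      have tu : Filter.Tendsto (fun c => src (U.sec (rng (B.srcSec c)))) l (𝓝 (src u)) := by
        have := (continuous_src.continuousAt.comp
          (U.continuousAt_sec ⟨u, hu, hur⟩)).tendsto.comp tB
        rwa [← hur, Function.comp_apply, U.sec_rng hu] at this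
      obtain ⟨N, N', hN, hN', hsN, hrN, hd⟩ := t2_separation hus
      refine tendsto_const_nhds.congr' ?_
      filter_upwards [tu (hN.mem_nhds hsN), tA (hN'.mem_nhds hrN)] with c hc hc'
      refine (bisFun_of_notMem fun hcU => Set.disjoint_left.1 hd hc ?_).symm
      have h1 : U.sec (rng (B.srcSec c)) = B.srcSec c * (A.srcSec c)⁻¹ := by
        rw [← rng_mul (hcomp c), U.sec_rng hcU]
      change src (U.sec (rng (B.srcSec c))) ∈ N'
      rw [h1, src_mul (hcomp c), src_inv]
      exact hc'
  · have H : ¬ MovesTo U Z Y := fun H => by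
      obtain ⟨u, hu, h1, -⟩ := H.exists_arrow
      exact hkU ⟨u, hu, h1.trans (cosetRng_eq hk hY)⟩
    rw [if_neg H]
    rw [hθU _ hkU] at tθ
    refine squeeze_zero_norm (fun c => ?_) (tendsto_norm_zero.comp tθ)
    by_cases hc : B.srcSec c * (A.srcSec c)⁻¹ ∈ U.carrier
    · rw [hbis c hc]
      rfl
    · rw [bisFun_of_notMem hc, norm_zero]
      exact norm_nonneg _

/-! ### The quasi-regular representations on the coset spaces -/

/-- The operator on `ℓ²(G_x/X)` given by a function supported on a bisection. -/
noncomputable def IsCoefficient.cosetOp {U : OpenBisection G} {θ : UnitSpace G → ℂ}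
    (h : IsCoefficient U θ) (X : essFiber x) : L2 (CosetSpace X) →L[ℂ] L2 (CosetSpace X) :=
  relOp (MovesTo U) (fun Y => θ (cosetRng Y)) (MovesTo.right_unique U) h.exists_bound.choose
    h.exists_bound.choose_spec.1 fun _ => h.exists_bound.choose_spec.2 _

open Classical in
theorem IsCoefficient.cosetOp_basisVec {U : OpenBisection G} {θ : UnitSpace G → ℂ}
    (h : IsCoefficient U θ) (Z Y : CosetSpace X) :
    h.cosetOp X (basisVec Z) Y = if MovesTo U Z Y then θ (cosetRng Y) else 0 := by
  rw [cosetOp, relOp_apply]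
  split_ifs with H
  · rw [relFun_of_rel (MovesTo.left_unique U) _ H, basisVec_apply_self, mul_one]
  · by_cases h' : ∃ Z', MovesTo U Z' Y
    · obtain ⟨Z', h'⟩ := h'
      rw [relFun_of_rel (MovesTo.left_unique U) _ h', basisVec_apply_ne, mul_zero]
      rintro rfl
      exact H h'
    · exact relFun_of_not _ h'

theorem inner_sum_basisVec {ι κ : Type u} (T : L2 ι →L[ℂ] L2 ι) (s : Finset κ) (e : κ → ι)
    (a : κ → ℂ) :
    inner ℂ (∑ j ∈ s, a j • basisVec (e j)) (T (∑ i ∈ s, a i • basisVec (e i)))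
      = ∑ j ∈ s, ∑ i ∈ s, star (a j) * (a i * T (basisVec (e i)) (e j)) := by
  rw [sum_inner]
  refine Finset.sum_congr rfl fun j _ => ?_
  rw [map_sum, inner_sum]
  refine Finset.sum_congr rfl fun i _ => ?_
  rw [map_smul, inner_smul_left, inner_smul_right, inner_basisVec_left]
  rfl

theorem bisFun_unit_one {c : UnitSpace G} (g h : Fiber c) :
    bisFun (OpenBisection.unit G) (fun _ => 1) (g.1 * h.1⁻¹) = (basisVec h : L2 (Fiber c)) g := by
  by_cases e : g = h
  · subst e
    rw [mul_inv_eq_rng, bisFun_of_mem (OpenBisection.val_mem_unit _), basisVec_apply_self]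
  · rw [basisVec_apply_ne e, bisFun_of_notMem]
    intro hu
    have h1 := eq_rng_of_mem_units hu
    rw [rng_mul_inv_fiber] at h1
    have h2 : g.1 * h.1⁻¹ = g.1 * g.1⁻¹ := by rw [h1, mul_inv_eq_rng]
    exact e (Subtype.ext (inv_inj' (mul_left_cancel (fiber_comp g h) (fiber_comp g g) h2))).symm

/-- The quasi-regular representation of `G` on `ℓ²(G_x/X)`, for `X ∈ 𝒳(x)`, is weakly contained in
the direct sum of the regular representations over the Hausdorff units. -/
theorem norm_inner_cosetOp_le (hG : CountablyCovered G) {n : ℕ} {U : Fin n → OpenBisection G}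
    {θ : Fin n → UnitSpace G → ℂ} (h : ∀ k, IsCoefficient (U k) (θ k)) {ε : ℝ}
    (hε : ∀ c ∈ hausdorffUnits G, ‖∑ k, (h k).op c‖ ≤ ε) (ψ : L2 (CosetSpace X)) :
    ‖inner ℂ ψ ((∑ k, (h k).cosetOp X) ψ)‖ ≤ ε * ‖ψ‖ ^ 2 := by
  classical
  -- Finitely supported vectors suffice.
  suffices hfin : ∀ s : Finset (CosetSpace X),
      ‖inner ℂ (∑ Y ∈ s, ψ Y • basisVec Y) ((∑ k, (h k).cosetOp X) (∑ Y ∈ s, ψ Y • basisVec Y))‖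
        ≤ ε * ‖(∑ Y ∈ s, ψ Y • basisVec Y : L2 (CosetSpace X))‖ ^ 2 by
    have hs : Filter.Tendsto (fun s : Finset (CosetSpace X) => ∑ Y ∈ s, ψ Y • basisVec Y)
      Filter.atTop (𝓝 ψ) := hasSum_basisVec ψ
    refine le_of_tendsto_of_tendsto' (b := Filter.atTop) ?_ ?_ hfin
    · exact (hs.inner (((∑ k, (h k).cosetOp X).continuous.tendsto ψ).comp hs)).norm
    · exact (hs.norm.pow 2).const_mul ε
  intro s
  obtain ⟨l, hne, hlC, hl⟩ := exists_isFellLimit X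
  choose rep hrep hrepY using fun Y : CosetSpace X => Y.2
  choose B hB using fun Y : CosetSpace X => hG.exists_mem (rep Y)
  -- Carry `ψ` over to nearby units `c`, replacing each coset by an arrow over `c` that is close
  -- to a representative of the coset.
  let e : ∀ (c : UnitSpace G), CosetSpace X → Fiber c := fun c Y =>
    ⟨(B Y).srcSec c, (B Y).src_srcSec c⟩
  let v : ∀ c : UnitSpace G, L2 (Fiber c) := fun c => ∑ Y ∈ s, ψ Y • basisVec (e c Y)
  have h1 : Filter.Tendsto (fun c => inner ℂ (v c) ((∑ k, (h k).op c) (v c))) l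
      (𝓝 (inner ℂ (∑ Y ∈ s, ψ Y • basisVec Y)
        ((∑ k, (h k).cosetOp X) (∑ Y ∈ s, ψ Y • basisVec Y)))) := by
    simp only [v]
    simp_rw [inner_sum_basisVec _ s (e _)]
    rw [inner_sum_basisVec _ s (fun Y => Y)]
    refine tendsto_finsetSum _ fun Y _ => tendsto_finsetSum _ fun Z _ =>
      Filter.Tendsto.const_mul _ (Filter.Tendsto.const_mul _ ?_)
    simp only [sum_apply, lp.coeFn_sum, Finset.sum_apply]
    refine tendsto_finsetSum _ fun k _ => ?_
    simp only [(h k).isConvolution_op.matrixCoeff, (h k).cosetOp_basisVec]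
    exact hl.tendsto_bisFun hG (h k).continuous (fun _ => (h k).eq_zero) (hB Z) (hB Y) (hrep Z)
      (hrep Y) (hrepY Z) (hrepY Y)
  have h2 : Filter.Tendsto (fun c => inner ℂ (v c) (v c)) l
      (𝓝 (inner ℂ (∑ Y ∈ s, ψ Y • basisVec Y : L2 (CosetSpace X))
        (∑ Y ∈ s, ψ Y • basisVec Y))) := by
    simp only [v]
    have g1 : ∀ c, inner ℂ (∑ Y ∈ s, ψ Y • basisVec (e c Y) : L2 (Fiber c))
        (∑ Y ∈ s, ψ Y • basisVec (e c Y)) = _ := fun c =>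
      inner_sum_basisVec (ContinuousLinearMap.id ℂ (L2 (Fiber c))) s (e c) ψ
    have g2 : inner ℂ (∑ Y ∈ s, ψ Y • basisVec Y : L2 (CosetSpace X))
        (∑ Y ∈ s, ψ Y • basisVec Y) = _ :=
      inner_sum_basisVec (ContinuousLinearMap.id ℂ (L2 (CosetSpace X))) s (fun Y => Y) ψ
    simp_rw [g1]
    rw [g2]
    refine tendsto_finsetSum _ fun Y _ => tendsto_finsetSum _ fun Z _ =>
      Filter.Tendsto.const_mul _ (Filter.Tendsto.const_mul _ ?_)
    simp only [ContinuousLinearMap.id_apply, ← bisFun_unit_one]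
    have h3 := hl.tendsto_bisFun hG (U := OpenBisection.unit G) (θ := fun _ => 1)
      continuous_const (fun t ht => (ht ⟨_, OpenBisection.val_mem_unit t, rng_val t⟩).elim)
      (hB Z) (hB Y) (hrep Z) (hrep Y) (hrepY Z) (hrepY Y)
    have h4 : (basisVec Z : L2 (CosetSpace X)) Y
        = if MovesTo (OpenBisection.unit G) Z Y then 1 else 0 := by
      simp only [movesTo_unit_iff]
      split_ifs with H
      · rw [H, basisVec_apply_self]
      · exact basisVec_apply_ne (Ne.symm H)
    rw [h4]
    exact h3
  have h5 : ∀ᶠ c in l, ‖inner ℂ (v c) ((∑ k, (h k).op c) (v c))‖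
      ≤ ε * ‖inner ℂ (v c) (v c)‖ := by
    filter_upwards [hlC] with c hc
    rw [inner_self_eq_norm_sq_to_K, norm_pow, RCLike.norm_ofReal, abs_norm]
    calc ‖inner ℂ (v c) ((∑ k, (h k).op c) (v c))‖
        ≤ ‖v c‖ * ‖(∑ k, (h k).op c) (v c)‖ := norm_inner_le_norm _ _
      _ ≤ ‖v c‖ * (ε * ‖v c‖) := by
          gcongr
          exact ContinuousLinearMap.le_of_opNorm_le _ (hε c hc) _
      _ = ε * ‖v c‖ ^ 2 := by ring
  have h6 := le_of_tendsto_of_tendsto h1.norm (h2.norm.const_mul ε) h5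
  rwa [inner_self_eq_norm_sq_to_K (𝕜 := ℂ) (∑ Y ∈ s, ψ Y • basisVec Y : L2 (CosetSpace X)),
    norm_pow, RCLike.norm_ofReal, abs_norm] at h6

end EssentialFibres

/-! ### Weak containment implies that the singular ideal vanishes -/

section WeakContainment

variable {G : Type u} [TopologicalSpace G] [ArrowGroupoid G] [EtaleGroupoid G]

/-- Multiplication by a bounded function on `ℓ²(ι)`. -/
noncomputable def diagOp {ι : Type u} (w : ι → ℂ) (M : ℝ) (hM : 0 ≤ M) (hw : ∀ i, ‖w i‖ ≤ M) :
    L2 ι →L[ℂ] L2 ι :=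
  relOp (fun i j => i = j) w (fun _ _ _ e e' => e.symm.trans e') M hM hw

theorem diagOp_apply {ι : Type u} (w : ι → ℂ) (M : ℝ) (hM : 0 ≤ M) (hw : ∀ i, ‖w i‖ ≤ M)
    (ψ : L2 ι) (i : ι) : diagOp w M hM hw ψ i = w i * ψ i := by
  rw [diagOp, relOp_apply, relFun_of_rel (fun _ _ _ e e' => e.trans e'.symm) ψ rfl]

theorem norm_diagOp_le {ι : Type u} (w : ι → ℂ) (M : ℝ) (hM : 0 ≤ M) (hw : ∀ i, ‖w i‖ ≤ M) :
    ‖diagOp w M hM hw‖ ≤ M := norm_relOp_le _ _ _ _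

/-- The empty bisection. -/
def OpenBisection.empty (G : Type u) [TopologicalSpace G] [ArrowGroupoid G] :
    OpenBisection G where
  carrier := ∅
  isOpen := isOpen_empty
  injOn_src := Set.injOn_empty _
  injOn_rng := Set.injOn_empty _

variable {x : UnitSpace G} {X : essFiber x}

theorem norm_bisectionOp_le (B : OpenBisection G) (X : essFiber x) : ‖bisectionOp B X‖ ≤ 1 :=
  norm_relOp_le _ _ _ _

theorem bisectionOp_apply_of_movesTo {B : OpenBisection G} {Z Y : CosetSpace X}
    (H : MovesTo B Z Y) (ψ : L2 (CosetSpace X)) : bisectionOp B X ψ Y = ψ Z := by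
  rw [bisectionOp, relOp_apply, relFun_of_rel (MovesTo.left_unique B) _ H, one_mul]

theorem bisectionOp_apply_of_not {B : OpenBisection G} {Y : CosetSpace X}
    (H : ¬ ∃ Z, MovesTo B Z Y) (ψ : L2 (CosetSpace X)) : bisectionOp B X ψ Y = 0 := by
  rw [bisectionOp, relOp_apply, relFun_of_not _ H]

theorem bisectionOp_unit (ψ : L2 (CosetSpace X)) :
    bisectionOp (OpenBisection.unit G) X ψ = ψ := by
  ext Y
  exact bisectionOp_apply_of_movesTo (movesTo_unit_iff.2 rfl) ψ

theorem bisectionOp_empty (ψ : L2 (CosetSpace X)) :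
    bisectionOp (OpenBisection.empty G) X ψ = 0 := by
  ext Y
  exact bisectionOp_apply_of_not (fun ⟨_, _, hb, _⟩ => hb.elim) ψ

theorem IsCoefficient.cosetOp_apply_of_movesTo {U : OpenBisection G} {θ : UnitSpace G → ℂ}
    (h : IsCoefficient U θ) {Z Y : CosetSpace X} (H : MovesTo U Z Y) (ψ : L2 (CosetSpace X)) :
    h.cosetOp X ψ Y = θ (cosetRng Y) * ψ Z := by
  rw [cosetOp, relOp_apply, relFun_of_rel (MovesTo.left_unique U) _ H]

theorem IsCoefficient.cosetOp_apply_of_not {U : OpenBisection G} {θ : UnitSpace G → ℂ}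
    (h : IsCoefficient U θ) {Y : CosetSpace X} (H : ¬ ∃ Z, MovesTo U Z Y)
    (ψ : L2 (CosetSpace X)) : h.cosetOp X ψ Y = 0 := by
  rw [cosetOp, relOp_apply, relFun_of_not _ H]

theorem MovesTo.of_forall {U V : OpenBisection G} {Z Y : CosetSpace X} (H : MovesTo U Z Y)
    (h : ∀ u ∈ U.carrier, rng u = cosetRng Y → src u = cosetRng Z → u ∈ V.carrier) :
    MovesTo V Z Y := by
  obtain ⟨b, hb, k, h1, h2, h3, h4⟩ := H
  refine ⟨b, h b hb ?_ ?_, k, h1, h2, h3, h4⟩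
  · rw [cosetRng_eq (by rw [src_mul h2, h1]) h4, rng_mul h2]
  · rw [cosetRng_eq h1 h3, h2]

/-- On vectors supported over a set `W` on which the coefficient is almost constant, a function
supported on `U` acts almost as a multiple of the indicator function of any bisection that has the
same arrows between points of `W`. -/
theorem norm_inner_cosetOp_sub_le {U V : OpenBisection G} {θ : UnitSpace G → ℂ}
    (h : IsCoefficient U θ) {W : Set (UnitSpace G)} {c : ℂ} {δ : ℝ} (hδ : 0 ≤ δ)
    (hθ : ∀ t ∈ W, ‖θ t - c‖ ≤ δ)
    (hUV : ∀ u, rng u ∈ W → src u ∈ W → (u ∈ U.carrier ↔ u ∈ V.carrier))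
    {ψ : L2 (CosetSpace X)} (hψ : ∀ Y, ψ Y ≠ 0 → cosetRng Y ∈ W) :
    ‖inner ℂ ψ (h.cosetOp X ψ) - c * inner ℂ ψ (bisectionOp V X ψ)‖ ≤ δ * ‖ψ‖ ^ 2 := by
  classical
  have key : ∀ Y, ψ Y ≠ 0 → h.cosetOp X ψ Y = θ (cosetRng Y) * bisectionOp V X ψ Y := by
    intro Y hY
    have hUV' : ∀ Z, MovesTo U Z Y → ψ Z ≠ 0 → MovesTo V Z Y := fun Z H hZ =>
      H.of_forall fun u hu hr hs => (hUV u (hr ▸ hψ Y hY) (hs ▸ hψ Z hZ)).1 hu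
    have hVU' : ∀ Z, MovesTo V Z Y → ψ Z ≠ 0 → MovesTo U Z Y := fun Z H hZ =>
      H.of_forall fun u hu hr hs => (hUV u (hr ▸ hψ Y hY) (hs ▸ hψ Z hZ)).2 hu
    by_cases hU : ∃ Z, MovesTo U Z Y ∧ ψ Z ≠ 0
    · obtain ⟨Z, HZ, hZ⟩ := hU
      rw [h.cosetOp_apply_of_movesTo HZ, bisectionOp_apply_of_movesTo (hUV' Z HZ hZ)]
    · have h1 : h.cosetOp X ψ Y = 0 := by
        by_cases H : ∃ Z, MovesTo U Z Y
        · obtain ⟨Z, H⟩ := H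
          have : ψ Z = 0 := by
            by_contra hZ
            exact hU ⟨Z, H, hZ⟩
          rw [h.cosetOp_apply_of_movesTo H, this, mul_zero]
        · exact h.cosetOp_apply_of_not H ψ
      have h2 : bisectionOp V X ψ Y = 0 := by
        by_cases H : ∃ Z, MovesTo V Z Y
        · obtain ⟨Z, H⟩ := H
          rw [bisectionOp_apply_of_movesTo H]
          by_contra hZ
          exact hU ⟨Z, hVU' Z H hZ, hZ⟩
        · exact bisectionOp_apply_of_not H ψ
      rw [h1, h2, mul_zero]
  let w : CosetSpace X → ℂ := fun Y => if cosetRng Y ∈ W then θ (cosetRng Y) - c else 0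
  have hw : ∀ Y, ‖w Y‖ ≤ δ := by
    intro Y
    simp only [w]
    split_ifs with hY
    · exact hθ _ hY
    · rwa [norm_zero]
  have e : inner ℂ ψ (h.cosetOp X ψ) - c * inner ℂ ψ (bisectionOp V X ψ)
      = inner ℂ ψ (diagOp w δ hδ hw (bisectionOp V X ψ)) := by
    rw [← inner_smul_right, ← inner_sub_right, lp.inner_eq_tsum, lp.inner_eq_tsum]
    refine tsum_congr fun Y => ?_
    by_cases hY : ψ Y = 0
    · rw [hY, inner_zero_left, inner_zero_left]
    · congr 1
      rw [diagOp_apply, lp.coeFn_sub, Pi.sub_apply, key Y hY, lp.coeFn_smul, Pi.smul_apply,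
        smul_eq_mul, ← sub_mul]
      simp only [w]
      rw [if_pos (hψ Y hY)]
  rw [e]
  calc ‖inner ℂ ψ (diagOp w δ hδ hw (bisectionOp V X ψ))‖
      ≤ ‖ψ‖ * ‖diagOp w δ hδ hw (bisectionOp V X ψ)‖ := norm_inner_le_norm _ _
    _ ≤ ‖ψ‖ * (δ * (1 * ‖ψ‖)) := by
        gcongr
        refine (ContinuousLinearMap.le_of_opNorm_le _ (norm_diagOp_le w δ hδ hw) _).trans ?_
        gcongr
        exact ContinuousLinearMap.le_of_opNorm_le _ (norm_bisectionOp_le V X) _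
    _ = δ * ‖ψ‖ ^ 2 := by ring

/-- Near a unit `x`, a function supported on a bisection is approximately a combination of the
indicator functions of the unit space and of the chosen bisection at one isotropy element. -/
theorem IsCoefficient.exists_nhds_norm_inner_le {B : G → OpenBisection G} (x : UnitSpace G)
    (hB : ∀ g ∈ isotropy x, g ∈ (B g).carrier) {U : OpenBisection G} {θ : UnitSpace G → ℂ}
    (h : IsCoefficient U θ) {δ : ℝ} (hδ : 0 < δ) :
    ∃ F : Finset G, (F : Set G) ⊆ isotropy x \ {x.val} ∧ ∃ N ∈ 𝓝 x,
      ∀ (y : UnitSpace G) (X : essFiber y) (ψ : L2 (CosetSpace X)),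
        (∀ Y, ψ Y ≠ 0 → cosetRng Y ∈ N) →
        ‖inner ℂ ψ (h.cosetOp X ψ) - bisFun U θ x.val * inner ℂ ψ ψ
          - ∑ g ∈ F, θ x * inner ℂ ψ (bisectionOp (B g) X ψ)‖ ≤ δ * ‖ψ‖ ^ 2 := by
  have hθ : {t | ‖θ t - θ x‖ ≤ δ} ∈ 𝓝 x := by
    have h1 := (h.continuous.continuousAt (x := x)).tendsto.eventually
      (Metric.closedBall_mem_nhds (θ x) hδ)
    simp only [dist_eq_norm] at h1
    exact h1
  by_cases hxr : x ∈ rng '' U.carrier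
  · obtain ⟨u, hu, hur⟩ := hxr
    have tu : Filter.Tendsto (fun t => src (U.sec t)) (𝓝 x) (𝓝 (src u)) := by
      have := (continuous_src.continuousAt.comp (U.continuousAt_sec ⟨u, hu, hur⟩)).tendsto
      rwa [Function.comp_apply, ← hur, U.sec_rng hu, hur] at this
    by_cases hus : src u = x
    · by_cases hux : u = x.val
      · -- The bisection contains the unit `x`.
        subst hux
        refine ⟨∅, by simp, {t | ‖θ t - θ x‖ ≤ δ} ∩ U.units,
          Filter.inter_mem hθ (U.isOpen_unitsSet.mem_nhds hu), fun y X ψ hψ => ?_⟩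
        rw [Finset.sum_empty, sub_zero, bisFun_of_mem hu, rng_val]
        have h1 := norm_inner_cosetOp_sub_le (V := OpenBisection.unit G) h hδ.le
          (fun t ht => ht.1) (fun v hr hs => ?_) hψ
        · rwa [bisectionOp_unit] at h1
        · constructor
          · intro hv
            exact ⟨rng v, U.injOn_rng hr.2 hv (rng_val _)⟩
          · intro hv
            rw [eq_rng_of_mem_units hv]
            exact hr.2
      · -- The bisection contains the isotropy element `u`, like `B u`.
        have hiso : u ∈ isotropy x := ⟨hus, hur⟩
        have hop : rng '' (U.carrier ∩ (B u).carrier) ∈ 𝓝 x :=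
          (isOpenMap_rng _ (U.isOpen.inter (B u).isOpen)).mem_nhds ⟨u, ⟨hu, hB u hiso⟩, hur⟩
        refine ⟨{u}, ?_, {t | ‖θ t - θ x‖ ≤ δ} ∩ rng '' (U.carrier ∩ (B u).carrier),
          Filter.inter_mem hθ hop, fun y X ψ hψ => ?_⟩
        · rw [Finset.coe_singleton, Set.singleton_subset_iff]
          exact ⟨hiso, hux⟩
        · have hx0 : bisFun U θ x.val = 0 := bisFun_of_notMem fun hx =>
            hux (U.injOn_rng hu hx (by rw [hur, rng_val]))
          rw [hx0, zero_mul, sub_zero, Finset.sum_singleton]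
          refine norm_inner_cosetOp_sub_le h hδ.le (fun t ht => ht.1) (fun v hr hs => ?_) hψ
          obtain ⟨-, v', ⟨hv'U, hv'B⟩, e⟩ := hr
          constructor
          · intro hv
            rwa [U.injOn_rng hv hv'U e.symm]
          · intro hv
            rwa [(B u).injOn_rng hv hv'B e.symm]
    · -- The arrow of the bisection with range `x` moves `x` away.
      obtain ⟨N, N', hN, hN', hsN, hxN', hd⟩ := t2_separation hus
      refine ⟨∅, by simp, {t | ‖θ t - θ x‖ ≤ δ} ∩ ((fun t => src (U.sec t)) ⁻¹' N ∩ N'),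
        Filter.inter_mem hθ (Filter.inter_mem (tu (hN.mem_nhds hsN)) (hN'.mem_nhds hxN')),
        fun y X ψ hψ => ?_⟩
      have hx0 : bisFun U θ x.val = 0 := bisFun_of_notMem fun hx => hus <| by
        rw [U.injOn_rng hu hx (by rw [hur, rng_val]), src_val]
      rw [Finset.sum_empty, sub_zero, hx0, zero_mul, sub_zero]
      have h1 := norm_inner_cosetOp_sub_le (V := OpenBisection.empty G) h hδ.le
        (fun t ht => ht.1) (fun v hr hs => ?_) hψ
      · rwa [bisectionOp_empty, inner_zero_right, mul_zero, sub_zero] at h1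
      · refine iff_of_false (fun hv => ?_) (fun hv => hv.elim)
        have h2 := hr.2.1
        rw [Set.mem_preimage, U.sec_rng hv] at h2
        exact Set.disjoint_left.1 hd h2 hs.2.2
  · -- The coefficient vanishes at `x`, so any bisection will do.
    have hx0 : bisFun U θ x.val = 0 := bisFun_of_notMem fun hx => hxr ⟨_, hx, rng_val x⟩
    refine ⟨∅, by simp, {t | ‖θ t - θ x‖ ≤ δ}, hθ, fun y X ψ hψ => ?_⟩
    rw [Finset.sum_empty, sub_zero, hx0, zero_mul, sub_zero]
    have h1 := norm_inner_cosetOp_sub_le (V := U) h hδ.le (fun t ht => ht)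
      (fun v hr hs => Iff.rfl) hψ
    rwa [h.eq_zero hxr, zero_mul, sub_zero] at h1

/-- Weak containment at the unit `x` forces elements of the singular ideal to vanish at `x`. -/
theorem IsGWeaklyContained.toFunction_eq_zero (hG : CountablyCovered G) {B : G → OpenBisection G}
    {x : UnitSpace G} (hB : ∀ g ∈ isotropy x, g ∈ (B g).carrier) (hx : IsGWeaklyContained B x)
    {a : reducedAlgebra G} (ha : a ∈ singularIdeal G) : toFunction a.1 x.val = 0 := by
  classical
  suffices hs : ∀ ε : ℝ, 0 < ε → ‖toFunction a.1 x.val‖ ≤ 4 * ε by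
    have h0 : ‖toFunction a.1 x.val‖ ≤ 0 := le_of_forall_pos_le_add fun ε hε => by
      have := hs (ε / 4) (by positivity)
      linarith
    exact norm_le_zero_iff.1 h0
  intro ε hε
  obtain ⟨S, hS, haS⟩ := memReduced_iff.1 ⟨a.1, a.2, fun _ => rfl⟩ ε hε
  obtain ⟨n, U, θ, h, hSop⟩ := hS.exists_eq_sum
  have hC : ∀ c ∈ hausdorffUnits G, ‖∑ k, (h k).op c‖ ≤ ε := by
    intro c hc
    have h1 := haS c
    rwa [(mem_singularIdeal_iff hG).1 ha c hc, zero_sub, norm_neg, hSop] at h1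
  have hval : ‖toFunction a.1 x.val - ∑ k, bisFun (U k) (θ k) x.val‖ ≤ ε := by
    let i : Fiber x := ⟨x.val, src_val x⟩
    have hi : i.1 * i.1⁻¹ = x.val := by rw [mul_inv_eq_rng, rng_val]
    have h1 := (norm_matrixCoeff_le (a.1 x - S x) i i).trans (haS x)
    have h2 : (a.1 x - S x) (basisVec i) i
        = toFunction a.1 x.val - ∑ k, bisFun (U k) (θ k) x.val := by
      rw [hSop x]
      change a.1 x (basisVec i) i - (∑ k, (h k).op x) (basisVec i) i = _
      rw [matrixCoeff_eq_toFunction a.2, sum_apply, lp.coeFn_sum, Finset.sum_apply, hi]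
      simp only [(h _).isConvolution_op.matrixCoeff, hi]
    rwa [h2] at h1
  let δ : ℝ := ε / (n + 1)
  have hδ : 0 < δ := by positivity
  choose F hF N hN hFN using fun k => (h k).exists_nhds_norm_inner_le x hB hδ
  let F' : Finset G := Finset.univ.biUnion F
  have hF' : (F' : Set G) ⊆ isotropy x \ {x.val} := by
    intro g hg
    obtain ⟨k, -, hk⟩ := Finset.mem_biUnion.1 (Finset.mem_coe.1 hg)
    exact hF k hk
  let W : Set (UnitSpace G) := interior (⋂ k, N k) ∩
    ⋂ g ∈ F', (rng '' (B g).carrier ∩ src '' (B g).carrier)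
  have hW : IsOpen W := isOpen_interior.inter <| isOpen_biInter_finset fun g _ =>
    (B g).isOpen_rng_image.inter (B g).isOpen_src_image
  have hxW : x ∈ W := by
    refine ⟨mem_interior_iff_mem_nhds.2 (Filter.iInter_mem.2 hN), ?_⟩
    refine Set.mem_iInter₂.2 fun g hg => ?_
    have hgi := (hF' hg).1
    exact ⟨⟨g, hB g hgi, hgi.2⟩, ⟨g, hB g hgi, hgi.1⟩⟩
  let M : ℝ := ∑ k, ∑ _g ∈ F k, ‖θ k x‖
  have hM : 0 ≤ M := Finset.sum_nonneg fun _ _ => Finset.sum_nonneg fun _ _ => norm_nonneg _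
  obtain ⟨m, y, X, ψ, -, hψW, hψ1, hψF⟩ := hx (ε / (M + 1)) (by positivity) F' hF' W hW hxW
    fun g hg => Set.inter_subset_right.trans (Set.iInter₂_subset g hg)
  have hψN : ∀ k i Y, ψ i Y ≠ 0 → cosetRng Y ∈ N k := by
    intro k i Y hY
    obtain ⟨g, hg, hgY⟩ := Y.2
    have hgm : g ∈ Y.1 := by rw [hgY]; exact self_mem_translate hg
    have h1 := (hψW i Y hY g hgm).1
    rw [rng_eq_cosetRng hgm] at h1
    exact Set.mem_iInter.1 (interior_subset h1) k
  have hnorm : ∑ i, ‖ψ i‖ ^ 2 = 1 := by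
    have h1 := congrArg Complex.re hψ1
    rw [Complex.re_sum, Complex.one_re] at h1
    rw [← h1]
    refine Finset.sum_congr rfl fun i _ => ?_
    rw [← inner_self_eq_norm_sq (𝕜 := ℂ)]
    rfl
  -- The approximation of `a` at `x` is a sum of values at the vectors `ψ i`, up to the errors of
  -- the local approximations and the terms with the bisections `B g`. Each of the three is at
  -- most `ε`.
  have hA : ‖∑ i, inner ℂ (ψ i) ((∑ k, (h k).cosetOp (X i)) (ψ i))‖ ≤ ε := by
    calc ‖∑ i, inner ℂ (ψ i) ((∑ k, (h k).cosetOp (X i)) (ψ i))‖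
        ≤ ∑ i, ε * ‖ψ i‖ ^ 2 :=
          norm_sum_le_of_le _ fun i _ => norm_inner_cosetOp_le hG h hC (ψ i)
      _ = ε := by rw [← Finset.mul_sum, hnorm, mul_one]
  have hE : ‖∑ k, ∑ i, (inner ℂ (ψ i) ((h k).cosetOp (X i) (ψ i))
      - bisFun (U k) (θ k) x.val * inner ℂ (ψ i) (ψ i)
      - ∑ g ∈ F k, θ k x * inner ℂ (ψ i) (bisectionOp (B g) (X i) (ψ i)))‖ ≤ ε := by
    calc _ ≤ ∑ _k : Fin n, δ := by
          refine norm_sum_le_of_le _ fun k _ => ?_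
          calc _ ≤ ∑ i, δ * ‖ψ i‖ ^ 2 :=
                norm_sum_le_of_le _ fun i _ => hFN k (y i) (X i) (ψ i) (hψN k i)
            _ = δ := by rw [← Finset.mul_sum, hnorm, mul_one]
      _ = n * δ := by rw [Finset.sum_const, Finset.card_univ, Fintype.card_fin, nsmul_eq_mul]
      _ ≤ (n + 1) * δ := by gcongr; linarith
      _ = ε := by simp only [δ]; field_simp
  have hR : ‖∑ k, ∑ g ∈ F k, θ k x *
      ∑ i, inner ℂ (ψ i) (bisectionOp (B g) (X i) (ψ i))‖ ≤ ε := by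
    calc _ ≤ ∑ k, ∑ _g ∈ F k, ‖θ k x‖ * (ε / (M + 1)) := by
          refine norm_sum_le_of_le _ fun k _ => norm_sum_le_of_le _ fun g hg => ?_
          rw [norm_mul]
          gcongr
          exact hψF g (Finset.mem_biUnion.2 ⟨k, Finset.mem_univ k, hg⟩)
      _ = M * (ε / (M + 1)) := by simp only [M, Finset.sum_mul]
      _ ≤ (M + 1) * (ε / (M + 1)) := by gcongr; linarith
      _ = ε := by field_simp
  have hsum : ∑ k, bisFun (U k) (θ k) x.val
      = ∑ i, inner ℂ (ψ i) ((∑ k, (h k).cosetOp (X i)) (ψ i))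
        - (∑ k, ∑ i, (inner ℂ (ψ i) ((h k).cosetOp (X i) (ψ i))
            - bisFun (U k) (θ k) x.val * inner ℂ (ψ i) (ψ i)
            - ∑ g ∈ F k, θ k x * inner ℂ (ψ i) (bisectionOp (B g) (X i) (ψ i))))
        - ∑ k, ∑ g ∈ F k, θ k x * ∑ i, inner ℂ (ψ i) (bisectionOp (B g) (X i) (ψ i)) := by
    have e1 : ∑ i, inner ℂ (ψ i) ((∑ k, (h k).cosetOp (X i)) (ψ i))
        = ∑ k, ∑ i, inner ℂ (ψ i) ((h k).cosetOp (X i) (ψ i)) := by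
      rw [Finset.sum_comm]
      refine Finset.sum_congr rfl fun i _ => ?_
      rw [sum_apply, inner_sum]
    rw [e1, ← Finset.sum_sub_distrib, ← Finset.sum_sub_distrib]
    refine Finset.sum_congr rfl fun k _ => ?_
    have e2 : ∑ g ∈ F k, θ k x * ∑ i, inner ℂ (ψ i) (bisectionOp (B g) (X i) (ψ i))
        = ∑ i, ∑ g ∈ F k, θ k x * inner ℂ (ψ i) (bisectionOp (B g) (X i) (ψ i)) := by
      rw [Finset.sum_comm]
      exact Finset.sum_congr rfl fun g _ => Finset.mul_sum _ _ _
    rw [Finset.sum_sub_distrib, Finset.sum_sub_distrib, ← Finset.mul_sum, hψ1, e2]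
    ring
  have h1 := norm_sub_norm_le (toFunction a.1 x.val) (∑ k, bisFun (U k) (θ k) x.val)
  have h2 : ‖∑ k, bisFun (U k) (θ k) x.val‖ ≤ ε + ε + ε := by
    rw [hsum]
    exact (norm_sub_le _ _).trans (add_le_add ((norm_sub_le _ _).trans (add_le_add hA hE)) hR)
  linarith

/-- Bump functions on the unit space. -/
theorem exists_isCoefficient_eq_one {O : Set (UnitSpace G)} (hO : IsOpen O) {x : UnitSpace G}
    (hx : x ∈ O) :
    ∃ φ : UnitSpace G → ℝ, φ x = 1 ∧ (∀ t ∉ O, φ t = 0) ∧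
      ∀ U : OpenBisection G, O ⊆ rng '' U.carrier → IsCoefficient U fun t => (φ t : ℂ) := by
  obtain ⟨L, hL, hLO, hLc⟩ := local_compact_nhds (hO.mem_nhds hx)
  obtain ⟨f, hf1, hf0, -, -⟩ := exists_continuous_one_zero_of_isCompact
    (isCompact_singleton (x := x)) isOpen_interior.isClosed_compl
    (Set.disjoint_singleton_left.2 fun h => h (mem_interior_iff_mem_nhds.2 hL))
  have h0 : ∀ t ∉ L, f t = 0 := fun t ht => hf0 fun h => ht (interior_subset h)
  have hsub : tsupport (fun t => (f t : ℂ)) ⊆ L := by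
    refine closure_minimal (fun t ht => ?_) hLc.isClosed
    by_contra h
    exact ht (by simp only [h0 t h, Complex.ofReal_zero])
  exact ⟨f, hf1 rfl, fun t ht => h0 t fun h => ht (hLO h), fun U hU =>
    ⟨Complex.continuous_ofReal.comp f.continuous, HasCompactSupport.of_support_subset_isCompact hLc
      (subset_closure.trans hsub), hsub.trans (hLO.trans hU)⟩⟩

theorem singularIdeal_eq_bot_of_isGWeaklyContained (hG : CountablyCovered G)
    {B : G → OpenBisection G} (hB : ∀ x : UnitSpace G, ∀ g ∈ isotropy x, g ∈ (B g).carrier)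
    (h : ∀ x : UnitSpace G, IsGWeaklyContained B x) : singularIdeal G = ⊥ := by
  rw [Submodule.eq_bot_iff]
  intro a ha
  apply Subtype.ext
  refine eq_zero_of_toFunction a.2 fun g => ?_
  -- Left multiplication by a function on a bisection around `g⁻¹` moves the value at `g` to `s(g)`.
  obtain ⟨V, hV⟩ := hG.exists_mem g⁻¹
  obtain ⟨φ, hφ1, -, hφV⟩ := exists_isCoefficient_eq_one V.isOpen_rng_image
    (x := src g) ⟨g⁻¹, hV, rng_inv g⟩
  have hφ := hφV V subset_rfl
  obtain ⟨b, hb, hba⟩ := hφ.memReduced_op.mul ⟨a.1, a.2, fun _ => rfl⟩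
  have hbJ : (⟨b, hb⟩ : reducedAlgebra G) ∈ singularIdeal G := by
    refine (mem_singularIdeal_iff hG).2 fun c hc => ?_
    change b c = 0
    rw [hba c]
    change hφ.op c * a.1 c = 0
    rw [(mem_singularIdeal_iff hG).1 ha c hc, mul_zero]
  have h0 := (h (src g)).toFunction_eq_zero hG (hB _) hbJ
  let i : Fiber (src g) := ⟨(src g).val, src_val _⟩
  have hi : i.1 * i.1⁻¹ = (src g).val := by rw [mul_inv_eq_rng, rng_val]
  have h1 : toFunction b (src g).val = b (src g) (basisVec i) i := by
    rw [matrixCoeff_eq_toFunction hb, hi]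
  have h2 : (V.pull i : Fiber (src g)) = ⟨g, rfl⟩ := by
    apply Subtype.ext
    change (V.sec (rng (src g).val))⁻¹ * (src g).val = g
    rw [rng_val, ← rng_inv, V.sec_rng hV, inv_inv_self, rng_inv, mul_src]
  have h3 : b (src g) (basisVec i) i = toFunction a.1 g := by
    rw [hba]
    change hφ.op (src g) (a.1 (src g) (basisVec i)) i = _
    rw [hφ.op_apply, h2, rng_val, hφ1, Complex.ofReal_one, one_mul, ← toFunction_eq]
  rw [← h3, ← h1]
  exact h0

end WeakContainment

/-! ### Vector functionals at Hausdorff units when the singular ideal vanishes -/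

section Functionals

variable {G : Type u} [TopologicalSpace G] [ArrowGroupoid G] [EtaleGroupoid G]

/-- If `J = 0`, the vector functionals at arbitrary units are limits of sums of vector functionals
at Hausdorff units: otherwise the Hahn–Banach theorem provides a self-adjoint element that is
positive at all Hausdorff units but not positive, and its negative part lies in `J`. -/
theorem exists_abs_sum_re_inner_sub_lt (hG : CountablyCovered G) (hJ : singularIdeal G = ⊥)
    {ι : Type*} [Fintype ι] {s : ι → OpFamily G} (hs : ∀ j, MemReduced (s j))
    (hsa : ∀ j x, IsSelfAdjoint (s j x)) {x : UnitSpace G} (ξ : L2 (Fiber x)) {δ : ℝ}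
    (hδ : 0 < δ) :
    ∃ (n : ℕ) (c : Fin n → UnitSpace G) (ψ : ∀ i, L2 (Fiber (c i))),
      (∀ i, c i ∈ hausdorffUnits G) ∧
      ∀ j, |∑ i, (inner ℂ (ψ i) (s j (c i) (ψ i))).re - (inner ℂ ξ (s j x ξ)).re| < δ := by
  classical
  let v : ∀ c, L2 (Fiber c) → ι → ℝ := fun c ψ j => (inner ℂ ψ (s j c ψ)).re
  have hv : ∀ (c : UnitSpace G) (ψ : L2 (Fiber c)) (t : ℝ), v c ((t : ℂ) • ψ) = t ^ 2 • v c ψ := by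
    intro c ψ t
    funext j
    simp only [v, map_smul, inner_smul_left, inner_smul_right, Complex.conj_ofReal, Pi.smul_apply,
      smul_eq_mul, Complex.re_ofReal_mul]
    ring
  let V : Set (ι → ℝ) := {w | ∃ c ∈ hausdorffUnits G, ∃ ψ, w = v c ψ}
  have hmem : v x ξ ∈ closure (convexHull ℝ V) := by
    by_contra hnot
    obtain ⟨f, u, hfx, hfu⟩ := geometric_hahn_banach_point_closed
      (convex_convexHull ℝ V).closure isClosed_closure hnot
    have hfV : ∀ c ∈ hausdorffUnits G, ∀ ψ, u < f (v c ψ) := fun c hc ψ =>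
      hfu _ (subset_closure (subset_convexHull ℝ V ⟨c, hc, ψ, rfl⟩))
    have hu : u < 0 := by
      obtain ⟨c, hc⟩ := (dense_hausdorffUnits hG).nonempty_iff.2 ⟨x⟩
      have h1 := hfV c hc (((0 : ℝ) : ℂ) • 0)
      rwa [hv, zero_pow two_ne_zero, zero_smul, map_zero] at h1
    let a : ι → ℝ := fun j => f fun k => if j = k then 1 else 0
    let T : OpFamily G := fun c => ∑ j, (a j : ℂ) • s j c
    have hT : MemReduced T := MemReduced.sum _ fun j _ => (hs j).smul _
    have hTsa : ∀ c, IsSelfAdjoint (T c) := fun c =>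
      isSelfAdjoint_sum _ fun j _ => IsSelfAdjoint.smul (Complex.conj_ofReal (a j)) (hsa j c)
    have hfT : ∀ c (ψ : L2 (Fiber c)), (inner ℂ ψ (T c ψ)).re = f (v c ψ) := by
      intro c ψ
      have h1 := f.toLinearMap.pi_apply_eq_sum_univ (v c ψ)
      refine Eq.trans ?_ h1.symm
      simp only [T, sum_apply, smul_apply, inner_sum,
        inner_smul_right, Complex.re_sum, Complex.re_ofReal_mul]
      exact Finset.sum_congr rfl fun j _ => mul_comm _ _
    have hpos : ∀ c ∈ hausdorffUnits G, negPartOp (T c) = 0 := by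
      intro c hc
      refine (negPartOp_eq_zero_iff (hTsa c)).2 fun ψ => ?_
      rw [hfT]
      by_contra! hneg
      -- By homogeneity, `f` takes the value `u` at a multiple of `ψ`.
      have h1 := hfV c hc ((Real.sqrt (u / f (v c ψ)) : ℂ) • ψ)
      rw [hv, map_smul, Real.sq_sqrt (div_nonneg_of_nonpos hu.le hneg.le), smul_eq_mul,
        div_mul_cancel₀ _ hneg.ne] at h1
      exact lt_irrefl _ h1
    have h1 := (negPartOp_eq_zero_iff (hTsa x)).1
      ((hT.negPart hTsa).eq_zero hG hJ hpos x) ξ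
    rw [hfT] at h1
    linarith
  obtain ⟨w, hw, hdist⟩ := Metric.mem_closure_iff.1 hmem δ hδ
  obtain ⟨κ, _, t, z, ht, -, hz, hsum⟩ := mem_convexHull_iff_exists_fintype.1 hw
  choose c hc ψ hzψ using hz
  let e := (Fintype.equivFin κ).symm
  refine ⟨Fintype.card κ, fun i => c (e i), fun i => (Real.sqrt (t (e i)) : ℂ) • ψ (e i),
    fun i => hc _, fun j => ?_⟩
  have h1 : ∑ i, v (c (e i)) ((Real.sqrt (t (e i)) : ℂ) • ψ (e i)) j = w j := by
    rw [e.sum_comp fun k => v (c k) ((Real.sqrt (t k) : ℂ) • ψ k) j, ← hsum, Finset.sum_apply]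
    refine Finset.sum_congr rfl fun k _ => ?_
    rw [hv, Real.sq_sqrt (ht k), hzψ]
  have h2 : |w j - v x ξ j| < δ := by
    rw [← Real.dist_eq, dist_comm]
    exact (dist_le_pi_dist _ _ j).trans_lt hdist
  rw [← h1] at h2
  exact h2

theorem re_inner_add_star_self {H : Type*} [NormedAddCommGroup H] [InnerProductSpace ℂ H]
    [CompleteSpace H] (T : H →L[ℂ] H) (ψ : H) :
    (inner ℂ ψ ((T + star T) ψ)).re = 2 * (inner ℂ ψ (T ψ)).re := by
  rw [add_apply, inner_add_right, ContinuousLinearMap.star_eq_adjoint,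
    ContinuousLinearMap.adjoint_inner_right, ← inner_conj_symm (T ψ) ψ, Complex.add_re,
    Complex.conj_re, two_mul]

/-- The complex form of `exists_abs_sum_re_inner_sub_lt`, for elements that need not be
self-adjoint. -/
theorem exists_norm_sum_inner_sub_lt (hG : CountablyCovered G) (hJ : singularIdeal G = ⊥)
    {ι : Type*} [Fintype ι] {T : ι → OpFamily G} (hT : ∀ j, MemReduced (T j))
    {x : UnitSpace G} (ξ : L2 (Fiber x)) {δ : ℝ} (hδ : 0 < δ) :
    ∃ (n : ℕ) (c : Fin n → UnitSpace G) (ψ : ∀ i, L2 (Fiber (c i))),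
      (∀ i, c i ∈ hausdorffUnits G) ∧
      ∀ j, ‖∑ i, inner ℂ (ψ i) (T j (c i) (ψ i)) - inner ℂ ξ (T j x ξ)‖ < δ := by
  let S : ι ⊕ ι → OpFamily G := Sum.elim T fun j c => Complex.I • T j c
  have hS : ∀ j, MemReduced (S j) := by
    rintro (j | j)
    · exact hT j
    · exact (hT j).smul _
  obtain ⟨n, c, ψ, hc, h⟩ := exists_abs_sum_re_inner_sub_lt hG hJ
    (s := fun j c => S j c + star (S j c)) (fun j => (hS j).add (hS j).star)
    (fun j c => IsSelfAdjoint.add_star_self (S j c)) ξ hδ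
  refine ⟨n, c, ψ, hc, fun j => ?_⟩
  have h1 := h (Sum.inl j)
  have h2 := h (Sum.inr j)
  simp only [re_inner_add_star_self, ← Finset.mul_sum, ← mul_sub, abs_mul, abs_two] at h1 h2
  refine (Complex.norm_le_abs_re_add_abs_im _).trans_lt ?_
  simp only [S, Sum.elim_inl, Sum.elim_inr, smul_apply, inner_smul_right,
    Complex.I_mul_re, Finset.sum_neg_distrib] at h1 h2
  rw [Complex.sub_re, Complex.sub_im, Complex.re_sum, Complex.im_sum]
  rw [neg_sub_neg, abs_sub_comm] at h2
  linarith

end Functionals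

/-! ### Transport to the coset spaces -/

section Transport

variable {G : Type u} [TopologicalSpace G] [ArrowGroupoid G] [EtaleGroupoid G]

theorem translate_singletonEssFiber {y : UnitSpace G} (hy : y ∈ hausdorffUnits G) {h : G}
    (hh : src h = y) : translate h ((singletonEssFiber hy).1 : Set G) = {h} := by
  change (fun a => h * a) '' {y.val} = {h}
  rw [Set.image_singleton, mul_unit hh]

/-- Over a Hausdorff unit `r(k)`, right translation by `k` identifies the cosets of the trivial
subgroup with the arrows in `G_{s(k)}`. -/
noncomputable def cosetEquiv {c : UnitSpace G} (k : Fiber c) (hk : rng k.1 ∈ hausdorffUnits G) :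
    CosetSpace (singletonEssFiber hk) ≃ Fiber c where
  toFun Y := ⟨Y.2.choose * k.1, by rw [src_mul Y.2.choose_spec.1, k.2]⟩
  invFun h := ⟨translate (h.1 * k.1⁻¹) _, h.1 * k.1⁻¹, src_mul_inv_fiber h k, rfl⟩
  left_inv Y := by
    apply Subtype.ext
    change translate (Y.2.choose * k.1 * k.1⁻¹) _ = Y.1
    rw [mul_inv_cancel_right Y.2.choose_spec.1]
    exact Y.2.choose_spec.2.symm
  right_inv h := by
    apply Subtype.ext
    let Y : CosetSpace (singletonEssFiber hk) :=
      ⟨translate (h.1 * k.1⁻¹) _, h.1 * k.1⁻¹, src_mul_inv_fiber h k, rfl⟩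
    change Y.2.choose * k.1 = h.1
    have h1 : translate (h.1 * k.1⁻¹) _ = _ := Y.2.choose_spec.2
    rw [translate_singletonEssFiber hk (src_mul_inv_fiber h k),
      translate_singletonEssFiber hk Y.2.choose_spec.1] at h1
    rw [← Set.singleton_eq_singleton_iff.1 h1, inv_mul_cancel_right (h.2.trans k.2.symm)]

theorem coe_cosetEquiv_symm {c : UnitSpace G} (k : Fiber c) (hk : rng k.1 ∈ hausdorffUnits G)
    (h : Fiber c) : ((cosetEquiv k hk).symm h).1 = {h.1 * k.1⁻¹} :=
  translate_singletonEssFiber hk (src_mul_inv_fiber h k)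

theorem movesTo_cosetEquiv_symm {c : UnitSpace G} (k : Fiber c) (hk : rng k.1 ∈ hausdorffUnits G)
    {V : OpenBisection G} {g h : Fiber c} (hV : g.1 * h.1⁻¹ ∈ V.carrier) :
    MovesTo V ((cosetEquiv k hk).symm h) ((cosetEquiv k hk).symm g) := by
  refine ⟨g.1 * h.1⁻¹, hV, h.1 * k.1⁻¹, src_mul_inv_fiber h k, ?_, rfl, ?_⟩
  · rw [src_mul_inv_fiber, rng_mul_inv_fiber]
  · change translate (g.1 * k.1⁻¹) _ = _
    rw [← mul_mul_mul (by rw [src_mul_inv_fiber]) (fiber_comp h k),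
      inv_mul_cancel_right (g.2.trans h.2.symm)]

theorem OpenBisection.pull_unit {x : UnitSpace G} (g : Fiber x) :
    (OpenBisection.unit G).pull g = g := by
  refine (OpenBisection.eq_pull _ ?_).symm
  rw [mul_inv_eq_rng]
  exact OpenBisection.val_mem_unit _

/-- The vector functional of a function `φ 1_V φ` at a Hausdorff unit, with `φ` supported in `U`, is
the vector functional of `1_V` at a vector over `U` in one of the coset spaces. -/
theorem exists_inner_bisectionOp_eq (hG : CountablyCovered G) {U : Set (UnitSpace G)}
    (hU : IsOpen U) (hne : U.Nonempty) {φ : UnitSpace G → ℝ} (hφU : ∀ t ∉ U, φ t = 0)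
    (hφ : IsCoefficient (OpenBisection.unit G) fun t => (φ t : ℂ)) {c : UnitSpace G}
    (hc : c ∈ hausdorffUnits G) (ψ : L2 (Fiber c)) :
    ∃ y ∈ U, ∃ (X : essFiber y) (η : L2 (CosetSpace X)),
      (∀ Y : CosetSpace X, η Y ≠ 0 → ∀ k ∈ Y.1, rng k ∈ U) ∧
      ∀ (V : OpenBisection G) (hV : IsCoefficient V fun t => (φ t : ℂ)),
        inner ℂ η (bisectionOp V X η) = inner ℂ ψ (hV.op c (hφ.op c ψ)) := by
  let χ := hφ.op c ψ
  have hχ : ∀ h : Fiber c, χ h = φ (rng h.1) * ψ h := fun h => by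
    rw [hφ.op_apply, OpenBisection.pull_unit]
  by_cases hk : ∃ k : Fiber c, rng k.1 ∈ U
  · obtain ⟨k, hkU⟩ := hk
    have hk := rng_mem_hausdorffUnits hG (h := k.1) (k.2.symm ▸ hc)
    let e := cosetEquiv k hk
    have h2 : 0 < (2 : ℝ≥0∞).toReal := by norm_num
    let η : L2 (CosetSpace (singletonEssFiber hk)) := ⟨fun Y => χ (e Y), memℓp_gen
      ((e.summable_iff (f := fun h => ‖χ h‖ ^ (2 : ℝ≥0∞).toReal)).2
        ((memℓp_gen_iff h2).1 χ.2))⟩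
    have hη : ∀ h, η (e.symm h) = χ h := fun h => congrArg χ (e.apply_symm_apply h)
    refine ⟨rng k.1, hkU, singletonEssFiber hk, η, fun Y hY l hl => ?_, fun V hV => ?_⟩
    · obtain ⟨h, rfl⟩ := e.symm.surjective Y
      rw [coe_cosetEquiv_symm k hk h, Set.mem_singleton_iff] at hl
      rw [hl, rng_mul_inv_fiber]
      by_contra hnot
      rw [hη, hχ, hφU _ hnot, Complex.ofReal_zero, zero_mul] at hY
      exact hY rfl
    · rw [lp.inner_eq_tsum, lp.inner_eq_tsum, ← e.symm.tsum_eq]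
      refine tsum_congr fun h => ?_
      rw [hη, hV.op_apply]
      by_cases h0 : φ (rng h.1) = 0
      · rw [hχ, h0, Complex.ofReal_zero, zero_mul, zero_mul, inner_zero_left, inner_zero_right]
      · have hr : rng h.1 ∈ rng '' V.carrier := by
          by_contra hnot
          exact h0 (Complex.ofReal_eq_zero.1 (hV.eq_zero hnot))
        have hm : MovesTo V (e.symm (V.pull h)) (e.symm h) :=
          movesTo_cosetEquiv_symm k hk (by rw [V.mul_inv_pull]; exact V.sec_mem hr)
        rw [bisectionOp_apply_of_movesTo hm, hη, hχ h, ← smul_eq_mul, ← smul_eq_mul,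
          inner_smul_left, inner_smul_right, Complex.conj_ofReal]
  · -- No arrow over `c` ends in `U`, so that `φ ψ = 0`.
    push Not at hk
    obtain ⟨y, hyU, hy⟩ := (dense_hausdorffUnits hG).inter_open_nonempty U hU hne
    refine ⟨y, hyU, singletonEssFiber hy, 0, fun Y hY => absurd rfl hY, fun V hV => ?_⟩
    have h0 : χ = 0 := by
      ext h
      rw [hχ, hφU _ (hk h), Complex.ofReal_zero, zero_mul]
      rfl
    change _ = inner ℂ ψ (hV.op c χ)
    rw [h0, inner_zero_left]
    exact ((congrArg (inner ℂ ψ) (map_zero (hV.op c))).trans (inner_zero_right ψ)).symm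

/-- The functions `φ²` and `φ 1_{B g} φ` have the values `1` and `0` at `x`, and they are
evaluated at the vectors that approximate the vector functional of `δ_x`. -/
theorem isGWeaklyContained_of_singularIdeal_eq_bot (hG : CountablyCovered G)
    (hJ : singularIdeal G = ⊥) {B : G → OpenBisection G} {x : UnitSpace G}
    (hB : ∀ g ∈ isotropy x, g ∈ (B g).carrier) : IsGWeaklyContained B x := by
  classical
  intro ε hε F hF U hU hxU hFU
  obtain ⟨φ, hφ1, hφU, hφ⟩ := exists_isCoefficient_eq_one hU hxU
  have hφ0 := hφ (OpenBisection.unit G) fun t _ => ⟨t.val, OpenBisection.val_mem_unit t, rng_val t⟩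
  have hφB : ∀ g : F, IsCoefficient (B g) fun t => (φ t : ℂ) := fun g =>
    hφ _ fun t ht => (hFU g g.2 ht).1
  let T : Option F → OpFamily G := fun j c =>
    j.elim (hφ0.op c * hφ0.op c) fun g => (hφB g).op c * hφ0.op c
  have hT : ∀ j, MemReduced (T j) := by
    rintro (_ | g)
    · exact hφ0.memReduced_op.mul hφ0.memReduced_op
    · exact (hφB g).memReduced_op.mul hφ0.memReduced_op
  let o : Fiber x := ⟨x.val, src_val x⟩
  have ho : rng o.1 = x := rng_val x
  have hT0 : inner ℂ (basisVec o) (T none x (basisVec o)) = 1 := by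
    rw [inner_basisVec_left]
    change hφ0.op x (hφ0.op x (basisVec o)) o = 1
    rw [hφ0.op_apply, hφ0.op_apply, OpenBisection.pull_unit, OpenBisection.pull_unit,
      basisVec_apply_self, ho, hφ1, Complex.ofReal_one, one_mul, one_mul]
  have hTg : ∀ g : F, inner ℂ (basisVec o) (T (some g) x (basisVec o)) = 0 := by
    intro g
    obtain ⟨hgx, hgne⟩ := hF g.2
    have hsec : (B g).sec x = g.1 := by
      rw [← hgx.2]
      exact (B g).sec_rng (hB _ hgx)
    rw [inner_basisVec_left]
    change (hφB g).op x (hφ0.op x (basisVec o)) o = 0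
    rw [(hφB g).op_apply, hφ0.op_apply, OpenBisection.pull_unit, basisVec_apply_ne, mul_zero,
      mul_zero]
    intro h
    have h1 := (B g).mul_inv_pull o
    rw [h, mul_inv_eq_rng, ho, hsec] at h1
    exact hgne h1.symm
  obtain ⟨n, c, ψ, hc, h⟩ := exists_norm_sum_inner_sub_lt hG hJ hT (basisVec o)
    (lt_min one_half_pos (half_pos hε))
  choose y hyU X η hηU hη using fun i =>
    exists_inner_bisectionOp_eq hG hU ⟨x, hxU⟩ hφU hφ0 (hc i) (ψ i)
  -- The normalising factor is bounded below, as the functional of `φ²` at `δ_x` equals `1`.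
  let N : ℝ := ∑ i, ‖η i‖ ^ 2
  have hN : ∑ i, inner ℂ (η i) (η i) = (N : ℂ) := by
    simp only [N, Complex.ofReal_sum, inner_self_eq_norm_sq_to_K, Complex.ofReal_pow]
    rfl
  have hN2 : 1 / 2 ≤ N := by
    have h1 := (h none).le.trans (min_le_left _ _)
    have h2 : ∑ i, inner ℂ (ψ i) (T none (c i) (ψ i)) = (N : ℂ) := by
      rw [← hN]
      refine Finset.sum_congr rfl fun i _ => ?_
      have h3 := hη i _ hφ0
      rw [bisectionOp_unit] at h3
      exact h3.symm
    rw [h2, hT0, ← Complex.ofReal_one, ← Complex.ofReal_sub, Complex.norm_real,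
      Real.norm_eq_abs] at h1
    linarith [(abs_le.1 h1).1]
  have hN0 : 0 < N := one_half_pos.trans_le hN2
  have key : ∀ V : OpenBisection G,
      ∑ i, inner ℂ (((Real.sqrt N)⁻¹ : ℂ) • η i)
        (bisectionOp V (X i) (((Real.sqrt N)⁻¹ : ℂ) • η i))
      = (N : ℂ)⁻¹ * ∑ i, inner ℂ (η i) (bisectionOp V (X i) (η i)) := by
    intro V
    rw [Finset.mul_sum]
    refine Finset.sum_congr rfl fun i _ => ?_
    rw [map_smul, inner_smul_left, inner_smul_right, ← mul_assoc, ← Complex.ofReal_inv,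
      Complex.conj_ofReal, ← Complex.ofReal_mul, ← mul_inv, Real.mul_self_sqrt hN0.le,
      Complex.ofReal_inv]
  refine ⟨n, y, X, fun i => ((Real.sqrt N)⁻¹ : ℂ) • η i, hyU, fun i Y hY => hηU i Y ?_, ?_, ?_⟩
  · intro h0
    apply hY
    rw [lp.coeFn_smul, Pi.smul_apply, h0, smul_zero]
  · have h1 := key (OpenBisection.unit G)
    simp only [bisectionOp_unit] at h1
    rw [h1, hN, inv_mul_cancel₀ (Complex.ofReal_ne_zero.2 hN0.ne')]
  · intro g hg
    have h1 := (h (some ⟨g, hg⟩)).le.trans (min_le_right _ _)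
    have h2 : ∑ i, inner ℂ (ψ i) (T (some ⟨g, hg⟩) (c i) (ψ i))
        = ∑ i, inner ℂ (η i) (bisectionOp (B g) (X i) (η i)) :=
      Finset.sum_congr rfl fun i _ => (hη i _ (hφB ⟨g, hg⟩)).symm
    rw [hTg, sub_zero, h2] at h1
    rw [key, norm_mul, norm_inv, Complex.norm_real, Real.norm_of_nonneg hN0.le]
    calc N⁻¹ * _ ≤ (1 / 2)⁻¹ * (ε / 2) := by gcongr
      _ = ε := by ring

end Transport

end EtaleGpd

theorem theoremB {G : Type*} [TopologicalSpace G] [EtaleGpd.ArrowGroupoid G]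
    [EtaleGpd.EtaleGroupoid G] (hG : EtaleGpd.CountablyCovered G)
    (B : G → EtaleGpd.OpenBisection G)
    (hB : ∀ x : EtaleGpd.UnitSpace G, ∀ g ∈ EtaleGpd.isotropy x, g ∈ (B g).carrier) :
    EtaleGpd.singularIdeal G = ⊥ ↔
      ∀ x : EtaleGpd.UnitSpace G, EtaleGpd.IsGWeaklyContained B x :=
  ⟨fun hJ x => EtaleGpd.isGWeaklyContained_of_singularIdeal_eq_bot hG hJ (hB x),
    EtaleGpd.singularIdeal_eq_bot_of_isGWeaklyContained hG hB⟩
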